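/- Let $a$, $a^\dagger$ be the annihilation and creation operators of a harmonic oscillator with Fock basis $(|n\rangle)_{n\ge 0}$, and let $D(\alpha)=\exp(\alpha a^\dagger-\alpha^* a)$, $S(\zeta)=\exp\big(\tfrac12(\zeta^* a^2-\zeta (a^\dagger)^2)\big)$ and $|\alpha,\zeta\rangle=D(\alpha)S(\zeta)|0\rangle$. Let $\theta>0$ and let $\beta_{gg},\beta_{ge},\beta_{eg},\beta_{ee}\in\mathbb C$ with $|\beta_{gg}|^2+|\beta_{ge}|^2+|\beta_{eg}|^2+|\beta_{ee}|^2=1$, $|\beta_{ee}|<|\beta_{gg}|$, $\beta_{gg}=|\beta_{gg}|e^{i\phi_{gg}}$, $\beta_{ee}=|\beta_{ee}|e^{i\phi_{ee}}$, and put $\epsilon=\beta_{ge}+\beta_{eg}$. Consider the Lindblad master equation $$\frac{d\rho}{d\tau}=-i[H,\rho]+L_1\rho L_1^\dagger-\tfrac12\big(L_1^\dagger L_1\rho+\rho L_1^\dagger L_1\big),\qquad H=-i\theta(Q-Q^\dagger),$$ $$Q=\big[\beta_{gg}(\beta_{ge}^*+\beta_{eg}^*)+\beta_{ee}^*(\beta_{ge}+\beta_{eg})\big]a,\qquad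 L_1=\sqrt2\,\theta(\beta_{gg}a-\beta_{ee}a^\dagger),$$ whose solutions are curves of density operators ($\tau\ge 0$) that satisfy the equation weakly, i.e. for all matrix elements between finite linear combinations of Fock states. Let $r,\phi_r\in\mathbb R$, $\alpha\in\mathbb C$ be given by $$\tanh(-r)=\frac{|\beta_{ee}|}{|\beta_{gg}|},\qquad \phi_r=\phi_{ee}-\phi_{gg}\ (\mathrm{mod}\ 2\pi),\qquad \alpha=\frac{\epsilon\beta_{gg}^*+\epsilon^*\beta_{ee}}{\theta(|\beta_{gg}|^2-|\beta_{ee}|^2)},$$ and let $\zeta=re^{i\phi_r}$, $|\psi\rangle=|\alpha,\zeta\rangle$ and $\kappa=2\theta^2(|\beta_{gg}|^2-|\beta_{ee}|^2)$. Then the equation stabilises $|\psi\rangle$ with convergence rate $\kappa$, in the following sense. 1. $|\psi\rangle\langle\psi|$ is a steady state, and from every initial density operator the equation has a solution. 2. Every solution $\rho$ converges to $|\psi\rangle\langle\psi|$ in trace norm as $\tau\to\infty$. 3. Let $n(\rho)=\sum_{n\ge0} n\,\langle n|S(\zeta)^\dagger D(\alpha)^\dagger\rho D(\alpha)S(\zeta)|n\rangle\in[0,\infty]$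 be the mean number of excitations above $|\psi\rangle$. For every solution $\rho$ and every $\tau\ge0$, $$n(\rho(\tau))=e^{-\kappa\tau}\,n(\rho(0)),\qquad 1-\langle\psi|\rho(\tau)|\psi\rangle\le e^{-\kappa\tau}\,n(\rho(0)),$$ and $e^{\kappa\tau}\big(1-\langle\psi|\rho(\tau)|\psi\rangle\big)\to n(\rho(0))$ as $\tau\to\infty$, in $[0,\infty]$. -/

import Mathlib

open scoped ComplexConjugate ENNReal Topology InnerProductSpace

noncomputable section

namespace Oscillator

/-- The Hilbert space `ℓ²(ℕ, ℂ)` of the harmonic oscillator, in the Fock (photon number)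
representation. -/
abbrev FockSpace : Type := lp (fun _ : ℕ => ℂ) 2

/-- The Fock state `|n⟩`. -/
def fock (n : ℕ) : FockSpace := lp.single 2 n (1 : ℂ)

/-- The dense space of finite linear combinations of Fock states. -/
abbrev FiniteFock : Type := ℕ →₀ ℂ

/-- The inclusion of the finite linear combinations of Fock states into the Hilbert space. -/
def toFock : FiniteFock →ₗ[ℂ] FockSpace := Finsupp.linearCombination ℂ fock

/-- (Possibly unbounded) operators with invariant dense domain `FiniteFock`. Products are
compositions. -/
abbrev Op : Type := Module.End ℂ FiniteFock

/-- The annihilation operator: `a |n⟩ = √n |n - 1⟩`, and `a |0⟩ = 0`. -/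
def ann : Op := Finsupp.linearCombination ℂ fun n : ℕ => Finsupp.single (n - 1) ((√(n : ℝ) : ℝ) : ℂ)

/-- The creation operator: `a† |n⟩ = √(n + 1) |n + 1⟩`. -/
def cre : Op :=
  Finsupp.linearCombination ℂ fun n : ℕ => Finsupp.single (n + 1) ((√((n : ℝ) + 1) : ℝ) : ℂ)

/-- `S` is the adjoint of `T` on the finite linear combinations of Fock states. -/
def IsAdjointOp (S T : Op) : Prop :=
  ∀ f g : FiniteFock, ⟪toFock (S f), toFock g⟫_ℂ = ⟪toFock f, toFock (T g)⟫_ℂ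

open Classical in
/-- The adjoint `T†` of an operator `T` (zero if there is none on the domain `FiniteFock`). -/
def dag (T : Op) : Op := if h : ∃ S, IsAdjointOp S T then h.choose else 0

/-- `U` is a one-parameter unitary group whose generator extends the operator `X`. The
derivative at `0` on the dense domain and unitarity give strong continuity. -/
structure IsUnitaryGroup (X : Op) (U : ℝ → FockSpace →L[ℂ] FockSpace) : Prop where
  map_add : ∀ s t, U (s + t) = U s * U t
  unitary : ∀ s, U s ∈ unitary (FockSpace →L[ℂ] FockSpace)
  hasDerivAt_zero : ∀ f : FiniteFock, HasDerivAt (fun s => U s (toFock f)) (toFock (X f)) 0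

open Classical in
/-- The exponential `exp X` of an essentially skew-adjoint operator `X`: the value at time `1` of
the unique one-parameter unitary group generated by `X` (zero if there is no unique one). -/
def expOp (X : Op) : FockSpace →L[ℂ] FockSpace :=
  if h : ∃! U, IsUnitaryGroup X U then h.exists.choose 1 else 0

/-- The displacement operator `D(α) = exp(α a† - α* a)`. -/
def displacement (α : ℂ) : FockSpace →L[ℂ] FockSpace := expOp (α • cre - conj α • ann)

/-- The squeezing operator `S(ζ) = exp((ζ* a² - ζ (a†)²) / 2)`. -/
def squeezing (ζ : ℂ) : FockSpace →L[ℂ] FockSpace :=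
  expOp ((1 / 2 : ℂ) • (conj ζ • ann ^ 2 - ζ • cre ^ 2))

/-- The displaced squeezed Fock state `D(α) S(ζ) |n⟩`. -/
def squeezedFock (α ζ : ℂ) (n : ℕ) : FockSpace := displacement α (squeezing ζ (fock n))

/-- The displaced squeezed state `|α, ζ⟩ = D(α) S(ζ) |0⟩`. -/
def squeezedState (α ζ : ℂ) : FockSpace := squeezedFock α ζ 0

/-- The operator `|ψ⟩⟨ψ|`. -/
def proj (ψ : FockSpace) : FockSpace →L[ℂ] FockSpace := InnerProductSpace.rankOne ℂ ψ ψ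

/-- Density operators: positive operators of trace one. -/
def IsDensity (ρ : FockSpace →L[ℂ] FockSpace) : Prop :=
  ρ.IsPositive ∧ HasSum (fun n => ⟪fock n, ρ (fock n)⟫_ℂ) 1

/-- The absolute value `|T| = √(T† T)` of a bounded operator on a Hilbert space. -/
def absOp {E : Type*} [NormedAddCommGroup E] [InnerProductSpace ℂ E] [CompleteSpace E]
    (T : E →L[ℂ] E) : E →L[ℂ] E := CFC.abs T

/-- The trace norm `tr |T|`, with `|T| = √(T† T)`. -/
def traceNorm (T : FockSpace →L[ℂ] FockSpace) : ℝ≥0∞ :=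
  ∑' n, ENNReal.ofReal (⟪fock n, absOp T (fock n)⟫_ℂ).re

/-- The sesquilinear form `⟨f| (-i [H, ρ] + L ρ L† - (L† L ρ + ρ L† L) / 2) |g⟩` of the
Lindblad generator with Hamiltonian `H` and coupling operator `L`. -/
def lindbladForm (H L : Op) (ρ : FockSpace →L[ℂ] FockSpace) (f g : FiniteFock) : ℂ :=
  -Complex.I * (⟪toFock (dag H f), ρ (toFock g)⟫_ℂ - ⟪toFock f, ρ (toFock (H g))⟫_ℂ)
    + (⟪toFock (dag L f), ρ (toFock (dag L g))⟫_ℂ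
      - (1 / 2) * (⟪toFock ((dag L * L) f), ρ (toFock g)⟫_ℂ
        + ⟪toFock f, ρ (toFock ((dag L * L) g))⟫_ℂ))

/-- `ρ` is a solution, for times `τ ≥ 0`, of the Lindblad master equation
`dρ/dτ = -i [H, ρ] + L ρ L† - (L† L ρ + ρ L† L) / 2`: a curve of density operators that satisfies
the equation in the weak sense, tested against finite linear combinations of Fock states. -/
def IsLindbladSolution (H L : Op) (ρ : ℝ → FockSpace →L[ℂ] FockSpace) : Prop :=
  (∀ τ, 0 ≤ τ → IsDensity (ρ τ)) ∧
    ∀ f g : FiniteFock, ∀ τ, 0 ≤ τ →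
      HasDerivWithinAt (fun s => ⟪toFock f, ρ s (toFock g)⟫_ℂ) (lindbladForm H L (ρ τ) f g)
        (Set.Ici 0) τ

/-- The operator `Q = [β_gg (β_ge* + β_eg*) + β_ee* (β_ge + β_eg)] a`. -/
def opQ (βgg βge βeg βee : ℂ) : Op :=
  (βgg * (conj βge + conj βeg) + conj βee * (βge + βeg)) • ann

/-- The Hamiltonian `H = -i θ (Q - Q†)`. -/
def opH (θ : ℝ) (βgg βge βeg βee : ℂ) : Op :=
  (-Complex.I * (θ : ℂ)) • (opQ βgg βge βeg βee - dag (opQ βgg βge βeg βee))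

/-- The coupling operator `L₁ = √2 θ (β_gg a - β_ee a†)`. -/
def opL (θ : ℝ) (βgg βee : ℂ) : Op := (((√2 * θ : ℝ)) : ℂ) • (βgg • ann - βee • cre)

/-- The population `⟨ψ|ρ|ψ⟩` of the state `ψ`. -/
def population (ψ : FockSpace) (ρ : FockSpace →L[ℂ] FockSpace) : ℝ := (⟪ψ, ρ ψ⟫_ℂ).re

/-- The mean number of excitations above the displaced squeezed state,
`tr (N S(ζ)† D(α)† ρ D(α) S(ζ)) = ∑ n, n ⟨n| S(ζ)† D(α)† ρ D(α) S(ζ) |n⟩`, possibly infinite. -/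
def meanExcitation (α ζ : ℂ) (ρ : FockSpace →L[ℂ] FockSpace) : ℝ≥0∞ :=
  ∑' n : ℕ, (n : ℝ≥0∞) * ENNReal.ofReal (population (squeezedFock α ζ n) ρ)

theorem inner_toFock_single (m : ℕ) (c : ℂ) (g : FiniteFock) :
    ⟪toFock (Finsupp.single m c), toFock g⟫_ℂ = conj c * g m := by
  induction g using Finsupp.induction_linear with
  | zero => simp
  | add f g hf hg => simp only [map_add, inner_add_right, hf, hg, Finsupp.add_apply]; ring
  | single n d =>
    simp only [toFock, Finsupp.linearCombination_single, fock, inner_smul_left, inner_smul_right,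
      lp.inner_single_left, lp.single_apply, Finsupp.single_apply, Pi.single_apply]
    by_cases h : m = n
    · subst h; simp [mul_comm]
    · simp [h, Ne.symm h]

/-- The adjoint is unique, so `dag T` is the adjoint as soon as there is one. -/
theorem dag_eq {S T : Op} (h : IsAdjointOp S T) : dag T = S := by
  have hex : ∃ S, IsAdjointOp S T := ⟨S, h⟩
  have hd : dag T = hex.choose := by simp [dag, hex]
  rw [hd]
  ext n m
  have h1 := hex.choose_spec (Finsupp.single n 1) (Finsupp.single m 1)
  rw [← h (Finsupp.single n 1) (Finsupp.single m 1)] at h1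
  have h2 := congrArg conj h1
  rw [inner_conj_symm, inner_conj_symm, inner_toFock_single, inner_toFock_single] at h2
  simpa using h2

theorem isAdjointOp_cre_ann : IsAdjointOp cre ann := by
  intro f g
  induction f using Finsupp.induction_linear with
  | zero => simp
  | add f f' hf hf' => simp only [map_add, inner_add_left, hf, hf']
  | single n c =>
    induction g using Finsupp.induction_linear with
    | zero => simp
    | add f f' hf hf' => simp only [map_add, inner_add_right, hf, hf']
    | single m d =>
      rw [cre, ann, Finsupp.linearCombination_single, Finsupp.linearCombination_single,
        Finsupp.smul_single, inner_toFock_single, inner_toFock_single]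
      rcases m with _ | m
      · simp
      · by_cases h : m = n
        · subst h; simp; ring
        · simp [h]

theorem dag_ann : dag ann = cre := dag_eq isAdjointOp_cre_ann

end Oscillator

end

open Oscillator

noncomputable section

namespace Oscillator

open Filter

/-! Put `U = D(α) S(ζ)`, write `ζ = r e` with `|e| = 1`, and let `C = cosh r`, `s = e sinh r`. Then
`U† a U = C a - s a† + α`. The relation between `r`, `φ_r` and the coefficients says exactly that
`L₁ = μ (C a + s a†)` with `|μ|² = κ`, so `U† L₁ U = μ a + c` for a scalar `c`. The value of `α` is
the one for which the transformed Hamiltonian cancels the effect of `c` (`lindbladForm_gauge`). In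
this frame the equation is therefore pure amplitude damping with coupling `μ a`, and `|ψ⟩` becomes
the vacuum (`isLindbladSolution_iff_damping`).

For the damped oscillator the populations obey a closed system, `p_n' = κ ((n+1) p_{n+1} - n p_n)`.
Following characteristics, the generating function satisfies `G_τ(z) = G_0(1 - (1-z) e^{-κτ})`. At
`z = 0` this gives the vacuum population, and its difference quotient at `z = 1` gives the mean
excitation number; all the rates follow, including the case of an infinite mean. A solution with
given initial state is written down in Kraus form. Trace norm convergence follows from that of the
population alone, because the negative part of `ρ - |ψ⟩⟨ψ|` has rank at most one
(`traceNorm_sub_proj`).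

The analytic work is with unbounded operators. The generators have degree at most two in `a`, `a†`,
so finite Fock vectors are analytic: `‖X^k f‖ ≤ K M^k k!` with `M` independent of `f`. This yields
uniqueness and existence of the unitary groups behind `expOp`, and the formula for `U† a U`, first
for small times and then for all times by the group law. Since `U f` is not a finite vector, it is
not an admissible test vector for the weak equation; it is approximated by truncations, and the
limit is uniform in time because density operators have norm at most one. -/

/-! ### Coordinates, truncations and ladder operators -/

theorem inner_fock_left (n : ℕ) (x : FockSpace) : ⟪fock n, x⟫_ℂ = x n := by
  simp [fock, lp.inner_single_left]

theorem toFock_single (n : ℕ) (c : ℂ) : toFock (Finsupp.single n c) = c • fock n := by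
  simp [toFock]

@[simp] theorem toFock_apply (f : FiniteFock) (n : ℕ) : toFock f n = f n := by
  have h := inner_toFock_single n 1 f
  rw [toFock_single, one_smul, inner_fock_left] at h
  simpa using h

theorem hasSum_norm_sq (x : FockSpace) : HasSum (fun n => ‖x n‖ ^ 2) (‖x‖ ^ 2) := by
  have h := lp.hasSum_norm (p := 2) (by norm_num) x
  simpa using h

theorem norm_le_of_norm_coord_le {x y : FockSpace} {C : ℝ} (hC : 0 ≤ C)
    (h : ∀ n, ‖x n‖ ≤ C * ‖y n‖) : ‖x‖ ≤ C * ‖y‖ := by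
  refine abs_le_of_sq_le_sq' ?_ (by positivity) |>.2
  rw [mul_pow]
  refine hasSum_le (fun n => ?_) (hasSum_norm_sq x) ((hasSum_norm_sq y).mul_left (C ^ 2))
  rw [← mul_pow]
  exact pow_le_pow_left₀ (norm_nonneg _) (h n) 2

theorem norm_fock (n : ℕ) : ‖fock n‖ = 1 := by
  simp [fock, lp.norm_single]

theorem fock_apply (n m : ℕ) : fock n m = if m = n then 1 else 0 := by
  simp [fock, lp.single_apply, Pi.single_apply]

/-- The truncation of a vector to its first `k` coordinates. -/
def trunc (k : ℕ) : FockSpace →ₗ[ℂ] FiniteFock where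
  toFun x := ∑ j ∈ Finset.range k, Finsupp.single j (x j)
  map_add' x y := by simp [Finset.sum_add_distrib]
  map_smul' c x := by simp [Finset.smul_sum]

theorem trunc_apply (k : ℕ) (x : FockSpace) (n : ℕ) :
    trunc k x n = if n < k then x n else 0 := by
  simp [trunc, Finsupp.finsetSum_apply, Finsupp.single_apply]

theorem tendsto_toFock_trunc (x : FockSpace) :
    Tendsto (fun k => toFock (trunc k x)) atTop (𝓝 x) := by
  have h := (lp.hasSum_single (p := 2) (by norm_num) x).tendsto_sum_nat
  refine h.congr fun k => ?_
  simp [trunc, toFock_single, fock, ← lp.single_smul]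

theorem denseRange_toFock : DenseRange toFock := fun x =>
  mem_closure_of_tendsto (tendsto_toFock_trunc x) (Eventually.of_forall fun _ => ⟨_, rfl⟩)

theorem norm_toFock_trunc_le (k : ℕ) (x : FockSpace) : ‖toFock (trunc k x)‖ ≤ ‖x‖ := by
  have := norm_le_of_norm_coord_le (x := toFock (trunc k x)) (y := x) zero_le_one fun n => by
    rw [toFock_apply, trunc_apply]; split_ifs <;> simp
  simpa using this

theorem ann_apply (f : FiniteFock) (n : ℕ) : ann f n = ((√((n : ℝ) + 1) : ℝ) : ℂ) * f (n + 1) := by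
  induction f using Finsupp.induction_linear with
  | zero => simp
  | add f g hf hg => simp only [map_add, Finsupp.add_apply, hf, hg]; ring
  | single m c =>
    rw [ann, Finsupp.linearCombination_single, Finsupp.smul_single, Finsupp.single_apply,
      Finsupp.single_apply]
    rcases m with _ | m
    · simp
    · by_cases h : m = n
      · subst h; simp; ring
      · simp [h]

theorem cre_apply_zero (f : FiniteFock) : cre f 0 = 0 := by
  induction f using Finsupp.induction_linear with
  | zero => simp
  | add f g hf hg => simp only [map_add, Finsupp.add_apply, hf, hg]; ring
  | single m c => simp [cre, Finsupp.linearCombination_single]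

theorem cre_apply_succ (f : FiniteFock) (n : ℕ) :
    cre f (n + 1) = ((√((n : ℝ) + 1) : ℝ) : ℂ) * f n := by
  induction f using Finsupp.induction_linear with
  | zero => simp
  | add f g hf hg => simp only [map_add, Finsupp.add_apply, hf, hg]; ring
  | single m c =>
    rw [cre, Finsupp.linearCombination_single, Finsupp.smul_single, Finsupp.single_apply,
      Finsupp.single_apply]
    by_cases h : m = n
    · subst h; simp; ring
    · simp [h]

theorem isAdjointOp_ann_cre : IsAdjointOp ann cre := fun f g => by
  have h := congrArg conj (isAdjointOp_cre_ann g f)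
  rw [inner_conj_symm, inner_conj_symm] at h
  exact h.symm

theorem cre_ann_apply (f : FiniteFock) (n : ℕ) : cre (ann f) n = n * f n := by
  rcases n with _ | n
  · simp [cre_apply_zero]
  · rw [cre_apply_succ, ann_apply, ← mul_assoc, ← Complex.ofReal_mul,
      Real.mul_self_sqrt (by positivity)]
    push_cast; ring

theorem ann_cre_apply (f : FiniteFock) (n : ℕ) : ann (cre f) n = (n + 1) * f n := by
  rw [ann_apply, cre_apply_succ, ← mul_assoc, ← Complex.ofReal_mul,
    Real.mul_self_sqrt (by positivity)]
  push_cast; ring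

/-- The canonical commutation relation. -/
theorem ann_mul_cre : ann * cre = cre * ann + 1 := by
  refine LinearMap.ext fun f => Finsupp.ext fun n => ?_
  simp only [Module.End.mul_apply, LinearMap.add_apply, Finsupp.add_apply, ann_cre_apply,
    cre_ann_apply, Module.End.one_apply]
  ring

/-- Linear combinations of the Fock states `|0⟩, …, |m⟩`. -/
def fockLE (m : ℕ) : Submodule ℂ FiniteFock where
  carrier := {f | ∀ n, m < n → f n = 0}
  add_mem' hf hg n hn := by simp [hf n hn, hg n hn]
  zero_mem' n _ := by simp
  smul_mem' c f hf n hn := by simp [hf n hn]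

theorem fockLE_mono {m n : ℕ} (h : m ≤ n) : fockLE m ≤ fockLE n := fun _ hf k hk =>
  hf k (h.trans_lt hk)

theorem exists_mem_fockLE (f : FiniteFock) : ∃ m, f ∈ fockLE m := by
  refine ⟨f.support.sup id, fun n hn => ?_⟩
  by_contra h
  exact absurd (Finset.le_sup (f := id) (Finsupp.mem_support_iff.2 h)) (not_le.2 hn)

theorem ann_mem_fockLE {m : ℕ} {f : FiniteFock} (hf : f ∈ fockLE m) : ann f ∈ fockLE m :=
  fun n hn => by rw [ann_apply, hf (n + 1) (by omega), mul_zero]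

theorem cre_mem_fockLE {m : ℕ} {f : FiniteFock} (hf : f ∈ fockLE m) : cre f ∈ fockLE (m + 1) :=
  fun n hn => by
    rcases n with _ | n
    · omega
    · rw [cre_apply_succ, hf n (by omega), mul_zero]

/-- `‖a f‖² = ⟨a† a f, f⟩`, and the number operator is diagonal with entries at most `m` on `fockLE
m`. -/
theorem norm_ann_le {m : ℕ} {f : FiniteFock} (hf : f ∈ fockLE m) :
    ‖toFock (ann f)‖ ≤ √(m + 1) * ‖toFock f‖ := by
  refine abs_le_of_sq_le_sq' ?_ (by positivity) |>.2
  rw [mul_pow, Real.sq_sqrt (by positivity), ← inner_self_eq_norm_sq (𝕜 := ℂ)]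
  rw [← isAdjointOp_cre_ann (ann f) f]
  refine (Complex.re_le_norm _).trans ((norm_inner_le_norm _ _).trans ?_)
  rw [sq, ← mul_assoc]
  gcongr
  refine norm_le_of_norm_coord_le (by positivity) fun n => ?_
  rw [toFock_apply, toFock_apply, cre_ann_apply, norm_mul, Complex.norm_natCast]
  by_cases h : n ≤ m
  · gcongr; exact_mod_cast h.trans (Nat.le_succ m)
  · simp [hf n (not_le.1 h)]

theorem norm_cre_le {m : ℕ} {f : FiniteFock} (hf : f ∈ fockLE m) :
    ‖toFock (cre f)‖ ≤ √(m + 1) * ‖toFock f‖ := by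
  refine abs_le_of_sq_le_sq' ?_ (by positivity) |>.2
  rw [mul_pow, Real.sq_sqrt (by positivity), ← inner_self_eq_norm_sq (𝕜 := ℂ)]
  rw [← isAdjointOp_ann_cre (cre f) f]
  refine (Complex.re_le_norm _).trans ((norm_inner_le_norm _ _).trans ?_)
  rw [sq, ← mul_assoc]
  gcongr
  refine norm_le_of_norm_coord_le (by positivity) fun n => ?_
  rw [toFock_apply, toFock_apply, ann_cre_apply, norm_mul]
  by_cases h : n ≤ m
  · gcongr
    rw [← Nat.cast_one, ← Nat.cast_add, Complex.norm_natCast]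
    exact_mod_cast Nat.succ_le_succ h
  · simp [hf n (not_le.1 h)]

theorem IsAdjointOp.add {S S' T T' : Op} (h : IsAdjointOp S T) (h' : IsAdjointOp S' T') :
    IsAdjointOp (S + S') (T + T') := fun f g => by
  simp only [LinearMap.add_apply, map_add, inner_add_left, inner_add_right, h f g, h' f g]

theorem IsAdjointOp.smul {S T : Op} (h : IsAdjointOp S T) (c : ℂ) :
    IsAdjointOp (conj c • S) (c • T) := fun f g => by
  simp only [LinearMap.smul_apply, map_smul, inner_smul_left, inner_smul_right, h f g,
    Complex.conj_conj]

theorem IsAdjointOp.mul {S S' T T' : Op} (h : IsAdjointOp S T) (h' : IsAdjointOp S' T') :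
    IsAdjointOp (S' * S) (T * T') := fun f g => by
  rw [Module.End.mul_apply, Module.End.mul_apply, h' (S f) g, h f (T' g)]

theorem isAdjointOp_one : IsAdjointOp 1 1 := fun _ _ => rfl

/-! ### Uniqueness for chains of derivatives with factorial growth -/

section Taylor

variable {E : Type*} [NormedAddCommGroup E] [NormedSpace ℝ E]

/-- Every `φ k` vanishes at `0`, so the bound on `φ (k + n)` can be integrated `n` times, each
integration raising the power of `s`. -/
theorem norm_le_of_hasDerivAt_succ {φ : ℕ → ℝ → E}
    (hd : ∀ k s, HasDerivAt (φ k) (φ (k + 1) s) s) (h0 : ∀ k, φ k 0 = 0) {C M : ℝ}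
    (hb : ∀ k s, |s| ≤ 1 → ‖φ k s‖ ≤ C * M ^ k * k.factorial) (n : ℕ) :
    ∀ k s, 0 ≤ s → s ≤ 1 →
      ‖φ k s‖ ≤ C * M ^ (k + n) * (k + n).factorial * (s ^ n / n.factorial) := by
  induction n with
  | zero => intro k s hs hs1; simpa using hb k s (by rwa [abs_of_nonneg hs])
  | succ n ih =>
    intro k s hs hs1
    have hB : ∀ x : ℝ, HasDerivAt
        (fun x : ℝ => C * M ^ (k + 1 + n) * (k + 1 + n).factorial *
          (x ^ (n + 1) / (n + 1).factorial))
        (C * M ^ (k + 1 + n) * (k + 1 + n).factorial * (x ^ n / n.factorial)) x := fun x => by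
      refine HasDerivAt.const_mul _ ?_
      have h := (hasDerivAt_pow (n + 1) x).div_const ((n + 1).factorial : ℝ)
      convert! h using 1
      rw [Nat.factorial_succ]
      push_cast
      field_simp
    have h := image_norm_le_of_norm_deriv_right_le_deriv_boundary (f := φ k) (f' := φ (k + 1))
      (a := 0) (b := 1) (fun x _ => (hd k x).continuousAt.continuousWithinAt)
      (fun x _ => (hd k x).hasDerivWithinAt) (by simp [h0]) hB
      (fun x hx => ih (k + 1) x hx.1 hx.2.le) ⟨hs, hs1⟩
    rwa [show k + (n + 1) = k + 1 + n by omega]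

/-- For `k = 0` the two factorials of the iterated bound cancel and leave `C (M s)^n`, which tends
to zero within the radius `1 / M`. This replaces an analyticity argument and is used both for
uniqueness of groups and for Heisenberg evolution. -/
theorem eq_zero_of_hasDerivAt_succ {φ : ℕ → ℝ → E}
    (hd : ∀ k s, HasDerivAt (φ k) (φ (k + 1) s) s) (h0 : ∀ k, φ k 0 = 0) {C M : ℝ}
    (hb : ∀ k s, |s| ≤ 1 → ‖φ k s‖ ≤ C * M ^ k * k.factorial) (hM : 0 ≤ M) {s : ℝ}
    (hs : |s| ≤ 1) (hsM : M * |s| < 1) : φ 0 s = 0 := by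
  have key : ∀ {φ : ℕ → ℝ → E}, (∀ k s, HasDerivAt (φ k) (φ (k + 1) s) s) → (∀ k, φ k 0 = 0) →
      (∀ k s, |s| ≤ 1 → ‖φ k s‖ ≤ C * M ^ k * k.factorial) → φ 0 |s| = 0 := by
    intro φ hd h0 hb
    have hlim : Tendsto (fun n : ℕ => C * (M * |s|) ^ n) atTop (𝓝 (C * 0)) :=
      (tendsto_pow_atTop_nhds_zero_of_lt_one (by positivity) hsM).const_mul C
    rw [mul_zero] at hlim
    rw [← norm_le_zero_iff]
    refine ge_of_tendsto' hlim fun n => ?_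
    refine (norm_le_of_hasDerivAt_succ hd h0 hb n 0 |s| (abs_nonneg s) hs).trans_eq ?_
    rw [zero_add, mul_pow]
    field_simp
  rcases abs_choice s with h | h
  · rw [← h]; exact key hd h0 hb
  -- Negative times reduce to positive ones by reflection; the sign keeps the chain of derivatives
  -- intact.
  · have := key (φ := fun k s => (-1 : ℝ) ^ k • φ k (-s)) (fun k s => ?_) (by simp [h0])
      fun k s hs => ?_
    · simpa [h] using this
    · have := ((hd k (-s)).scomp s (hasDerivAt_neg s)).const_smul ((-1 : ℝ) ^ k)
      convert! this using 1
      rw [smul_smul, pow_succ]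
    · rw [norm_smul]
      simpa using hb k (-s) (by simpa using hs)

end Taylor

/-! ### Finite Fock vectors are analytic vectors -/

theorem factorial_add_le (m k : ℕ) :
    ((m + k).factorial : ℝ) ≤ m.factorial * 2 ^ m * 2 ^ k * k.factorial := by
  rw [← Nat.add_choose_mul_factorial_mul_factorial m k]
  have h : ((m + k).choose k : ℝ) ≤ 2 ^ (m + k) := by
    exact_mod_cast Nat.choose_le_two_pow (m + k) k
  push_cast
  rw [pow_add] at h
  calc ((m + k).choose k : ℝ) * m.factorial * k.factorial
      ≤ (2 ^ m * 2 ^ k) * m.factorial * k.factorial := by gcongr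
    _ = _ := by ring

/-- Operators that raise the photon number by at most two, with at most linear growth. -/
structure Banded (X : Op) (c : ℝ) : Prop where
  nonneg : 0 ≤ c
  mem : ∀ {m f}, f ∈ fockLE m → X f ∈ fockLE (m + 2)
  norm_le : ∀ {m f}, f ∈ fockLE m → ‖toFock (X f)‖ ≤ c * (m + 1) * ‖toFock f‖

theorem Banded.pow_mem {X : Op} {c : ℝ} (hX : Banded X c) {m : ℕ} {f : FiniteFock}
    (hf : f ∈ fockLE m) (k : ℕ) : (X ^ k) f ∈ fockLE (m + 2 * k) := by
  induction k with
  | zero => simpa using hf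
  | succ k ih => rw [pow_succ', Module.End.mul_apply]; exact hX.mem ih

/-- After `k` applications the level is at most `m + 2k`, so the next one costs `c (m + 2k + 1) ≤ 2c
(m + k + 1)`; these factors multiply up to a factorial. -/
theorem Banded.norm_pow_le {X : Op} {c : ℝ} (hX : Banded X c) {m : ℕ} {f : FiniteFock}
    (hf : f ∈ fockLE m) (k : ℕ) :
    ‖toFock ((X ^ k) f)‖ ≤ (2 * c) ^ k * (m + k).factorial * ‖toFock f‖ := by
  have hc := hX.nonneg
  induction k with
  | zero =>
    simp only [pow_zero, Module.End.one_apply, one_mul, add_zero]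
    exact le_mul_of_one_le_left (norm_nonneg _) (by exact_mod_cast Nat.factorial_pos m)
  | succ k ih =>
    rw [pow_succ' X, Module.End.mul_apply]
    refine (hX.norm_le (hX.pow_mem hf k)).trans ?_
    calc c * ((m + 2 * k : ℕ) + 1) * ‖toFock ((X ^ k) f)‖
        ≤ (2 * c * (m + k + 1)) * ((2 * c) ^ k * (m + k).factorial * ‖toFock f‖) := by
          gcongr ?_ * ?_
          push_cast
          have : (0 : ℝ) ≤ c * m := by positivity
          nlinarith
      _ = _ := by rw [← add_assoc, Nat.factorial_succ]; push_cast; ring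

/-- The rate `4c` does not depend on `f` or `m`; only the prefactor does. So one time interval works
for all finite vectors. -/
theorem Banded.norm_pow_le_factorial {X : Op} {c : ℝ} (hX : Banded X c) {m : ℕ} {f : FiniteFock}
    (hf : f ∈ fockLE m) (k : ℕ) : ‖toFock ((X ^ k) f)‖ ≤
      (m.factorial * 2 ^ m * ‖toFock f‖) * (4 * c) ^ k * k.factorial := by
  have hc := hX.nonneg
  refine (hX.norm_pow_le hf k).trans ?_
  calc (2 * c) ^ k * (m + k).factorial * ‖toFock f‖
      ≤ (2 * c) ^ k * (m.factorial * 2 ^ m * 2 ^ k * k.factorial) * ‖toFock f‖ := by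
        gcongr; exact factorial_add_le m k
    _ = _ := by rw [show 4 * c = 2 * c * 2 by ring, mul_pow (2 * c) 2]; ring

/-! ### Unitary groups: uniqueness -/

theorem norm_unitary_apply {U : FockSpace →L[ℂ] FockSpace}
    (hU : U ∈ unitary (FockSpace →L[ℂ] FockSpace)) (x : FockSpace) : ‖U x‖ = ‖x‖ :=
  ContinuousLinearMap.norm_map_of_mem_unitary hU x

theorem IsUnitaryGroup.map_zero {X : Op} {U : ℝ → FockSpace →L[ℂ] FockSpace}
    (hU : IsUnitaryGroup X U) : U 0 = 1 := by
  have h : U 0 = U 0 * U 0 := by simpa using hU.map_add 0 0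
  have h1 := Unitary.star_mul_self_of_mem (hU.unitary 0)
  calc U 0 = star (U 0) * U 0 * U 0 := by rw [h1, one_mul]
    _ = 1 := by rw [mul_assoc, ← h, h1]

theorem IsUnitaryGroup.hasDerivAt {X : Op} {U : ℝ → FockSpace →L[ℂ] FockSpace}
    (hU : IsUnitaryGroup X U) (f : FiniteFock) (s : ℝ) :
    HasDerivAt (fun s => U s (toFock f)) (U s (toFock (X f))) s := by
  have h1 : HasDerivAt (fun t => U t (toFock f)) (toFock (X f)) (s - s) := by
    rw [sub_self]; exact hU.hasDerivAt_zero f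
  have h2 := h1.comp_sub_const s s
  have h3 := ((U s).restrictScalars ℝ).hasFDerivAt.comp_hasDerivAt s h2
  refine h3.congr_of_eventuallyEq (Eventually.of_forall fun t => ?_)
  simp only [Function.comp_apply, ContinuousLinearMap.coe_restrictScalars']
  rw [← mul_apply_eq_comp, ← hU.map_add, add_sub_cancel]

theorem clm_ext_of_toFock {A B : FockSpace →L[ℂ] FockSpace}
    (h : ∀ f, A (toFock f) = B (toFock f)) : A = B :=
  ContinuousLinearMap.ext fun x => congrFun
    (denseRange_toFock.equalizer A.continuous B.continuous (funext h)) x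

theorem forall_of_small {P : ℝ → Prop} {δ : ℝ} (hδ : 0 < δ) (hsmall : ∀ s, |s| < δ → P s)
    (hadd : ∀ s t, P s → P t → P (s + t)) (s : ℝ) : P s := by
  have hmul : ∀ (n : ℕ) t, P t → P ((n + 1 : ℕ) * t) := by
    intro n t ht
    induction n with
    | zero => simpa using ht
    | succ n ih =>
      have := hadd _ _ ih ht
      convert! this using 1; push_cast; ring
  obtain ⟨n, hn⟩ := exists_nat_gt (|s| / δ)
  have hn' : |s| / δ < (n + 1 : ℕ) := hn.trans (by push_cast; linarith)
  have h := hmul n (s / (n + 1 : ℕ)) (hsmall _ ?_)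
  · rwa [mul_div_cancel₀] at h
    positivity
  · rw [abs_div, Nat.abs_cast, div_lt_iff₀ (by positivity)]
    rwa [div_lt_iff₀ hδ, mul_comm] at hn'

theorem exists_small (c : ℝ) : ∃ δ : ℝ, 0 < δ ∧ ∀ s, |s| < δ → |s| ≤ 1 ∧ c * |s| < 1 := by
  refine ⟨1 / (|c| + 1), by positivity, fun s hs => ?_⟩
  rw [lt_div_iff₀ (by positivity)] at hs
  have h1 : c * |s| ≤ |c| * |s| := mul_le_mul_of_nonneg_right (le_abs_self c) (abs_nonneg s)
  constructor <;> nlinarith [abs_nonneg c, abs_nonneg s, mul_nonneg (abs_nonneg c) (abs_nonneg s)]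

/-- The vectors `U s (X^k f) - V s (X^k f)` form a chain of derivatives vanishing at `s = 0`, with
factorial bounds since `U s` and `V s` are isometric. The groups thus agree for small times, and the
group law does the rest. -/
theorem IsUnitaryGroup.unique {X : Op} {c : ℝ} (hX : Banded X c)
    {U V : ℝ → FockSpace →L[ℂ] FockSpace} (hU : IsUnitaryGroup X U) (hV : IsUnitaryGroup X V) :
    U = V := by
  have hc := hX.nonneg
  obtain ⟨δ, hδ, hsmall⟩ := exists_small (4 * c)
  refine funext (forall_of_small hδ (fun s hs => clm_ext_of_toFock fun f => ?_) fun s t hs ht => ?_)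
  · obtain ⟨m, hf⟩ := exists_mem_fockLE f
    rw [← sub_eq_zero]
    refine eq_zero_of_hasDerivAt_succ
      (φ := fun k s => U s (toFock ((X ^ k) f)) - V s (toFock ((X ^ k) f)))
      (C := 2 * (m.factorial * 2 ^ m * ‖toFock f‖)) (M := 4 * c)
      (fun k s => ?_) (fun k => ?_) (fun k s _ => ?_) (by positivity) (hsmall s hs).1
      (hsmall s hs).2
    · rw [pow_succ', Module.End.mul_apply]
      exact (hU.hasDerivAt _ s).sub (hV.hasDerivAt _ s)
    · simp [hU.map_zero, hV.map_zero]
    · refine (norm_sub_le _ _).trans ?_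
      rw [norm_unitary_apply (hU.unitary s), norm_unitary_apply (hV.unitary s)]
      linarith [hX.norm_pow_le_factorial hf k]
  · rw [hU.map_add, hV.map_add, hs, ht]

/-! ### Unitary groups: existence by finite-rank truncation -/

/-- The truncation to the first `n` Fock states, on `FiniteFock`. -/
def truncOp (n : ℕ) : Op := trunc n ∘ₗ toFock

theorem truncOp_apply (n : ℕ) (f : FiniteFock) (k : ℕ) :
    truncOp n f k = if k < n then f k else 0 := by
  simp [truncOp, trunc_apply]

theorem truncOp_eq_self {m n : ℕ} (h : m < n) {f : FiniteFock} (hf : f ∈ fockLE m) :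
    truncOp n f = f := by
  ext k
  rw [truncOp_apply]
  split_ifs with hk
  · rfl
  · exact (hf k (by omega)).symm

theorem truncOp_mem {m : ℕ} (n : ℕ) {f : FiniteFock} (hf : f ∈ fockLE m) :
    truncOp n f ∈ fockLE m := fun k hk => by
  rw [truncOp_apply, hf k hk, ite_self]

theorem norm_truncOp_le (n : ℕ) (f : FiniteFock) : ‖toFock (truncOp n f)‖ ≤ ‖toFock f‖ :=
  norm_toFock_trunc_le n _

theorem isAdjointOp_truncOp (n : ℕ) : IsAdjointOp (truncOp n) (truncOp n) := fun f g => by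
  have h1 := lp.hasSum_inner (𝕜 := ℂ) (toFock (truncOp n f)) (toFock g)
  have h2 := lp.hasSum_inner (𝕜 := ℂ) (toFock f) (toFock (truncOp n g))
  refine h1.unique ?_
  convert! h2 using 2 with k
  simp only [toFock_apply, truncOp_apply]
  split_ifs <;> simp

theorem banded_truncOp {X : Op} {c : ℝ} (hX : Banded X c) (n : ℕ) :
    Banded (truncOp n * X * truncOp n) c where
  nonneg := hX.nonneg
  mem hf := truncOp_mem n (hX.mem (truncOp_mem n hf))
  norm_le {m f} hf := by
    have hc := hX.nonneg
    calc _ ≤ ‖toFock (X (truncOp n f))‖ := norm_truncOp_le n _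
      _ ≤ c * (m + 1) * ‖toFock (truncOp n f)‖ := hX.norm_le (truncOp_mem n hf)
      _ ≤ _ := by gcongr; exact norm_truncOp_le n f

/-- The first `k` applications starting at level `m` never leave level `m + 2k`, so the truncation
does not notice them: each Taylor coefficient is eventually constant in `n`. -/
theorem truncOp_pow_eq {X : Op} {c : ℝ} (hX : Banded X c) {m n k : ℕ} {f : FiniteFock}
    (hf : f ∈ fockLE m) (hn : m + 2 * k < n) :
    ((truncOp n * X * truncOp n) ^ k) f = (X ^ k) f := by
  induction k with
  | zero => simp
  | succ k ih =>
    rw [pow_succ', pow_succ', Module.End.mul_apply, Module.End.mul_apply, ih (by omega)]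
    simp only [Module.End.mul_apply]
    rw [truncOp_eq_self (m := m + 2 * k) (by omega) (hX.pow_mem hf k),
      truncOp_eq_self (m := m + 2 * k + 2) (by omega) (hX.mem (hX.pow_mem hf k))]

/-- The bounded extension of `truncOp n * X * truncOp n`. -/
def truncCLM (X : Op) (n : ℕ) : FockSpace →L[ℂ] FockSpace :=
  ∑ j ∈ Finset.range n,
    InnerProductSpace.rankOne ℂ (toFock (truncOp n (X (Finsupp.single j 1)))) (fock j)

theorem truncCLM_apply (X : Op) (n : ℕ) (x : FockSpace) :
    truncCLM X n x = toFock (truncOp n (X (trunc n x))) := by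
  simp only [truncCLM, sum_apply, InnerProductSpace.rankOne_apply,
    inner_fock_left, trunc, LinearMap.coe_mk, AddHom.coe_mk, map_sum]
  refine Finset.sum_congr rfl fun j _ => ?_
  rw [← map_smul, ← map_smul, ← map_smul, Finsupp.smul_single, smul_eq_mul, mul_one]

theorem truncCLM_toFock (X : Op) (n : ℕ) (f : FiniteFock) :
    truncCLM X n (toFock f) = toFock ((truncOp n * X * truncOp n) f) := truncCLM_apply X n _

theorem truncCLM_pow_toFock (X : Op) (n k : ℕ) (f : FiniteFock) :
    (truncCLM X n ^ k) (toFock f) = toFock (((truncOp n * X * truncOp n) ^ k) f) := by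
  induction k with
  | zero => simp
  | succ k ih =>
    rw [pow_succ', pow_succ', mul_apply_eq_comp, ih, truncCLM_toFock,
      Module.End.mul_apply _ (_ ^ k)]

theorem truncCLM_mem_skewAdjoint {X : Op} (hX : IsAdjointOp (-X) X) (n : ℕ) :
    truncCLM X n ∈ skewAdjoint (FockSpace →L[ℂ] FockSpace) := by
  rw [skewAdjoint.mem_iff, ContinuousLinearMap.star_eq_adjoint]
  refine ((ContinuousLinearMap.eq_adjoint_iff _ _).2 fun x y => ?_).symm
  have h := ((isAdjointOp_truncOp n).mul hX).mul (isAdjointOp_truncOp n)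
  have key : ∀ f g, ⟪(-truncCLM X n) (toFock f), toFock g⟫_ℂ =
      ⟪toFock f, truncCLM X n (toFock g)⟫_ℂ := fun f g => by
    rw [truncCLM_toFock, ← h f g, neg_apply, truncCLM_toFock]
    simp [mul_assoc]
  refine congrFun (denseRange_toFock.equalizer (g := fun x => ⟪(-truncCLM X n) x, y⟫_ℂ)
    (h := fun x => ⟪x, truncCLM X n y⟫_ℂ) (by fun_prop) (by fun_prop) (funext fun f => ?_)) x
  exact congrFun (denseRange_toFock.equalizer (g := fun y => ⟪(-truncCLM X n) (toFock f), y⟫_ℂ)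
    (h := fun y => ⟪toFock f, truncCLM X n y⟫_ℂ) (by fun_prop) (by fun_prop) (funext fun g =>
      key f g)) y

section Exp

variable {A : FockSpace →L[ℂ] FockSpace}

theorem exp_smul_mem_unitary (hA : A ∈ skewAdjoint (FockSpace →L[ℂ] FockSpace)) (t : ℝ) :
    NormedSpace.exp (t • A) ∈ unitary (FockSpace →L[ℂ] FockSpace) := by
  let _ := NormedAlgebra.restrictScalars ℚ ℝ (FockSpace →L[ℂ] FockSpace)
  refine NormedSpace.exp_mem_unitary_of_mem_skewAdjoint ?_
  rw [skewAdjoint.mem_iff] at hA ⊢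
  have h : t • A = (t : ℂ) • A := ContinuousLinearMap.ext fun x => (Complex.coe_smul t (A x)).symm
  rw [h, star_smul, hA, Complex.star_def, Complex.conj_ofReal, smul_neg]

theorem exp_add_smul (A : FockSpace →L[ℂ] FockSpace) (s t : ℝ) : NormedSpace.exp ((s + t) • A) =
    NormedSpace.exp (s • A) * NormedSpace.exp (t • A) := by
  let _ := NormedAlgebra.restrictScalars ℚ ℝ (FockSpace →L[ℂ] FockSpace)
  rw [add_smul, NormedSpace.exp_add_of_commute]
  exact ((Commute.refl A).smul_left s).smul_right t

theorem hasSum_exp_smul_apply (A : FockSpace →L[ℂ] FockSpace) (t : ℝ) (x : FockSpace) :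
    HasSum (fun k : ℕ => ((k.factorial : ℝ)⁻¹ * t ^ k) • (A ^ k) x)
      (NormedSpace.exp (t • A) x) := by
  have h := NormedSpace.exp_series_hasSum_exp' (𝕂 := ℝ) (t • A)
  have h2 := h.mapL (ContinuousLinearMap.apply ℂ FockSpace x)
  convert! h2 using 2 with k
  simp [smul_pow, smul_smul]

theorem hasDerivAt_exp_smul_apply (A : FockSpace →L[ℂ] FockSpace) (t : ℝ) (x : FockSpace) :
    HasDerivAt (fun t : ℝ => NormedSpace.exp (t • A) x) (NormedSpace.exp (t • A) (A x)) t := by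
  have h := hasDerivAt_exp_smul_const (𝕂 := ℝ) A t
  have h2 := (((ContinuousLinearMap.apply ℂ FockSpace x).restrictScalars ℝ).hasFDerivAt
    (x := NormedSpace.exp (t • A))).comp_hasDerivAt t h
  exact h2

theorem norm_exp_smul_apply_sub_le (hA : A ∈ skewAdjoint (FockSpace →L[ℂ] FockSpace)) (t : ℝ)
    (x : FockSpace) : ‖NormedSpace.exp (t • A) x - x‖ ≤ ‖A x‖ * |t| := by
  have h := (convex_univ).norm_image_sub_le_of_norm_hasDerivWithin_le
    (f := fun t : ℝ => NormedSpace.exp (t • A) x) (C := ‖A x‖)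
    (fun s _ => (hasDerivAt_exp_smul_apply A s x).hasDerivWithinAt)
    (fun s _ => (norm_unitary_apply (exp_smul_mem_unitary hA s) _).le)
    (Set.mem_univ 0) (Set.mem_univ t)
  simpa using h

/-- The bound involves `A` only through `A (A x)`. On a finite vector this is independent of the
truncation level once that is large, so the estimate survives the limit and gives the derivative at
`0`. -/
theorem norm_exp_smul_apply_sub_sub_le (hA : A ∈ skewAdjoint (FockSpace →L[ℂ] FockSpace)) (t : ℝ)
    (x : FockSpace) : ‖NormedSpace.exp (t • A) x - x - t • A x‖ ≤ ‖A (A x)‖ * t ^ 2 := by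
  have h := (convex_Icc (-|t|) |t|).norm_image_sub_le_of_norm_hasDerivWithin_le
    (f := fun t : ℝ => NormedSpace.exp (t • A) x - t • A x) (C := ‖A (A x)‖ * |t|) (x := 0) (y := t)
    (f' := fun s => NormedSpace.exp (s • A) (A x) - A x)
    (fun s _ => ((hasDerivAt_exp_smul_apply A s x).sub (by
      simpa using (hasDerivAt_id s).smul_const (A x))).hasDerivWithinAt)
    (fun s hs => (norm_exp_smul_apply_sub_le hA s _).trans
      (mul_le_mul_of_nonneg_left (abs_le.2 hs) (norm_nonneg _)))
      ⟨neg_nonpos.2 (abs_nonneg t), abs_nonneg t⟩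
    ⟨neg_abs_le t, le_abs_self t⟩
  rw [mul_assoc] at h
  simp only [zero_smul, NormedSpace.exp_zero, one_apply_eq_self, sub_zero,
    Real.norm_eq_abs, abs_mul_abs_self] at h
  rw [sub_right_comm, sq]
  exact h

end Exp

/-- The exponential series converges by dominated convergence: each term stabilises, and truncation
does not spoil the factorial bound, so a geometric series is a common majorant. -/
theorem tendsto_exp_truncCLM_toFock {X : Op} {c : ℝ} (hX : Banded X c) (f : FiniteFock) {t : ℝ}
    (ht : 4 * c * |t| < 1) : ∃ y, Tendsto (fun n => NormedSpace.exp (t • truncCLM X n) (toFock f))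
      atTop (𝓝 y) := by
  have hc := hX.nonneg
  obtain ⟨m, hf⟩ := exists_mem_fockLE f
  refine ⟨∑' k : ℕ, ((k.factorial : ℝ)⁻¹ * t ^ k) • toFock ((X ^ k) f), ?_⟩
  have : (fun n => NormedSpace.exp (t • truncCLM X n) (toFock f)) = fun n =>
      ∑' k : ℕ, ((k.factorial : ℝ)⁻¹ * t ^ k) • toFock (((truncOp n * X * truncOp n) ^ k) f) := by
    ext1 n
    rw [← (hasSum_exp_smul_apply (truncCLM X n) t (toFock f)).tsum_eq]
    simp only [truncCLM_pow_toFock]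
  rw [this]
  refine tendsto_tsum_of_dominated_convergence
    (bound := fun k => (m.factorial * 2 ^ m * ‖toFock f‖) * (4 * c * |t|) ^ k)
    ((summable_geometric_of_lt_one (by positivity) ht).mul_left _) (fun k => ?_)
    (Eventually.of_forall fun n k => ?_)
  · refine tendsto_const_nhds.congr' ?_
    filter_upwards [eventually_gt_atTop (m + 2 * k)] with n hn
    rw [truncOp_pow_eq hX hf hn]
  · rw [norm_smul, norm_mul, norm_inv, norm_pow, Real.norm_natCast, Real.norm_eq_abs]
    calc _ ≤ ((k.factorial : ℝ)⁻¹ * |t| ^ k) *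
          ((m.factorial * 2 ^ m * ‖toFock f‖) * (4 * c) ^ k * k.factorial) := by
          gcongr; exact (banded_truncOp hX n).norm_pow_le_factorial hf k
      _ = _ := by rw [mul_pow (4 * c)]; field_simp

theorem exists_tendsto_of_dense {B : ℕ → FockSpace →L[ℂ] FockSpace} (hB : ∀ n x, ‖B n x‖ = ‖x‖)
    (h : ∀ f, ∃ y, Tendsto (fun n => B n (toFock f)) atTop (𝓝 y)) (x : FockSpace) :
    ∃ y, Tendsto (fun n => B n x) atTop (𝓝 y) := by
  refine cauchySeq_tendsto_of_complete (Metric.cauchySeq_iff.2 fun ε hε => ?_)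
  obtain ⟨f, hf⟩ := denseRange_toFock.exists_dist_lt x (ε := ε / 3) (by positivity)
  obtain ⟨y, hy⟩ := h f
  obtain ⟨N, hN⟩ := Metric.cauchySeq_iff.1 hy.cauchySeq (ε / 3) (by positivity)
  have hd : ∀ n, dist (B n x) (B n (toFock f)) < ε / 3 := fun n => by
    rwa [dist_eq_norm, ← map_sub, hB, ← dist_eq_norm]
  refine ⟨N, fun m hm n hn => ?_⟩
  have h1 := hd m
  have h2 := hd n
  rw [dist_comm] at h2
  have h3 := dist_triangle4 (B m x) (B m (toFock f)) (B n (toFock f)) (B n x)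
  linarith [hN m hm n hn]

/-- The group is the strong limit of the unitary groups of the skew-adjoint truncations. The series
gives the limit on finite vectors for small times, isometry extends it to all vectors, and
composition extends it to all times. -/
theorem exists_isUnitaryGroup {X : Op} {c : ℝ} (hX : Banded X c) (hs : IsAdjointOp (-X) X) :
    ∃ U, IsUnitaryGroup X U := by
  set E : ℕ → ℝ → FockSpace →L[ℂ] FockSpace := fun n t => NormedSpace.exp (t • truncCLM X n)
  have hskew := truncCLM_mem_skewAdjoint hs
  have hE : ∀ n t x, ‖E n t x‖ = ‖x‖ := fun n t =>
    norm_unitary_apply (exp_smul_mem_unitary (hskew n) t)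
  have hmul : ∀ n s t x, E n (s + t) x = E n s (E n t x) := fun n s t x => by
    rw [← mul_apply_eq_comp]; exact congrArg (· x) (exp_add_smul _ s t)
  -- Since `E n s` is isometric, replacing `E n t x` by its limit `y` inside it costs an error that
  -- tends to zero.
  have hcomp : ∀ {s t x y z}, Tendsto (fun n => E n t x) atTop (𝓝 y) →
      Tendsto (fun n => E n s y) atTop (𝓝 z) → Tendsto (fun n => E n (s + t) x) atTop (𝓝 z) := by
    intro s t x y z h1 h2
    have h3 : Tendsto (fun n => E n s (E n t x - y)) atTop (𝓝 0) := by
      rw [tendsto_zero_iff_norm_tendsto_zero]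
      simp only [hE]
      exact tendsto_iff_norm_sub_tendsto_zero.1 h1
    have h4 := h3.add h2
    rw [zero_add] at h4
    refine h4.congr fun n => ?_
    rw [map_sub, sub_add_cancel, hmul]
  obtain ⟨δ, hδ, hsmall⟩ := exists_small (4 * c)
  have hlim : ∀ t x, ∃ y, Tendsto (fun n => E n t x) atTop (𝓝 y) := by
    refine forall_of_small hδ (fun t ht x => ?_) fun s t h1 h2 x => ?_
    · exact exists_tendsto_of_dense (B := fun n => E n t) (fun n x => hE n t x)
        (fun f => tendsto_exp_truncCLM_toFock hX f (hsmall t ht).2) x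
    · obtain ⟨y, hy⟩ := h2 x
      obtain ⟨z, hz⟩ := h1 y
      exact ⟨z, hcomp hy hz⟩
  choose W hW using hlim
  have hnorm : ∀ t x, ‖W t x‖ = ‖x‖ := fun t x =>
    tendsto_nhds_unique (hW t x).norm (by simpa only [hE] using tendsto_const_nhds)
  set U : ℝ → FockSpace →L[ℂ] FockSpace := fun t =>
    (linearMapOfTendsto (W t) (fun n => (E n t : FockSpace →ₗ[ℂ] FockSpace))
      (tendsto_pi_nhds.2 (hW t))).mkContinuous 1 (fun x => by simp [hnorm])
  have hUW : ∀ t x, U t x = W t x := fun t x => rfl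
  have hadd : ∀ s t, U (s + t) = U s * U t := fun s t => ContinuousLinearMap.ext fun x =>
    tendsto_nhds_unique (hW (s + t) x) (hcomp (hW t x) (hW s (W t x)))
  have hzero : U 0 = 1 := ContinuousLinearMap.ext fun x =>
    tendsto_nhds_unique (hW 0 x) (by simp [E])
  have hstar : ∀ t, star (U t) * U t = 1 := fun t =>
    (ContinuousLinearMap.norm_map_iff_adjoint_comp_self (U t)).1 (hnorm t)
  refine ⟨U, hadd, fun t => Unitary.mem_iff.2 ⟨hstar t, ?_⟩, fun f => ?_⟩
  -- A limit of unitaries is a priori only an isometry; the inverse `U (-t)` makes it surjective.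
  · have h1 : U t * U (-t) = 1 := by rw [← hadd, add_neg_cancel, hzero]
    have h2 : star (U t) = U (-t) := by
      rw [← mul_one (star (U t)), ← h1, ← mul_assoc, hstar, one_mul]
    rw [h2, h1]
  · obtain ⟨m, hf⟩ := exists_mem_fockLE f
    have hbound : ∀ t, ‖U t (toFock f) - toFock f - t • toFock (X f)‖ ≤
        ‖toFock (X (X f))‖ * t ^ 2 := fun t => by
      have h1 := (((hW t (toFock f)).sub_const (toFock f)).sub_const (t • toFock (X f))).norm
      refine le_of_tendsto h1 ?_
      filter_upwards [eventually_gt_atTop (m + 4)] with n hn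
      have h2 := norm_exp_smul_apply_sub_sub_le (hskew n) t (toFock f)
      have h3 := truncOp_pow_eq hX hf (k := 1) (n := n) (by omega)
      have h4 := truncOp_pow_eq hX hf (k := 2) (n := n) (by omega)
      have h5 : truncCLM X n (truncCLM X n (toFock f)) = toFock (X (X f)) := by
        have := truncCLM_pow_toFock X n 2 f
        rw [h4] at this
        simpa [sq] using this
      have h6 : truncCLM X n (toFock f) = toFock (X f) := by
        have := truncCLM_pow_toFock X n 1 f
        rw [h3] at this
        simpa using this
      rwa [h5, h6] at h2
    rw [hasDerivAt_iff_isLittleO_nhds_zero]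
    have h0 : ∀ h : ℝ, U (0 + h) (toFock f) - U 0 (toFock f) - h • toFock (X f) =
        U h (toFock f) - toFock f - h • toFock (X f) := fun h => by rw [zero_add, hzero]; rfl
    simp only [h0]
    refine (Asymptotics.IsBigO.of_bound ‖toFock (X (X f))‖ (Eventually.of_forall fun t => ?_) :
      _ =O[𝓝 0] fun t : ℝ => t ^ 2).trans_isLittleO ?_
    · simpa using hbound t
    · exact Asymptotics.isLittleO_pow_id one_lt_two

theorem IsUnitaryGroup.expOp_eq {X : Op} {c : ℝ} (hX : Banded X c)
    {U : ℝ → FockSpace →L[ℂ] FockSpace} (hU : IsUnitaryGroup X U) : expOp X = U 1 := by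
  have h : ∃! U, IsUnitaryGroup X U := ⟨U, hU, fun V hV => hV.unique hX hU⟩
  rw [expOp, dif_pos h, h.exists.choose_spec.unique hX hU]

/-! ### Affine operators in the ladder operators -/

/-- The operator `u a + v a† + w`. -/
def linOp (u v w : ℂ) : Op := u • ann + v • cre + w • 1

theorem linOp_apply (u v w : ℂ) (f : FiniteFock) :
    linOp u v w f = u • ann f + v • cre f + w • f := rfl

theorem isAdjointOp_linOp (u v w : ℂ) :
    IsAdjointOp (linOp (conj v) (conj u) (conj w)) (linOp u v w) := by
  have h := ((isAdjointOp_cre_ann.smul u).add (isAdjointOp_ann_cre.smul v)).add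
    (isAdjointOp_one.smul w)
  rwa [add_comm (conj u • cre)] at h

theorem dag_linOp (u v w : ℂ) : dag (linOp u v w) = linOp (conj v) (conj u) (conj w) :=
  dag_eq (isAdjointOp_linOp u v w)

theorem linOp_mem_fockLE (u v w : ℂ) {m : ℕ} {f : FiniteFock} (hf : f ∈ fockLE m) :
    linOp u v w f ∈ fockLE (m + 1) :=
  add_mem (add_mem (Submodule.smul_mem _ _ (fockLE_mono (by omega) (ann_mem_fockLE hf)))
    (Submodule.smul_mem _ _ (cre_mem_fockLE hf)))
    (Submodule.smul_mem _ _ (fockLE_mono (by omega) hf))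

theorem norm_linOp_le {u v w : ℂ} {m : ℕ} {f : FiniteFock} (hf : f ∈ fockLE m) :
    ‖toFock (linOp u v w f)‖ ≤ (‖u‖ + ‖v‖ + ‖w‖) * (m + 1) * ‖toFock f‖ := by
  have hs : √((m : ℝ) + 1) ≤ m + 1 :=
    Real.sqrt_le_iff.2 ⟨by positivity, by nlinarith [(m.cast_nonneg : (0 : ℝ) ≤ m)]⟩
  have h1 : ‖toFock (ann f)‖ ≤ (m + 1) * ‖toFock f‖ := (norm_ann_le hf).trans (by gcongr)
  have h2 : ‖toFock (cre f)‖ ≤ (m + 1) * ‖toFock f‖ := (norm_cre_le hf).trans (by gcongr)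
  have h3 : ‖toFock f‖ ≤ (m + 1) * ‖toFock f‖ :=
    le_mul_of_one_le_left (norm_nonneg _) (by linarith [(m.cast_nonneg : (0 : ℝ) ≤ m)])
  simp only [linOp_apply, map_add, map_smul]
  refine (norm_add₃_le).trans ?_
  rw [norm_smul, norm_smul, norm_smul]
  calc _ ≤ ‖u‖ * ((m + 1) * ‖toFock f‖) + ‖v‖ * ((m + 1) * ‖toFock f‖)
        + ‖w‖ * ((m + 1) * ‖toFock f‖) := by gcongr
    _ = _ := by ring

theorem linOp_mul_linOp (u v w u' v' w' : ℂ) : linOp u v w * linOp u' v' w' =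
    (u * u') • (ann * ann) + (u * v') • (ann * cre) + (v * u') • (cre * ann) +
      (v * v') • (cre * cre) + linOp (u * w' + w * u') (v * w' + w * v') (w * w') := by
  simp only [linOp, add_mul, mul_add, smul_mul_assoc, mul_smul_comm, mul_one, one_mul, smul_add,
    smul_smul, add_smul]
  abel_nf
  simp only [mul_comm]
  abel

/-! ### Affine canonical transformations and their closures on truncated vectors -/

theorem tendsto_of_trunc_shift {T : Op} {x y : FockSpace} (i j : ℕ)
    (h : ∀ k, T (trunc (k + i) x) = trunc (k + j) y) :
    Tendsto (fun k => toFock (T (trunc k x))) atTop (𝓝 y) := by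
  rw [← tendsto_add_atTop_iff_nat i]
  simp only [h]
  exact (tendsto_add_atTop_iff_nat j).2 (tendsto_toFock_trunc y)

/-- `T` maps the truncations of `x` to those of `y`, up to a shift. -/
def TruncShift (T : Op) (x y : FockSpace) : Prop :=
  ∃ i j, ∀ k, T (trunc (k + i) x) = trunc (k + j) y

theorem TruncShift.tendsto {T : Op} {x y : FockSpace} (h : TruncShift T x y) :
    Tendsto (fun k => toFock (T (trunc k x))) atTop (𝓝 y) := by
  obtain ⟨i, j, h⟩ := h
  exact tendsto_of_trunc_shift i j h

/-- Convergence alone would not compose, since `T'` is unbounded. An exact identity between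
truncations does, and this is how products of two ladder operators are reached. -/
theorem TruncShift.mul {T T' : Op} {x y z : FockSpace} (h : TruncShift T x y)
    (h' : TruncShift T' y z) : TruncShift (T' * T) x z := by
  obtain ⟨i, j, h⟩ := h
  obtain ⟨i', j', h'⟩ := h'
  refine ⟨i + i', j + j', fun k => ?_⟩
  rw [Module.End.mul_apply, show k + (i + i') = k + i' + i by omega, h,
    show k + i' + j = k + j + i' by omega, h', add_assoc]

theorem truncShift_one (x : FockSpace) : TruncShift 1 x x := ⟨0, 0, fun _ => rfl⟩

/-- Tested on Fock states, the weak relation determines the coordinates of `y`; `a` moves the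
cut-off down by one place. -/
theorem truncShift_ann {x y : FockSpace}
    (h : ∀ n, ⟪toFock (cre (Finsupp.single n 1)), x⟫_ℂ = ⟪fock n, y⟫_ℂ) : TruncShift ann x y := by
  refine ⟨1, 0, fun k => Finsupp.ext fun n => ?_⟩
  have := h n
  rw [cre, Finsupp.linearCombination_single, one_smul, toFock_single, inner_smul_left,
    inner_fock_left, inner_fock_left, Complex.conj_ofReal] at this
  rw [ann_apply, trunc_apply, trunc_apply]
  simp [← this]

theorem truncShift_cre {x y : FockSpace}
    (h : ∀ n, ⟪toFock (ann (Finsupp.single n 1)), x⟫_ℂ = ⟪fock n, y⟫_ℂ) : TruncShift cre x y := by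
  refine ⟨0, 1, fun k => Finsupp.ext fun n => ?_⟩
  have := h n
  rw [ann, Finsupp.linearCombination_single, one_smul, toFock_single, inner_smul_left,
    inner_fock_left, inner_fock_left, Complex.conj_ofReal] at this
  rcases n with _ | n
  · rw [cre_apply_zero, trunc_apply]
    simp [← this]
  · rw [cre_apply_succ, trunc_apply, trunc_apply]
    simp [← this]

/-- `U` implements the affine canonical transformation `U† a U = u a + v a† + w`. -/
structure IsBogoliubov (U : FockSpace →L[ℂ] FockSpace) (u v w : ℂ) : Prop where
  inner_ann : ∀ f g, ⟪toFock (cre g), U (toFock f)⟫_ℂ = ⟪toFock g, U (toFock (linOp u v w f))⟫_ℂ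
  inner_cre : ∀ f g, ⟪toFock (ann g), U (toFock f)⟫_ℂ =
    ⟪toFock g, U (toFock (linOp (conj v) (conj u) (conj w) f))⟫_ℂ

section Bogoliubov

variable {U V : FockSpace →L[ℂ] FockSpace} {u v w u' v' w' : ℂ}

theorem IsBogoliubov.truncShift_ann (h : IsBogoliubov U u v w) (f : FiniteFock) :
    TruncShift ann (U (toFock f)) (U (toFock (linOp u v w f))) :=
  Oscillator.truncShift_ann fun n => by rw [h.inner_ann, toFock_single, one_smul]

theorem IsBogoliubov.truncShift_cre (h : IsBogoliubov U u v w) (f : FiniteFock) :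
    TruncShift cre (U (toFock f)) (U (toFock (linOp (conj v) (conj u) (conj w) f))) :=
  Oscillator.truncShift_cre fun n => by rw [h.inner_cre, toFock_single, one_smul]

/-- `T U f = U T' f`, in the sense of the closure of `T`. -/
def Intertwines (U : FockSpace →L[ℂ] FockSpace) (T T' : Op) : Prop :=
  ∀ f, Tendsto (fun k => toFock (T (trunc k (U (toFock f))))) atTop (𝓝 (U (toFock (T' f))))

theorem Intertwines.add {T T' S S' : Op} (h : Intertwines U T T') (h' : Intertwines U S S') :
    Intertwines U (T + S) (T' + S') := fun f => by
  simp only [LinearMap.add_apply, map_add]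
  exact (h f).add (h' f)

theorem Intertwines.smul {T T' : Op} (h : Intertwines U T T') (c : ℂ) :
    Intertwines U (c • T) (c • T') := fun f => by
  simp only [LinearMap.smul_apply, map_smul]
  exact (h f).const_smul c

theorem Intertwines.linOp_mul {T T' A A' : Op} {p q s : ℂ} (ha : Intertwines U (ann * T) (A * T'))
    (hc : Intertwines U (cre * T) (A' * T')) (h1 : Intertwines U T T') :
    Intertwines U (linOp p q s * T) ((p • A + q • A' + s • 1) * T') := by
  simp only [linOp, add_mul, smul_mul_assoc, one_mul]
  exact ((ha.smul p).add (hc.smul q)).add (h1.smul s)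

theorem Intertwines.mul_linOp {T T' A A' : Op} {p q s : ℂ} (ha : Intertwines U (T * ann) (T' * A))
    (hc : Intertwines U (T * cre) (T' * A')) (h1 : Intertwines U T T') :
    Intertwines U (T * linOp p q s) (T' * (p • A + q • A' + s • 1)) := by
  simp only [linOp, mul_add, mul_smul_comm, mul_one]
  exact ((ha.smul p).add (hc.smul q)).add (h1.smul s)

theorem smul_linOp_add (p q s u v w : ℂ) :
    p • linOp u v w + q • linOp (conj v) (conj u) (conj w) + s • (1 : Op) =
      linOp (p * u + q * conj v) (p * v + q * conj u) (p * w + q * conj w + s) := by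
  simp only [linOp, smul_add, smul_smul, add_smul]
  abel

theorem IsBogoliubov.intertwines_linOp (h : IsBogoliubov U u v w) (p q s : ℂ) :
    Intertwines U (linOp p q s)
      (linOp (p * u + q * conj v) (p * v + q * conj u) (p * w + q * conj w + s)) := by
  rw [← smul_linOp_add, ← mul_one (linOp p q s), ← mul_one (_ + _)]
  exact Intertwines.linOp_mul (fun f => by simpa using (h.truncShift_ann f).tendsto)
    (fun f => by simpa using (h.truncShift_cre f).tendsto)
    (fun f => (truncShift_one _).tendsto)

/-- The truncation identity holds for single ladder operators and their products but is not
additive, as the shifts differ. So products are treated first and the linear combinations are taken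
after passing to the limit. The quadratic case is needed for `L† L`. -/
theorem IsBogoliubov.intertwines_linOp_mul (h : IsBogoliubov U u v w) (p q s p' q' s' : ℂ) :
    Intertwines U (linOp p q s * linOp p' q' s')
      (linOp (p * u + q * conj v) (p * v + q * conj u) (p * w + q * conj w + s) *
        linOp (p' * u + q' * conj v) (p' * v + q' * conj u)
          (p' * w + q' * conj w + s')) := by
  rw [← smul_linOp_add p', ← smul_linOp_add p]
  have key : ∀ {T T'}, (∀ f, TruncShift T (U (toFock f)) (U (toFock (T' f)))) →
      Intertwines U (T * linOp p' q' s') (T' * (p' • linOp u v w +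
        q' • linOp (conj v) (conj u) (conj w) + s' • 1)) := fun hT =>
    Intertwines.mul_linOp (fun f => ((h.truncShift_ann f).mul (hT _)).tendsto)
      (fun f => ((h.truncShift_cre f).mul (hT _)).tendsto) (fun f => (hT f).tendsto)
  refine Intertwines.linOp_mul (key h.truncShift_ann) (key h.truncShift_cre) ?_
  simpa using key (T := 1) (T' := 1) fun f => truncShift_one _

/-- The relation for `U` is known only on finite vectors; `V f` is approximated by its truncations,
on which both sides converge. -/
theorem Intertwines.inner_eq {S T T' : Op} (hV : Intertwines V T T')
    (hU : ∀ f g, ⟪toFock (S g), U (toFock f)⟫_ℂ = ⟪toFock g, U (toFock (T f))⟫_ℂ)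
    (f g : FiniteFock) :
    ⟪toFock (S g), (U * V) (toFock f)⟫_ℂ = ⟪toFock g, (U * V) (toFock (T' f))⟫_ℂ := by
  have hc : ∀ x, Continuous fun y => ⟪x, U y⟫_ℂ := fun x => by fun_prop
  have h1 := ((hc (toFock (S g))).tendsto _).comp (tendsto_toFock_trunc (V (toFock f)))
  have h2 := ((hc (toFock g)).tendsto _).comp (hV f)
  refine tendsto_nhds_unique h1 (h2.congr fun k => ?_)
  simp only [Function.comp_apply, hU]

theorem IsBogoliubov.mul (hU : IsBogoliubov U u v w) (hV : IsBogoliubov V u' v' w') :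
    IsBogoliubov (U * V) (u * u' + v * conj v') (u * v' + v * conj u')
      (u * w' + v * conj w' + w) where
  inner_ann := (hV.intertwines_linOp u v w).inner_eq hU.inner_ann
  inner_cre := by
    have := (hV.intertwines_linOp (conj v) (conj u) (conj w)).inner_eq hU.inner_cre
    simpa [add_comm, add_left_comm] using this

end Bogoliubov

/-! ### Heisenberg evolution of the ladder operators -/

/-- An affine operator costs one more factor linear in the level, which is absorbed in `(m + 1 +
k)!`; the exponential rate `4c` is unchanged. -/
theorem Banded.norm_linOp_pow_le {X : Op} {c : ℝ} (hX : Banded X c) {u v w : ℂ} {m : ℕ}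
    {f : FiniteFock} (hf : f ∈ fockLE m) (k : ℕ) : ‖toFock (linOp u v w ((X ^ k) f))‖ ≤
      (‖u‖ + ‖v‖ + ‖w‖) * (2 * ((m + 1).factorial * 2 ^ (m + 1) * ‖toFock f‖)) * (4 * c) ^ k *
        k.factorial := by
  have hc := hX.nonneg
  have h0 : (((m + 2 * k : ℕ) : ℝ) + 1) * (m + k).factorial ≤ 2 * (m + 1 + k).factorial := by
    rw [show m + 1 + k = m + k + 1 by omega, Nat.factorial_succ]
    push_cast
    rw [← mul_assoc]
    gcongr
    linarith [(m.cast_nonneg : (0 : ℝ) ≤ m)]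
  refine (norm_linOp_le (hX.pow_mem hf k)).trans ?_
  calc _ ≤ (‖u‖ + ‖v‖ + ‖w‖) * ((m + 2 * k : ℕ) + 1) *
        ((2 * c) ^ k * (m + k).factorial * ‖toFock f‖) := by
        gcongr; exact hX.norm_pow_le hf k
    _ = (‖u‖ + ‖v‖ + ‖w‖) * (2 * c) ^ k * ‖toFock f‖ *
        ((((m + 2 * k : ℕ) : ℝ) + 1) * (m + k).factorial) := by ring
    _ ≤ (‖u‖ + ‖v‖ + ‖w‖) * (2 * c) ^ k * ‖toFock f‖ *
        (2 * ((m + 1).factorial * 2 ^ (m + 1) * 2 ^ k * k.factorial)) := by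
        refine mul_le_mul_of_nonneg_left (h0.trans ?_) (by positivity)
        exact mul_le_mul_of_nonneg_left (factorial_add_le (m + 1) k) zero_le_two
    _ = _ := by rw [show 4 * c = 2 * c * 2 by ring, mul_pow (2 * c) 2]; ring

section Heisenberg

variable {X : Op} {c : ℝ} {U : ℝ → FockSpace →L[ℂ] FockSpace} {u v w u' v' w' : ℝ → ℂ}

/-- If `A(s)` solves `A' = [A, X]`, then `(U A h)' = U (X A + [A, X]) h = U A X h`. So the vectors
`U A X^k f` form a chain of derivatives, just like `U X^k f`. The two sides of the claim, with `X^k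
f` for `f`, agree at `s = 0` and hence on the interval of convergence. -/
theorem IsUnitaryGroup.inner_eq_of_small (hX : Banded X c) (hU : IsUnitaryGroup X U)
    (hu : ∀ s, HasDerivAt u (u' s) s) (hv : ∀ s, HasDerivAt v (v' s) s)
    (hw : ∀ s, HasDerivAt w (w' s) s)
    (hcomm : ∀ s, linOp (u' s) (v' s) (w' s) =
      linOp (u s) (v s) (w s) * X - X * linOp (u s) (v s) (w s)) {S : Op}
    (hS : IsAdjointOp S (linOp (u 0) (v 0) (w 0))) {s : ℝ} (hs : |s| ≤ 1)
    (hsc : 4 * c * |s| < 1) (f g : FiniteFock) :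
    ⟪toFock (S g), U s (toFock f)⟫_ℂ =
      ⟪toFock g, U s (toFock (linOp (u s) (v s) (w s) f))⟫_ℂ := by
  have hc := hX.nonneg
  obtain ⟨m, hf⟩ := exists_mem_fockLE f
  obtain ⟨K, hK⟩ : ∃ K, ∀ s : ℝ, |s| ≤ 1 → ‖u s‖ + ‖v s‖ + ‖w s‖ ≤ K := by
    have hcont : ContinuousOn (fun s => ‖u s‖ + ‖v s‖ + ‖w s‖) (Set.Icc (-1) 1) := by
      have hu' : Continuous u := continuous_iff_continuousAt.2 fun s => (hu s).continuousAt
      have hv' : Continuous v := continuous_iff_continuousAt.2 fun s => (hv s).continuousAt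
      have hw' : Continuous w := continuous_iff_continuousAt.2 fun s => (hw s).continuousAt
      fun_prop
    obtain ⟨K, hK⟩ := isCompact_Icc.bddAbove_image hcont
    exact ⟨K, fun s hs => hK ⟨s, abs_le.1 hs, rfl⟩⟩
  have hd : ∀ (h : FiniteFock) (s : ℝ),
      HasDerivAt (fun s => U s (toFock (linOp (u s) (v s) (w s) h)))
        (U s (toFock (linOp (u s) (v s) (w s) (X h)))) s := fun h s => by
    have h1 := (((hu s).smul (hU.hasDerivAt (ann h) s)).add
      ((hv s).smul (hU.hasDerivAt (cre h) s))).add ((hw s).smul (hU.hasDerivAt h s))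
    have h2 := LinearMap.congr_fun (hcomm s) h
    rw [LinearMap.sub_apply, Module.End.mul_apply, Module.End.mul_apply] at h2
    rw [eq_sub_iff_add_eq] at h2
    have h3 : (fun s => U s (toFock (linOp (u s) (v s) (w s) h))) = fun s =>
        u s • U s (toFock (ann h)) + v s • U s (toFock (cre h)) + w s • U s (toFock h) :=
      funext fun s => by simp only [linOp_apply, _root_.map_add, map_smul]
    rw [h3, ← h2]
    refine h1.congr_deriv ?_
    simp only [linOp_apply, _root_.map_add, map_smul]
    abel
  rw [← sub_eq_zero]
  refine eq_zero_of_hasDerivAt_succ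
    (φ := fun k s => ⟪toFock (S g), U s (toFock ((X ^ k) f))⟫_ℂ -
      ⟪toFock g, U s (toFock (linOp (u s) (v s) (w s) ((X ^ k) f)))⟫_ℂ)
    (C := ‖toFock (S g)‖ * (m.factorial * 2 ^ m * ‖toFock f‖) + ‖toFock g‖ *
      (K * (2 * ((m + 1).factorial * 2 ^ (m + 1) * ‖toFock f‖)))) (M := 4 * c)
    (fun k s => ?_) (fun k => ?_) (fun k s hs => ?_) (by positivity) hs hsc
  · rw [pow_succ', Module.End.mul_apply]
    have h1 := ((innerSL ℂ (toFock (S g))).restrictScalars ℝ).hasFDerivAt.comp_hasDerivAt s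
      (hU.hasDerivAt ((X ^ k) f) s)
    have h2 := ((innerSL ℂ (toFock g)).restrictScalars ℝ).hasFDerivAt.comp_hasDerivAt s
      (hd ((X ^ k) f) s)
    exact h1.sub h2
  · simp only [hU.map_zero, one_apply_eq_self]
    exact sub_eq_zero.2 (hS _ _)
  · refine (norm_sub_le _ _).trans ?_
    rw [add_mul, add_mul]
    refine add_le_add ((norm_inner_le_norm _ _).trans ?_) ((norm_inner_le_norm _ _).trans ?_)
    · rw [norm_unitary_apply (hU.unitary s), mul_assoc, mul_assoc, ← mul_assoc _ ((4 * c) ^ k)]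
      gcongr
      exact hX.norm_pow_le_factorial hf k
    · rw [norm_unitary_apply (hU.unitary s), mul_assoc ‖toFock g‖, mul_assoc ‖toFock g‖]
      gcongr
      refine (hX.norm_linOp_pow_le hf k).trans ?_
      gcongr
      exact hK s hs

/-- The last three hypotheses say that the affine maps form a one-parameter group. Composition of
canonical transformations then carries the small-time result to every `s`. -/
theorem IsUnitaryGroup.isBogoliubov (hX : Banded X c) (hU : IsUnitaryGroup X U)
    (hu : ∀ s, HasDerivAt u (u' s) s) (hv : ∀ s, HasDerivAt v (v' s) s)
    (hw : ∀ s, HasDerivAt w (w' s) s) (hu0 : u 0 = 1) (hv0 : v 0 = 0) (hw0 : w 0 = 0)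
    (hcomm : ∀ s, linOp (u' s) (v' s) (w' s) =
      linOp (u s) (v s) (w s) * X - X * linOp (u s) (v s) (w s))
    (hcomm' : ∀ s, linOp (conj (v' s)) (conj (u' s)) (conj (w' s)) =
      linOp (conj (v s)) (conj (u s)) (conj (w s)) * X -
        X * linOp (conj (v s)) (conj (u s)) (conj (w s)))
    (hu_add : ∀ s t, u (s + t) = u s * u t + v s * conj (v t))
    (hv_add : ∀ s t, v (s + t) = u s * v t + v s * conj (u t))
    (hw_add : ∀ s t, w (s + t) = u s * w t + v s * conj (w t) + w s) (s : ℝ) :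
    IsBogoliubov (U s) (u s) (v s) (w s) := by
  obtain ⟨δ, hδ, hsmall⟩ := exists_small (4 * c)
  have hconj : ∀ {φ φ' : ℝ → ℂ}, (∀ s, HasDerivAt φ (φ' s) s) →
      ∀ s, HasDerivAt (fun s => conj (φ s)) (conj (φ' s)) s := fun h s =>
    (h s).star
  refine forall_of_small hδ (P := fun s => IsBogoliubov (U s) (u s) (v s) (w s))
    (fun s hs => ⟨fun f g => ?_, fun f g => ?_⟩) (fun s t hs ht => ?_) s
  · refine hU.inner_eq_of_small hX hu hv hw hcomm ?_ (hsmall s hs).1 (hsmall s hs).2 f g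
    simpa [hu0, hv0, hw0, linOp] using isAdjointOp_cre_ann
  · refine hU.inner_eq_of_small hX (hconj hv) (hconj hu) (hconj hw) hcomm' ?_ (hsmall s hs).1
      (hsmall s hs).2 f g
    simpa [hu0, hv0, hw0, linOp] using isAdjointOp_ann_cre
  · rw [hU.map_add, hu_add, hv_add, hw_add]
    exact hs.mul ht

end Heisenberg

/-! ### Displacement and squeezing operators -/

theorem IsUnitaryGroup.star_eq {X : Op} {U : ℝ → FockSpace →L[ℂ] FockSpace}
    (hU : IsUnitaryGroup X U) (s : ℝ) : star (U s) = U (-s) := by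
  have h1 : U s * U (-s) = 1 := by rw [← hU.map_add, add_neg_cancel, hU.map_zero]
  rw [← mul_one (star (U s)), ← h1, ← mul_assoc, Unitary.star_mul_self_of_mem (hU.unitary s),
    one_mul]

theorem banded_linOp (u v w : ℂ) : Banded (linOp u v w) (‖u‖ + ‖v‖ + ‖w‖) where
  nonneg := by positivity
  mem hf := fockLE_mono (by omega) (linOp_mem_fockLE u v w hf)
  norm_le hf := norm_linOp_le hf

theorem op_sub_eq (S T : Op) : S - T = S + (-1 : ℂ) • T :=
  LinearMap.ext fun f => by
    rw [LinearMap.sub_apply, LinearMap.add_apply, LinearMap.smul_apply, neg_one_smul,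
      sub_eq_add_neg]

theorem linOp_commutator (u v w u' v' w' : ℂ) :
    linOp u v w * linOp u' v' w' - linOp u' v' w' * linOp u v w =
      linOp 0 0 (u * v' - v * u') := by
  rw [linOp_mul_linOp, linOp_mul_linOp, ann_mul_cre, op_sub_eq]
  simp only [linOp, smul_add]
  module

/-- For `X = α a† - α* a` one has `[a, X] = α`, so the Heisenberg solution is `a + s α`; times `1`
and `-1` give the operator and its adjoint. -/
theorem displacement_spec (α : ℂ) :
    displacement α ∈ unitary (FockSpace →L[ℂ] FockSpace) ∧
      IsBogoliubov (displacement α) 1 0 α ∧ IsBogoliubov (star (displacement α)) 1 0 (-α) := by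
  have hXe : α • cre - conj α • ann = linOp (-conj α) α 0 := by
    simp only [linOp]
    module
  have hX := banded_linOp (-conj α) α 0
  have hs : IsAdjointOp (-linOp (-conj α) α 0) (linOp (-conj α) α 0) := by
    convert! isAdjointOp_linOp (-conj α) α 0 using 1
    simp only [linOp, map_neg, Complex.conj_conj, map_zero]
    module
  obtain ⟨U, hU⟩ := exists_isUnitaryGroup hX hs
  have hB := hU.isBogoliubov hX (u := fun _ => 1) (v := fun _ => 0) (w := fun s => s * α)
    (u' := fun _ => 0) (v' := fun _ => 0) (w' := fun _ => α) (fun s => hasDerivAt_const s _)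
    (fun s => hasDerivAt_const s _)
    (fun s => by simpa using (Complex.ofRealCLM.hasDerivAt (x := s)).mul_const α)
    rfl rfl (by simp) (fun s => by rw [linOp_commutator]; simp)
    (fun s => by rw [linOp_commutator]; simp) (by simp) (by simp)
    (fun s t => by push_cast; ring)
  rw [displacement, hXe, hU.expOp_eq hX, hU.star_eq]
  exact ⟨hU.unitary 1, by simpa using hB 1, by simpa using hB (-1)⟩

theorem ann_mul_cre_sq : ann * cre ^ 2 = cre ^ 2 * ann + (2 : ℂ) • cre := by
  rw [sq, ← mul_assoc, ann_mul_cre, add_mul, mul_assoc, ann_mul_cre, mul_add, mul_assoc, two_smul]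
  simp only [one_mul, mul_one]
  abel

theorem ann_sq_mul_cre : ann ^ 2 * cre = cre * ann ^ 2 + (2 : ℂ) • ann := by
  rw [sq, mul_assoc, ann_mul_cre, mul_add, ← mul_assoc, ann_mul_cre, add_mul, mul_assoc, two_smul]
  simp only [one_mul, mul_one]
  abel

/-- The generator of the squeezing operators. -/
def squeezeGen (ζ : ℂ) : Op := (1 / 2 : ℂ) • (conj ζ • ann ^ 2 - ζ • cre ^ 2)

theorem linOp_commutator_squeezeGen (u v ζ : ℂ) :
    linOp u v 0 * squeezeGen ζ - squeezeGen ζ * linOp u v 0 =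
      linOp (-(conj ζ * v)) (-(ζ * u)) 0 := by
  have e1 : ann * ann ^ 2 = ann ^ 2 * ann := by rw [← pow_succ', pow_succ]
  have e2 : cre * cre ^ 2 = cre ^ 2 * cre := by rw [← pow_succ', pow_succ]
  simp only [linOp, squeezeGen, op_sub_eq, zero_smul, add_zero, add_mul, mul_add,
    smul_mul_assoc, mul_smul_comm, smul_smul, smul_add, e1, e2, ann_mul_cre_sq, ann_sq_mul_cre]
  module

theorem banded_squeezeGen (ζ : ℂ) : Banded (squeezeGen ζ) (2 * ‖ζ‖) where
  nonneg := by positivity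
  mem {m f} hf := by
    simp only [squeezeGen, sq, LinearMap.smul_apply, LinearMap.sub_apply, Module.End.mul_apply]
    exact Submodule.smul_mem _ _ (sub_mem
      (Submodule.smul_mem _ _ (fockLE_mono (by omega) (ann_mem_fockLE (ann_mem_fockLE hf))))
      (Submodule.smul_mem _ _ (cre_mem_fockLE (cre_mem_fockLE hf))))
  norm_le {m f} hf := by
    have h1 : ‖toFock (ann (ann f))‖ ≤ 2 * (m + 1) * ‖toFock f‖ := by
      calc _ ≤ √(m + 1) * (√(m + 1) * ‖toFock f‖) :=
            (norm_ann_le (ann_mem_fockLE hf)).trans (by gcongr; exact norm_ann_le hf)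
        _ = (m + 1) * ‖toFock f‖ := by rw [← mul_assoc, Real.mul_self_sqrt (by positivity)]
        _ ≤ _ := by gcongr; linarith [(m.cast_nonneg : (0 : ℝ) ≤ m)]
    have h2 : ‖toFock (cre (cre f))‖ ≤ 2 * (m + 1) * ‖toFock f‖ := by
      calc _ ≤ √((m + 1 : ℕ) + 1) * (√(m + 1) * ‖toFock f‖) :=
            (norm_cre_le (cre_mem_fockLE hf)).trans (by gcongr; exact norm_cre_le hf)
        _ ≤ √((m + 1 : ℕ) + 1) * (√((m + 1 : ℕ) + 1) * ‖toFock f‖) := by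
            gcongr; linarith
        _ = (m + 1 + 1) * ‖toFock f‖ := by
            rw [← mul_assoc, Real.mul_self_sqrt (by positivity)]; push_cast; ring
        _ ≤ _ := by gcongr; linarith [(m.cast_nonneg : (0 : ℝ) ≤ m)]
    simp only [squeezeGen, sq, LinearMap.smul_apply, LinearMap.sub_apply, Module.End.mul_apply,
      map_smul, map_sub, norm_smul]
    have h3 := norm_sub_le (conj ζ • toFock (ann (ann f))) (ζ • toFock (cre (cre f)))
    rw [norm_smul, norm_smul, RCLike.norm_conj] at h3
    have h4 : ‖ζ‖ * ‖toFock (ann (ann f))‖ ≤ ‖ζ‖ * (2 * (m + 1) * ‖toFock f‖) := by gcongr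
    have h5 : ‖ζ‖ * ‖toFock (cre (cre f))‖ ≤ ‖ζ‖ * (2 * (m + 1) * ‖toFock f‖) := by gcongr
    have h6 : ‖(1 / 2 : ℂ)‖ = 1 / 2 := by norm_num
    rw [h6]
    linarith

theorem isAdjointOp_squeezeGen (ζ : ℂ) : IsAdjointOp (-squeezeGen ζ) (squeezeGen ζ) := by
  have ha := isAdjointOp_cre_ann.mul isAdjointOp_cre_ann
  have hc := isAdjointOp_ann_cre.mul isAdjointOp_ann_cre
  have h := (ha.smul (1 / 2 * conj ζ)).add (hc.smul (-(1 / 2 * ζ)))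
  convert! h using 1
  · simp only [squeezeGen, sq, map_mul, map_neg, Complex.conj_conj, map_div₀, map_one, map_ofNat]
    module
  · simp only [squeezeGen, sq]
    module

/-- Commutation with the generator sends `a` to `-ζ a†` and `a†` to `-ζ* a`, so with `ζ = r e` the
Heisenberg solution is the hyperbolic rotation `cosh (s r) a - e sinh (s r) a†`. -/
theorem squeezing_spec {r : ℝ} {e : ℂ} (he : e * conj e = 1) :
    squeezing (r * e) ∈ unitary (FockSpace →L[ℂ] FockSpace) ∧
      IsBogoliubov (squeezing (r * e)) (Real.cosh r) (-(e * Real.sinh r)) 0 ∧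
      IsBogoliubov (star (squeezing (r * e))) (Real.cosh r) (e * Real.sinh r) 0 := by
  have hX := banded_squeezeGen (r * e)
  obtain ⟨U, hU⟩ := exists_isUnitaryGroup hX (isAdjointOp_squeezeGen (r * e))
  have hcosh : ∀ s : ℝ, HasDerivAt (fun s : ℝ => ((Real.cosh (s * r) : ℝ) : ℂ))
      (((Real.sinh (s * r) * r : ℝ)) : ℂ) s := fun s => by
    simpa using (((hasDerivAt_id s).mul_const r).cosh).ofReal_comp
  have hsinh : ∀ s : ℝ, HasDerivAt (fun s : ℝ => ((Real.sinh (s * r) : ℝ) : ℂ))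
      (((Real.cosh (s * r) * r : ℝ)) : ℂ) s := fun s => by
    simpa using (((hasDerivAt_id s).mul_const r).sinh).ofReal_comp
  have hB := hU.isBogoliubov hX (u := fun s => (Real.cosh (s * r) : ℝ))
    (v := fun s => -(e * (Real.sinh (s * r) : ℝ))) (w := fun s => 0)
    (u' := fun s => (Real.sinh (s * r) * r : ℝ)) (v' := fun s => -(e * (Real.cosh (s * r) * r : ℝ)))
    (w' := fun _ => 0) hcosh (fun s => ((hsinh s).const_mul e).neg)
    (fun s => hasDerivAt_const s _) (by simp) (by simp) rfl
    (fun s => by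
      rw [linOp_commutator_squeezeGen]
      congr 1
      · simp only [map_mul, Complex.conj_ofReal]
        push_cast
        linear_combination (-(r * Complex.sinh (s * r))) * he
      · push_cast; ring)
    (fun s => by
      simp only [map_neg, map_mul, Complex.conj_ofReal, map_zero]
      rw [linOp_commutator_squeezeGen]
      congr 1
      · simp only [map_mul, Complex.conj_ofReal]
        push_cast; ring
      · push_cast
        linear_combination (-(r * Complex.sinh (s * r))) * he)
    (fun s t => by
      simp only [map_neg, map_mul, Complex.conj_ofReal, add_mul, Real.cosh_add]
      push_cast
      linear_combination (-(Complex.sinh (s * r) * Complex.sinh (t * r))) * he)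
    (fun s t => by
      simp only [Complex.conj_ofReal, add_mul, Real.sinh_add]
      push_cast; ring)
    (by simp)
  rw [squeezing, show (1 / 2 : ℂ) • (conj ((r : ℂ) * e) • ann ^ 2 - ((r : ℂ) * e) • cre ^ 2) =
    squeezeGen (r * e) from rfl, hU.expOp_eq hX, hU.star_eq]
  exact ⟨hU.unitary 1, by simpa using hB 1, by simpa using hB (-1)⟩

/-- `D(α) S(ζ)`. -/
def squeezeDisplace (α ζ : ℂ) : FockSpace →L[ℂ] FockSpace := displacement α * squeezing ζ

theorem squeezeDisplace_spec (α : ℂ) {r : ℝ} {e : ℂ} (he : e * conj e = 1) :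
    squeezeDisplace α (r * e) ∈ unitary (FockSpace →L[ℂ] FockSpace) ∧
      IsBogoliubov (squeezeDisplace α (r * e)) (Real.cosh r) (-(e * Real.sinh r)) α ∧
      IsBogoliubov (star (squeezeDisplace α (r * e))) (Real.cosh r) (e * Real.sinh r)
        (-(Real.cosh r * α + e * Real.sinh r * conj α)) := by
  obtain ⟨hD, hD1, hD2⟩ := displacement_spec α
  obtain ⟨hS, hS1, hS2⟩ := squeezing_spec (r := r) he
  refine ⟨mul_mem hD hS, ?_, ?_⟩
  · simpa [squeezeDisplace] using hD1.mul hS1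
  · rw [squeezeDisplace, star_mul]
    have := hS2.mul hD2
    simp only [mul_one, map_zero, mul_zero, add_zero, zero_add, map_one, map_neg] at this
    convert! this using 1
    ring

/-! ### Positive operators, traces and density operators -/

section FunctionalCalculus

variable {E : Type*} [NormedAddCommGroup E] [InnerProductSpace ℂ E] [CompleteSpace E]

theorem exists_eq_star_mul_self {ρ : E →L[ℂ] E} (hρ : ρ.IsPositive) : ∃ R, ρ = star R * R := by
  have h : 0 ≤ ρ := (ContinuousLinearMap.nonneg_iff_isPositive ρ).2 hρ
  exact ⟨CFC.sqrt ρ, by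
    rw [(CFC.sqrt_nonneg ρ).isSelfAdjoint.star_eq, CFC.sqrt_mul_sqrt_self ρ h]⟩

theorem exists_negPart {T : E →L[ℂ] E} (hT : IsSelfAdjoint T) : ∃ N : E →L[ℂ] E, N.IsPositive ∧
    (∀ x, N (T x) = -N (N x)) ∧ (absOp T).IsPositive ∧ absOp T = T + (N + N) := by
  refine ⟨T⁻, (ContinuousLinearMap.nonneg_iff_isPositive _).1 (CFC.negPart_nonneg T),
    fun x => ?_, (ContinuousLinearMap.nonneg_iff_isPositive _).1 (CFC.abs_nonneg T), ?_⟩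
  · have h1 : T⁻ * T = -(T⁻ * T⁻) := by
      nth_rw 2 [← CFC.posPart_sub_negPart T hT]
      rw [mul_sub, CFC.negPart_mul_posPart, zero_sub]
    simpa using congrArg (· x) h1
  · rw [absOp, ← two_nsmul, ← CFC.abs_sub_self T hT]
    abel

end FunctionalCalculus

theorem inner_star_left (A : FockSpace →L[ℂ] FockSpace) (x y : FockSpace) :
    ⟪star A x, y⟫_ℂ = ⟪x, A y⟫_ℂ := ContinuousLinearMap.adjoint_inner_left A y x

theorem inner_star_right (A : FockSpace →L[ℂ] FockSpace) (x y : FockSpace) :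
    ⟪x, star A y⟫_ℂ = ⟪A x, y⟫_ℂ := ContinuousLinearMap.adjoint_inner_right A x y

theorem enorm_sq_eq_ofReal {E : Type*} [SeminormedAddCommGroup E] (x : E) :
    ‖x‖ₑ ^ 2 = ENNReal.ofReal (‖x‖ ^ 2) := by
  rw [ENNReal.ofReal_pow (norm_nonneg _), ofReal_norm]

theorem enorm_sq_eq_tsum (x : FockSpace) : ‖x‖ₑ ^ 2 = ∑' n, ‖x n‖ₑ ^ 2 := by
  simp only [enorm_sq_eq_ofReal]
  rw [← ENNReal.ofReal_tsum_of_nonneg (fun _ => by positivity) (hasSum_norm_sq x).summable,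
    (hasSum_norm_sq x).tsum_eq]

/-- The square of the Hilbert-Schmidt norm. -/
def hsSq (A : FockSpace →L[ℂ] FockSpace) : ℝ≥0∞ := ∑' n, ‖A (fock n)‖ₑ ^ 2

theorem enorm_apply_fock (A : FockSpace →L[ℂ] FockSpace) (m n : ℕ) :
    ‖(A (fock n)) m‖ₑ = ‖(star A (fock m)) n‖ₑ := by
  rw [← inner_fock_left, ← inner_fock_left, inner_star_right, ← inner_conj_symm,
    RCLike.enorm_conj]

/-- Both sides are the sum of all squared matrix elements, in the two orders of summation. -/
theorem hsSq_star (A : FockSpace →L[ℂ] FockSpace) : hsSq (star A) = hsSq A := by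
  simp only [hsSq, enorm_sq_eq_tsum]
  rw [ENNReal.tsum_comm]
  simp only [← enorm_apply_fock]

/-- Invariance under a unitary factor on the left is clear term by term; adjoints move it to the
right. -/
theorem hsSq_mul_unitary (A : FockSpace →L[ℂ] FockSpace) {U : FockSpace →L[ℂ] FockSpace}
    (hU : U ∈ unitary (FockSpace →L[ℂ] FockSpace)) : hsSq (A * U) = hsSq A := by
  rw [← hsSq_star, star_mul, ← hsSq_star A]
  simp only [hsSq, mul_apply_eq_comp]
  refine tsum_congr fun n => ?_
  rw [← ofReal_norm, norm_unitary_apply (Unitary.star_mem hU), ofReal_norm]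

theorem enorm_apply_sq_le (A : FockSpace →L[ℂ] FockSpace) (x : FockSpace) :
    ‖A x‖ₑ ^ 2 ≤ hsSq A * ‖x‖ₑ ^ 2 := by
  rw [enorm_sq_eq_tsum, ← hsSq_star, hsSq, ← ENNReal.tsum_mul_right]
  refine ENNReal.tsum_le_tsum fun n => ?_
  rw [← inner_fock_left, ← inner_star_left, ← mul_pow]
  gcongr
  rw [← ofReal_norm, ← ofReal_norm, ← ofReal_norm, ← ENNReal.ofReal_mul (norm_nonneg _)]
  exact ENNReal.ofReal_le_ofReal (norm_inner_le_norm _ _)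

/-- The trace of a positive operator. -/
def diagSum (ρ : FockSpace →L[ℂ] FockSpace) : ℝ≥0∞ :=
  ∑' n, ENNReal.ofReal (⟪fock n, ρ (fock n)⟫_ℂ).re

theorem diagSum_star_mul_self (A : FockSpace →L[ℂ] FockSpace) : diagSum (star A * A) = hsSq A := by
  refine tsum_congr fun n => ?_
  rw [mul_apply_eq_comp, inner_star_right, enorm_sq_eq_ofReal, ← inner_self_eq_norm_sq (𝕜 := ℂ)]
  rfl

theorem isPositive_star_mul_self (A : FockSpace →L[ℂ] FockSpace) : (star A * A).IsPositive :=
  ContinuousLinearMap.isPositive_adjoint_comp_self A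

theorem isPositive_star_conj {ρ : FockSpace →L[ℂ] FockSpace} (hρ : ρ.IsPositive)
    (A : FockSpace →L[ℂ] FockSpace) : (star A * ρ * A).IsPositive := by
  obtain ⟨R, rfl⟩ := exists_eq_star_mul_self hρ
  have := isPositive_star_mul_self (R * A)
  rwa [star_mul, ← mul_assoc, mul_assoc (star A)] at this

theorem diagSum_unitary_conj {ρ : FockSpace →L[ℂ] FockSpace} (hρ : ρ.IsPositive)
    {U : FockSpace →L[ℂ] FockSpace} (hU : U ∈ unitary (FockSpace →L[ℂ] FockSpace)) :
    diagSum (star U * ρ * U) = diagSum ρ := by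
  obtain ⟨R, rfl⟩ := exists_eq_star_mul_self hρ
  rw [diagSum_star_mul_self, ← hsSq_mul_unitary R hU, ← diagSum_star_mul_self, star_mul]
  simp only [mul_assoc]

theorem norm_le_of_diagSum_le {ρ : FockSpace →L[ℂ] FockSpace} (hρ : ρ.IsPositive) {τ : ℝ}
    (hτ : 0 ≤ τ) (h : diagSum ρ ≤ ENNReal.ofReal τ) : ‖ρ‖ ≤ τ := by
  obtain ⟨R, rfl⟩ := exists_eq_star_mul_self hρ
  rw [diagSum_star_mul_self] at h
  refine ContinuousLinearMap.opNorm_le_bound _ hτ fun x => ?_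
  have h1 := enorm_apply_sq_le R x
  have h2 := enorm_apply_sq_le (star R) (R x)
  rw [hsSq_star] at h2
  have h3 : ‖(star R * R) x‖ₑ ^ 2 ≤ ENNReal.ofReal ((τ * ‖x‖) ^ 2) := by
    calc _ ≤ hsSq R * (hsSq R * ‖x‖ₑ ^ 2) := h2.trans (by gcongr)
      _ ≤ ENNReal.ofReal τ * (ENNReal.ofReal τ * ‖x‖ₑ ^ 2) := by gcongr
      _ = _ := by
        rw [enorm_sq_eq_ofReal, ← ENNReal.ofReal_mul hτ, ← ENNReal.ofReal_mul hτ]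
        congr 1
        ring
  rw [enorm_sq_eq_ofReal, ENNReal.ofReal_le_ofReal_iff (by positivity)] at h3
  exact abs_le_of_sq_le_sq' h3 (by positivity) |>.2

theorem inner_eq_ofReal_re {ρ : FockSpace →L[ℂ] FockSpace} (hρ : ρ.IsPositive) (x : FockSpace) :
    ⟪x, ρ x⟫_ℂ = ((⟪x, ρ x⟫_ℂ).re : ℂ) :=
  (Complex.ext rfl (by simpa using (Complex.nonneg_iff.1 (hρ.inner_nonneg_right x)).2.symm))

theorem isDensity_iff {ρ : FockSpace →L[ℂ] FockSpace} :
    IsDensity ρ ↔ ρ.IsPositive ∧ diagSum ρ = 1 := by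
  refine and_congr_right fun hρ => ?_
  have h0 : ∀ n, 0 ≤ (⟪fock n, ρ (fock n)⟫_ℂ).re := fun n => hρ.re_inner_nonneg_right _
  have h1 : (fun n => ⟪fock n, ρ (fock n)⟫_ℂ) = fun n => ((⟪fock n, ρ (fock n)⟫_ℂ).re : ℂ) :=
    funext fun n => inner_eq_ofReal_re hρ _
  rw [h1, ← Complex.ofReal_one, Complex.hasSum_ofReal]
  constructor
  · intro h
    rw [diagSum, ← ENNReal.ofReal_tsum_of_nonneg h0 h.summable, h.tsum_eq, ENNReal.ofReal_one]
  · intro h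
    have hs := ENNReal.summable_toReal (f := fun n => ENNReal.ofReal (⟪fock n, ρ (fock n)⟫_ℂ).re)
      (by rw [diagSum] at h; rw [h]; exact ENNReal.one_ne_top)
    simp only [ENNReal.toReal_ofReal (h0 _)] at hs
    rw [diagSum, ← ENNReal.ofReal_tsum_of_nonneg h0 hs, ENNReal.ofReal_eq_one] at h
    rw [← h]
    exact hs.hasSum

theorem IsDensity.unitary_conj {ρ : FockSpace →L[ℂ] FockSpace} (hρ : IsDensity ρ)
    {U : FockSpace →L[ℂ] FockSpace} (hU : U ∈ unitary (FockSpace →L[ℂ] FockSpace)) :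
    IsDensity (star U * ρ * U) := by
  rw [isDensity_iff] at hρ ⊢
  exact ⟨isPositive_star_conj hρ.1 U, (diagSum_unitary_conj hρ.1 hU).trans hρ.2⟩

theorem IsDensity.norm_le {ρ : FockSpace →L[ℂ] FockSpace} (hρ : IsDensity ρ) : ‖ρ‖ ≤ 1 :=
  norm_le_of_diagSum_le hρ.1 zero_le_one (by rw [(isDensity_iff.1 hρ).2, ENNReal.ofReal_one])

/-- This is `ρ² ≤ ρ`: writing `ρ = R† R`, the trace is the squared Hilbert-Schmidt norm of `R`, so
`R†` is a contraction. -/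
theorem IsDensity.norm_apply_sq_le {ρ : FockSpace →L[ℂ] FockSpace} (hρ : IsDensity ρ)
    (x : FockSpace) : ‖ρ x‖ ^ 2 ≤ (⟪x, ρ x⟫_ℂ).re := by
  obtain ⟨hp, ht⟩ := isDensity_iff.1 hρ
  obtain ⟨R, rfl⟩ := exists_eq_star_mul_self hp
  rw [diagSum_star_mul_self] at ht
  have h := enorm_apply_sq_le (star R) (R x)
  rw [hsSq_star, ht, one_mul, enorm_sq_eq_ofReal, enorm_sq_eq_ofReal,
    ENNReal.ofReal_le_ofReal_iff (by positivity), ← inner_self_eq_norm_sq (𝕜 := ℂ) (R x),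
    ← inner_star_right] at h
  exact h

/-! ### Trace distance to a pure state -/

theorem proj_apply (ψ x : FockSpace) : proj ψ x = ⟪ψ, x⟫_ℂ • ψ := rfl

theorem hasSum_inner_proj (ψ : FockSpace) :
    HasSum (fun n => ⟪fock n, proj ψ (fock n)⟫_ℂ) ((‖ψ‖ ^ 2 : ℝ) : ℂ) := by
  rw [Complex.ofReal_pow]
  have h := lp.hasSum_inner (𝕜 := ℂ) ψ ψ
  rw [inner_self_eq_norm_sq_to_K] at h
  convert! h using 2 with n
  rw [proj_apply, inner_smul_right, inner_fock_left, ← inner_conj_symm, inner_fock_left]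
  exact (RCLike.inner_apply' (𝕜 := ℂ) _ _).symm

theorem isDensity_proj {ψ : FockSpace} (hψ : ‖ψ‖ = 1) : IsDensity (proj ψ) :=
  ⟨InnerProductSpace.isPositive_rankOne_self ψ, by simpa [hψ] using hasSum_inner_proj ψ⟩

/-- If `N ≥ 0` and `N³ ≤ |u⟩⟨u|`, then `N` has rank at most one and `(tr N)³ ≤ ‖u‖²`. -/
theorem hasSum_diag_of_cube_le {N : FockSpace →L[ℂ] FockSpace} (hN : N.IsPositive) {u : FockSpace}
    (h : ∀ x, (⟪N x, N (N x)⟫_ℂ).re ≤ ‖⟪u, x⟫_ℂ‖ ^ 2) :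
    ∃ l : ℝ, 0 ≤ l ∧ l ^ 3 ≤ ‖u‖ ^ 2 ∧ HasSum (fun n => ⟪fock n, N (fock n)⟫_ℂ) (l : ℂ) := by
  have hsymm : ∀ x y, ⟪N x, y⟫_ℂ = ⟪x, N y⟫_ℂ := hN.inner_left_eq_inner_right
  -- On the orthogonal complement of `u` the form of `N³` vanishes, and positivity brings this down
  -- to `N`. Hence `N` is determined by its value on the unit vector `e` along `u`.
  have hker : ∀ x, ⟪u, x⟫_ℂ = 0 → N x = 0 := fun x hx => by
    obtain ⟨M, hM⟩ := exists_eq_star_mul_self hN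
    have h1 := h x
    rw [hx, norm_zero, zero_pow two_ne_zero] at h1
    nth_rw 2 [hM] at h1
    rw [mul_apply_eq_comp, inner_star_right] at h1
    have h2 : ‖M (N x)‖ ^ 2 ≤ 0 := by rw [← inner_self_eq_norm_sq (𝕜 := ℂ)]; exact h1
    have h3 : M (N x) = 0 := by
      rw [← norm_eq_zero]; exact pow_eq_zero_iff two_ne_zero |>.1 (le_antisymm h2 (by positivity))
    have h4 : N (N x) = 0 := by
      nth_rw 1 [hM]; rw [mul_apply_eq_comp, h3, map_zero]
    rw [← inner_self_eq_zero (𝕜 := ℂ), hsymm, h4, inner_zero_right]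
  rcases eq_or_ne u 0 with rfl | hu
  · refine ⟨0, le_rfl, by simp, ?_⟩
    have : N = 0 := ContinuousLinearMap.ext fun x => hker x (inner_zero_left _)
    simp [this]
  · have hu' : ‖u‖ ≠ 0 := norm_ne_zero_iff.2 hu
    set e : FockSpace := ((‖u‖⁻¹ : ℝ) : ℂ) • u with he
    have hue : ⟪u, e⟫_ℂ = ‖u‖ := by
      rw [he, inner_smul_right, inner_self_eq_norm_sq_to_K]
      change ((‖u‖⁻¹ : ℝ) : ℂ) * (‖u‖ : ℂ) ^ 2 = ‖u‖
      have : (‖u‖ : ℂ) ≠ 0 := by exact_mod_cast hu'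
      push_cast
      field_simp
    have heu : ∀ x, ⟪u, x⟫_ℂ = ‖u‖ * ⟪e, x⟫_ℂ := fun x => by
      rw [he, inner_smul_left, Complex.conj_ofReal, ← mul_assoc, ← Complex.ofReal_mul,
        mul_inv_cancel₀ hu', Complex.ofReal_one, one_mul]
    have hNx : ∀ x, N x = ⟪e, x⟫_ℂ • N e := fun x => by
      have := hker (x - ⟪e, x⟫_ℂ • e) (by
        rw [inner_sub_right, inner_smul_right, hue, heu x, mul_comm, sub_self])
      rwa [map_sub, map_smul, sub_eq_zero] at this
    set l : ℝ := (⟪e, N e⟫_ℂ).re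
    have hl : ⟪e, N e⟫_ℂ = l := inner_eq_ofReal_re hN e
    refine ⟨l, hN.re_inner_nonneg_right e, ?_, ?_⟩
    · have h1 := h e
      have h2 : ⟪N e, N e⟫_ℂ = ((l ^ 2 : ℝ) : ℂ) := by
        rw [hsymm, hNx (N e), inner_smul_right, hl]; push_cast; ring
      rw [hNx (N e), inner_smul_right, h2, hl, ← Complex.ofReal_mul, Complex.ofReal_re, hue,
        Complex.norm_real, norm_norm] at h1
      linarith [h1]
    · have h1 := lp.hasSum_inner (𝕜 := ℂ) e (N e)
      rw [hl] at h1
      convert! h1 using 2 with n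
      rw [hNx (fock n), inner_smul_right, inner_fock_left, ← inner_conj_symm e, inner_fock_left]
      simp [mul_comm]

/-- Let `N` be the negative part of `T = ρ - |ψ⟩⟨ψ|`. Then `N³ = -N T N ≤ |Nψ⟩⟨Nψ|` because `N ρ N ≥
0`, so `N` has rank at most one and its trace `l` satisfies `l³ ≤ ‖Nψ‖² ≤ ‖Tψ‖² ≤ 1 - ⟨ψ|ρ|ψ⟩`. As
`T` has trace zero, `tr |T| = 2 l`. The exponent is not sharp, but only convergence is needed. -/
theorem traceNorm_sub_proj {ρ : FockSpace →L[ℂ] FockSpace} (hρ : IsDensity ρ) {ψ : FockSpace}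
    (hψ : ‖ψ‖ = 1) : ∃ l : ℝ, 0 ≤ l ∧ l ^ 3 ≤ 1 - population ψ ρ ∧
      traceNorm (ρ - proj ψ) = ENNReal.ofReal (2 * l) := by
  set T := ρ - proj ψ with hT
  have hTsa : IsSelfAdjoint T := hρ.1.isSelfAdjoint.sub (isDensity_proj hψ).1.isSelfAdjoint
  obtain ⟨N, hN, hNT, habs_pos, habs⟩ := exists_negPart hTsa
  have hsymm : ∀ x y, ⟪N x, y⟫_ℂ = ⟪x, N y⟫_ℂ := hN.inner_left_eq_inner_right
  have hcube : ∀ x, (⟪N x, N (N x)⟫_ℂ).re ≤ ‖⟪N ψ, x⟫_ℂ‖ ^ 2 := fun x => by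
    have h1 : ⟪N x, T (N x)⟫_ℂ = -⟪N x, N (N x)⟫_ℂ := by
      rw [hsymm, hNT, inner_neg_right, hsymm]
    rw [hT, sub_apply, inner_sub_right, proj_apply, inner_smul_right, ← inner_conj_symm (N x) ψ,
      Complex.mul_conj, ← hsymm, Complex.normSq_eq_norm_sq] at h1
    have h2 := hρ.1.re_inner_nonneg_right (N x)
    have h3 := congrArg Complex.re h1
    simp only [Complex.sub_re, Complex.ofReal_re, Complex.neg_re] at h3
    have h4 : (⟪N x, ρ (N x)⟫_ℂ).re = RCLike.re ⟪N x, ρ (N x)⟫_ℂ := rfl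
    linarith
  obtain ⟨l, hl0, hl, hsum⟩ := hasSum_diag_of_cube_le hN hcube
  refine ⟨l, hl0, hl.trans ?_, ?_⟩
  · have h1 : ‖N ψ‖ ^ 2 ≤ ‖N ψ‖ * ‖T ψ‖ := by
      have h2 : ⟪N ψ, T ψ⟫_ℂ = -⟪N ψ, N ψ⟫_ℂ := by
        rw [hsymm, hNT, inner_neg_right, hsymm]
      have h3 := norm_inner_le_norm (𝕜 := ℂ) (N ψ) (T ψ)
      rw [h2, norm_neg, inner_self_eq_norm_sq_to_K] at h3
      simpa using h3
    have h4 : ‖N ψ‖ ≤ ‖T ψ‖ := by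
      rcases (norm_nonneg (N ψ)).eq_or_lt with h | h
      · rw [← h]; exact norm_nonneg _
      · rw [sq] at h1; exact le_of_mul_le_mul_left h1 h
    have h5 : ‖T ψ‖ ^ 2 = ‖ρ ψ‖ ^ 2 - 2 * population ψ ρ + 1 := by
      have : T ψ = ρ ψ - ψ := by
        rw [hT, sub_apply, proj_apply, inner_self_eq_norm_sq_to_K, hψ]; simp
      rw [this, @norm_sub_sq ℂ, hψ, inner_re_symm, population]
      norm_num
    have h6 := hρ.norm_apply_sq_le ψ
    rw [← population] at h6
    have h7 := pow_le_pow_left₀ (norm_nonneg _) h4 2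
    linarith
  · have habs' : ∀ n, ⟪fock n, absOp T (fock n)⟫_ℂ =
        ⟪fock n, ρ (fock n)⟫_ℂ - ⟪fock n, proj ψ (fock n)⟫_ℂ + 2 * ⟪fock n, N (fock n)⟫_ℂ :=
      fun n => by
        rw [habs, hT]
        simp only [add_apply, sub_apply, inner_add_right, inner_sub_right]
        ring
    have h1 := (hρ.2.sub (isDensity_proj hψ).2).add (hsum.mul_left 2)
    simp only [← habs', sub_self, zero_add] at h1
    have h2 := Complex.hasSum_re h1
    have h3 : ∀ n, 0 ≤ (⟪fock n, absOp T (fock n)⟫_ℂ).re := fun n =>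
      habs_pos.re_inner_nonneg_right _
    rw [traceNorm, ← ENNReal.ofReal_tsum_of_nonneg h3 h2.summable, h2.tsum_eq]
    simp

/-! ### Transport of weak solutions and gauge invariance -/

theorem hasDerivWithinAt_Ici_of_tendstoUniformlyOn {F G : ℕ → ℝ → ℂ} {f g : ℝ → ℂ}
    (hd : ∀ n τ, 0 ≤ τ → HasDerivWithinAt (F n) (G n τ) (Set.Ici 0) τ)
    (hF : ∀ τ, 0 ≤ τ → Tendsto (fun n => F n τ) atTop (𝓝 (f τ)))
    (hG : TendstoUniformlyOn G g atTop (Set.Ici 0)) {τ : ℝ} (hτ : 0 ≤ τ) :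
    HasDerivWithinAt f (g τ) (Set.Ici 0) τ := by
  rw [hasDerivWithinAt_iff_isLittleO, Asymptotics.isLittleO_iff]
  intro ε hε
  have hev := Metric.tendstoUniformlyOn_iff.1 hG (ε / 4) (by positivity)
  obtain ⟨n, hn⟩ := eventually_atTop.1 hev
  have hlip : ∀ t, 0 ≤ t → ‖(f t - F n t) - (f τ - F n τ)‖ ≤ ε / 2 * ‖t - τ‖ := fun t ht => by
    refine le_of_tendsto (((hF t ht).sub_const (F n t)).sub
      ((hF τ hτ).sub_const (F n τ))).norm ?_
    filter_upwards [eventually_ge_atTop n] with m hm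
    refine (convex_Ici (0 : ℝ)).norm_image_sub_le_of_norm_hasDerivWithin_le
      (f := fun t => F m t - F n t) (fun x hx => (hd m x hx).sub (hd n x hx)) (fun x hx => ?_)
      hτ ht
    have h1 := hn m hm x hx
    have h2 := hn n le_rfl x hx
    rw [← dist_eq_norm]
    rw [dist_comm] at h1
    linarith [dist_triangle (G m x) (g x) (G n x)]
  have hlo := Asymptotics.isLittleO_iff.1 (hasDerivWithinAt_iff_isLittleO.1 (hd n τ hτ))
    (c := ε / 4) (by positivity)
  filter_upwards [hlo, self_mem_nhdsWithin] with t h1 ht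
  have h2 := hlip t ht
  have h3 : ‖(t - τ) • (G n τ - g τ)‖ ≤ ε / 4 * ‖t - τ‖ := by
    rw [norm_smul, mul_comm]
    gcongr
    have := (hn n le_rfl τ hτ).le
    rwa [dist_comm, dist_eq_norm] at this
  calc ‖f t - f τ - (t - τ) • g τ‖ = ‖((f t - F n t) - (f τ - F n τ)) +
        (F n t - F n τ - (t - τ) • G n τ) + (t - τ) • (G n τ - g τ)‖ := by
        rw [smul_sub]; congr 1; ring
    _ ≤ _ := norm_add₃_le
    _ ≤ ε / 2 * ‖t - τ‖ + ε / 4 * ‖t - τ‖ + ε / 4 * ‖t - τ‖ := by gcongr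
    _ = ε * ‖t - τ‖ := by ring

/-- The error is at most `‖x₀ - x k‖ ‖y k‖ + ‖x₀‖ ‖y₀ - y k‖`, in which time no longer appears. -/
theorem tendstoUniformlyOn_inner {ρ : ℝ → FockSpace →L[ℂ] FockSpace} {s : Set ℝ}
    (hρ : ∀ τ ∈ s, ‖ρ τ‖ ≤ 1) {x y : ℕ → FockSpace} {x₀ y₀ : FockSpace}
    (hx : Tendsto x atTop (𝓝 x₀)) (hy : Tendsto y atTop (𝓝 y₀)) :
    TendstoUniformlyOn (fun k τ => ⟪x k, ρ τ (y k)⟫_ℂ) (fun τ => ⟪x₀, ρ τ y₀⟫_ℂ) atTop s := by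
  rw [Metric.tendstoUniformlyOn_iff]
  intro ε hε
  have hlim : Tendsto (fun k => ‖x₀ - x k‖ * ‖y k‖ + ‖x₀‖ * ‖y₀ - y k‖) atTop (𝓝 0) := by
    have h1 := ((tendsto_const_nhds (x := x₀)).sub hx).norm
    have h2 := ((tendsto_const_nhds (x := y₀)).sub hy).norm
    simpa using (h1.mul hy.norm).add (h2.const_mul ‖x₀‖)
  filter_upwards [hlim.eventually_lt_const hε] with k hk τ hτ
  refine lt_of_le_of_lt ?_ hk
  have h : ⟪x₀, ρ τ y₀⟫_ℂ - ⟪x k, ρ τ (y k)⟫_ℂ =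
      ⟪x₀ - x k, ρ τ (y k)⟫_ℂ + ⟪x₀, ρ τ (y₀ - y k)⟫_ℂ := by
    rw [map_sub, inner_sub_left, inner_sub_right]; ring
  have hb : ∀ z, ‖ρ τ z‖ ≤ ‖z‖ := fun z => by
    simpa using (ρ τ).le_of_opNorm_le (hρ τ hτ) z
  rw [dist_eq_norm, h]
  refine (norm_add_le _ _).trans (add_le_add ?_ ?_)
  · exact (norm_inner_le_norm _ _).trans (by gcongr; exact hb _)
  · exact (norm_inner_le_norm _ _).trans (by gcongr; exact hb _)

theorem tendstoUniformlyOn_const_mul {F : ℕ → ℝ → ℂ} {f : ℝ → ℂ} {s : Set ℝ}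
    (h : TendstoUniformlyOn F f atTop s) (c : ℂ) :
    TendstoUniformlyOn (fun k τ => c * F k τ) (fun τ => c * f τ) atTop s :=
  (uniformContinuous_const_smul c).comp_tendstoUniformlyOn h

theorem inner_star_mul_mul (U ρ : FockSpace →L[ℂ] FockSpace) (x y : FockSpace) :
    ⟪x, (star U * ρ * U) y⟫_ℂ = ⟪U x, ρ (U y)⟫_ℂ := by
  rw [mul_assoc, mul_apply_eq_comp, mul_apply_eq_comp, inner_star_right]

/-- A canonical transformation maps solutions to solutions of the transformed equation. -/
theorem IsLindbladSolution.bogoliubov {U : FockSpace →L[ℂ] FockSpace}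
    (hU : U ∈ unitary (FockSpace →L[ℂ] FockSpace)) {u v w h k l p q s : ℂ}
    (hB : IsBogoliubov U u v w) {ρ : ℝ → FockSpace →L[ℂ] FockSpace}
    (hρ : IsLindbladSolution (linOp h k l) (linOp p q s) ρ) :
    IsLindbladSolution (linOp (h * u + k * conj v) (h * v + k * conj u) (h * w + k * conj w + l))
      (linOp (p * u + q * conj v) (p * v + q * conj u) (p * w + q * conj w + s))
      (fun τ => star U * ρ τ * U) := by
  refine ⟨fun τ hτ => (hρ.1 τ hτ).unitary_conj hU, fun f g τ hτ => ?_⟩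
  have hnorm : ∀ τ ∈ Set.Ici (0 : ℝ), ‖ρ τ‖ ≤ 1 := fun τ hτ => (hρ.1 τ hτ).norm_le
  have h1 : Intertwines U 1 1 := fun f => (truncShift_one _).tendsto
  have hH := hB.intertwines_linOp h k l
  have hL' : Intertwines U (dag (linOp p q s)) (dag (linOp (p * u + q * conj v)
      (p * v + q * conj u) (p * w + q * conj w + s))) := by
    rw [dag_linOp, dag_linOp]
    convert! hB.intertwines_linOp (conj q) (conj p) (conj s) using 2 <;>
      simp only [map_add, map_mul, Complex.conj_conj] <;> ring
  have hH' : Intertwines U (dag (linOp h k l)) (dag (linOp (h * u + k * conj v)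
      (h * v + k * conj u) (h * w + k * conj w + l))) := by
    rw [dag_linOp, dag_linOp]
    convert! hB.intertwines_linOp (conj k) (conj h) (conj l) using 2 <;>
      simp only [map_add, map_mul, Complex.conj_conj] <;> ring
  have hLL : Intertwines U (dag (linOp p q s) * linOp p q s) (dag (linOp (p * u + q * conj v)
      (p * v + q * conj u) (p * w + q * conj w + s)) * linOp (p * u + q * conj v)
      (p * v + q * conj u) (p * w + q * conj w + s)) := by
    rw [dag_linOp, dag_linOp]
    convert! hB.intertwines_linOp_mul (conj q) (conj p) (conj s) p q s using 3 <;>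
      simp only [map_add, map_mul, Complex.conj_conj] <;> ring
  have key := fun {T T' S S' : Op} (hT : Intertwines U T T') (hS : Intertwines U S S') =>
    tendstoUniformlyOn_inner hnorm (hT f) (hS g)
  -- The truncations of `U f` and `U g` are admissible test vectors. The matrix elements converge
  -- pointwise and their derivatives uniformly in time, so the equation passes to the limit.
  refine hasDerivWithinAt_Ici_of_tendstoUniformlyOn
    (F := fun n τ => ⟪toFock (trunc n (U (toFock f))), ρ τ (toFock (trunc n (U (toFock g))))⟫_ℂ)
    (g := fun τ => lindbladForm _ _ (star U * ρ τ * U) f g)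
    (fun n τ hτ => hρ.2 _ _ τ hτ) (fun τ hτ => ?_) ?_ hτ
  · simp only [inner_star_mul_mul]
    exact (key h1 h1).tendsto_at hτ
  · simp only [lindbladForm, inner_star_mul_mul]
    exact (tendstoUniformlyOn_const_mul ((key hH' h1).sub (key h1 hH)) _).add
      ((key hL' hL').sub (tendstoUniformlyOn_const_mul ((key hLL h1).add (key h1 hLL)) _))

/-- The invariance of the Lindblad generator under shifts of the coupling operator that are
compensated by the Hamiltonian. -/
theorem lindbladForm_gauge {h l μ c σ : ℂ} (hl : conj l = l) (hσ : σ * conj σ = μ * conj μ)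
    (hc : Complex.I * h = 1 / 2 * (μ * conj c)) (ρ : FockSpace →L[ℂ] FockSpace)
    (f g : FiniteFock) :
    lindbladForm (linOp h (conj h) l) (linOp μ 0 c) ρ f g =
      lindbladForm 0 (linOp σ 0 0) ρ f g := by
  have h0 : dag 0 = 0 := dag_eq (fun f g => by simp)
  have hc' := congrArg conj hc
  simp only [map_mul, Complex.conj_I, map_div₀, map_one, map_ofNat, Complex.conj_conj] at hc'
  simp only [lindbladForm, dag_linOp, h0, map_zero, linOp_mul_linOp]
  simp only [linOp, LinearMap.add_apply, LinearMap.smul_apply, Module.End.one_apply, map_add,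
    map_smul, inner_add_left, inner_add_right, inner_smul_left, inner_smul_right, map_mul,
    Complex.conj_conj, map_zero, LinearMap.zero_apply, inner_zero_left, inner_zero_right, hl]
  set a1 := ⟪toFock f, ρ (toFock g)⟫_ℂ
  set a2 := ⟪toFock (ann f), ρ (toFock g)⟫_ℂ
  set a3 := ⟪toFock (cre f), ρ (toFock g)⟫_ℂ
  set a4 := ⟪toFock f, ρ (toFock (ann g))⟫_ℂ
  set a5 := ⟪toFock f, ρ (toFock (cre g))⟫_ℂ
  set a6 := ⟪toFock (cre f), ρ (toFock (cre g))⟫_ℂ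
  set a7 := ⟪toFock ((cre * ann) f), ρ (toFock g)⟫_ℂ
  set a8 := ⟪toFock f, ρ (toFock ((cre * ann) g))⟫_ℂ
  linear_combination (-a3 + a4) * hc + (a2 - a5) * hc' - (a6 - 1 / 2 * (a7 + a8)) * hσ

/-! ### Probability generating functions -/

section GeneratingFunction

variable {q : ℕ → ℝ}

/-- The probability generating function of `q`. -/
def genFun (q : ℕ → ℝ) (z : ℝ) : ℝ := ∑' n, q n * z ^ n

/-- The mean value of `q`. -/
def meanValue (q : ℕ → ℝ) : ℝ≥0∞ := ∑' n : ℕ, (n : ℝ≥0∞) * ENNReal.ofReal (q n)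

theorem summable_genFun (h0 : ∀ n, 0 ≤ q n) (hq : HasSum q 1) {z : ℝ} (hz0 : 0 ≤ z)
    (hz1 : z ≤ 1) : Summable fun n => q n * z ^ n :=
  hq.summable.of_nonneg_of_le (fun n => mul_nonneg (h0 n) (pow_nonneg hz0 n)) fun n =>
    mul_le_of_le_one_right (h0 n) (pow_le_one₀ hz0 hz1)

theorem genFun_zero (q : ℕ → ℝ) : genFun q 0 = q 0 := by
  rw [genFun, tsum_eq_single 0 (fun n hn => by simp [hn])]
  simp

/-- Termwise, `(1 - z^n) / (1 - z)` is a geometric sum, which increases to `n` as `z → 1`. The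
difference quotient thus approaches the mean from below, even when the mean is infinite. -/
theorem ofReal_one_sub_genFun (h0 : ∀ n, 0 ≤ q n) (hq : HasSum q 1) {z : ℝ} (hz0 : 0 ≤ z)
    (hz1 : z < 1) : ENNReal.ofReal ((1 - genFun q z) / (1 - z)) =
      ∑' n, ENNReal.ofReal (q n * ∑ j ∈ Finset.range n, z ^ j) := by
  have h1 : HasSum (fun n => q n * ∑ j ∈ Finset.range n, z ^ j)
      ((1 - genFun q z) / (1 - z)) := by
    have h2 := (hq.sub (summable_genFun h0 hq hz0 hz1.le).hasSum).div_const (1 - z)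
    convert! h2 using 2 with n
    rw [geom_sum_eq hz1.ne, ← mul_one_sub, mul_div_assoc, ← neg_sub 1 (z ^ n), ← neg_sub 1 z,
      neg_div_neg_eq]
  rw [← h1.tsum_eq, ENNReal.ofReal_tsum_of_nonneg _ h1.summable]
  exact fun n => mul_nonneg (h0 n) (Finset.sum_nonneg fun j _ => pow_nonneg hz0 j)

theorem ofReal_one_sub_genFun_le (h0 : ∀ n, 0 ≤ q n) (hq : HasSum q 1) {z : ℝ} (hz0 : 0 ≤ z)
    (hz1 : z < 1) : ENNReal.ofReal ((1 - genFun q z) / (1 - z)) ≤ meanValue q := by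
  rw [ofReal_one_sub_genFun h0 hq hz0 hz1]
  refine ENNReal.tsum_le_tsum fun n => ?_
  rw [← ENNReal.ofReal_natCast, ← ENNReal.ofReal_mul n.cast_nonneg, mul_comm (n : ℝ)]
  refine ENNReal.ofReal_le_ofReal (mul_le_mul_of_nonneg_left ?_ (h0 n))
  exact (Finset.sum_le_card_nsmul _ _ 1 fun j _ => pow_le_one₀ hz0 hz1.le).trans (by simp)

/-- Finite partial sums are continuous at `z = 1` and bound the limit from below; the termwise
estimate bounds it from above. -/
theorem tendsto_one_sub_genFun (h0 : ∀ n, 0 ≤ q n) (hq : HasSum q 1) :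
    Tendsto (fun z => ENNReal.ofReal ((1 - genFun q z) / (1 - z))) (𝓝[Set.Ico 0 1] 1)
      (𝓝 (meanValue q)) := by
  refine tendsto_order.2 ⟨fun a ha => ?_, fun a ha => ?_⟩
  · have h1 := (ENNReal.summable (f := fun n : ℕ =>
      (n : ℝ≥0∞) * ENNReal.ofReal (q n))).hasSum.eventually_const_lt ha
    obtain ⟨s, hs⟩ := h1.exists
    have hcont : Continuous fun z : ℝ =>
        ∑ n ∈ s, ENNReal.ofReal (q n * ∑ j ∈ Finset.range n, z ^ j) :=
      continuous_finsetSum _ fun n _ => ENNReal.continuous_ofReal.comp (by fun_prop)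
    have hlim := (hcont.tendsto 1).mono_left (nhdsWithin_le_nhds (s := Set.Ico 0 1))
    have hval : ∑ n ∈ s, ENNReal.ofReal (q n * ∑ j ∈ Finset.range n, (1 : ℝ) ^ j) =
        ∑ n ∈ s, (n : ℝ≥0∞) * ENNReal.ofReal (q n) := Finset.sum_congr rfl fun n _ => by
      rw [mul_comm, ENNReal.ofReal_mul (by simp)]
      simp
    rw [hval] at hlim
    filter_upwards [hlim.eventually_const_lt hs, self_mem_nhdsWithin] with z hz hz01
    rw [ofReal_one_sub_genFun h0 hq hz01.1 hz01.2]
    exact hz.trans_le (ENNReal.sum_le_tsum s)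
  · filter_upwards [self_mem_nhdsWithin] with z hz
    exact (ofReal_one_sub_genFun_le h0 hq hz.1 hz.2).trans_lt ha

theorem tendsto_genFun (h0 : ∀ n, 0 ≤ q n) (hq : HasSum q 1) :
    Tendsto (genFun q) (𝓝[Set.Ico 0 1] 1) (𝓝 1) := by
  suffices h : Tendsto (genFun q) (𝓝[Set.Ico 0 1] 1) (𝓝 (∑' n, q n)) by rwa [hq.tsum_eq] at h
  refine tendsto_tsum_of_dominated_convergence hq.summable (fun n => ?_) ?_
  · have : Continuous fun z : ℝ => q n * z ^ n := by fun_prop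
    simpa using (this.tendsto 1).mono_left (nhdsWithin_le_nhds (s := Set.Ico 0 1))
  · filter_upwards [self_mem_nhdsWithin] with z hz n
    rw [Real.norm_eq_abs, abs_of_nonneg (mul_nonneg (h0 n) (pow_nonneg hz.1 n))]
    exact mul_le_of_le_one_right (h0 n) (pow_le_one₀ hz.1 hz.2.le)

end GeneratingFunction

/-! ### The pure death process -/

/-- The pure death process with rate `κ`: every excitation decays independently. -/
structure IsPureDeath (κ : ℝ) (p : ℝ → ℕ → ℝ) : Prop where
  rate_pos : 0 < κ
  nonneg : ∀ τ, 0 ≤ τ → ∀ n, 0 ≤ p τ n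
  hasSum : ∀ τ, 0 ≤ τ → HasSum (p τ) 1
  hasDerivWithinAt : ∀ τ, 0 ≤ τ → ∀ n : ℕ, HasDerivWithinAt (fun τ => p τ n)
    (κ * ((n + 1) * p τ (n + 1) - n * p τ n)) (Set.Ici 0) τ

namespace IsPureDeath

variable {κ : ℝ} {p : ℝ → ℕ → ℝ} {τ : ℝ}

theorem le_one (h : IsPureDeath κ p) (hτ : 0 ≤ τ) (n : ℕ) : p τ n ≤ 1 :=
  le_hasSum (h.hasSum τ hτ) n fun m _ => h.nonneg τ hτ m

/-- The solution of the transport equation for the generating function. -/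
theorem genFun_eq (h : IsPureDeath κ p) (hτ : 0 ≤ τ) {z : ℝ} (hz0 : 0 ≤ z) (hz1 : z < 1) :
    genFun (p τ) z = genFun (p 0) (1 - (1 - z) * Real.exp (-κ * τ)) := by
  have hκ := h.rate_pos
  -- The characteristic of the transport equation that passes through `z` at time `τ`.
  set w : ℝ → ℝ := fun s => 1 - (1 - z) * Real.exp (-κ * (τ - s)) with hw
  have hexp : ∀ s ∈ Set.Icc 0 τ, Real.exp (-κ * (τ - s)) ≤ 1 ∧
      Real.exp (-κ * τ) ≤ Real.exp (-κ * (τ - s)) := fun s hs => by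
    constructor
    · rw [Real.exp_le_one_iff]; nlinarith [hs.2]
    · rw [Real.exp_le_exp]; nlinarith [hs.1]
  have hw0 : ∀ s ∈ Set.Icc 0 τ, 0 ≤ w s := fun s hs => by
    have := (hexp s hs).1
    have h1 : (1 - z) * Real.exp (-κ * (τ - s)) ≤ 1 - z :=
      mul_le_of_le_one_right (by linarith) this
    simp only [hw]; linarith
  have hwR : ∀ s ∈ Set.Icc 0 τ, w s ≤ w 0 := fun s hs => by
    have h1 : (1 - z) * Real.exp (-κ * τ) ≤ (1 - z) * Real.exp (-κ * (τ - s)) :=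
      mul_le_mul_of_nonneg_left (hexp s hs).2 (by linarith)
    simp only [hw, sub_zero]; linarith
  have hR1 : w 0 < 1 := by
    have : 0 < (1 - z) * Real.exp (-κ * (τ - 0)) :=
      mul_pos (by linarith) (Real.exp_pos _)
    simp only [hw]; linarith
  have h0mem : (0 : ℝ) ∈ Set.Icc 0 τ := ⟨le_rfl, hτ⟩
  have hR0 : 0 ≤ w 0 := hw0 0 h0mem
  have hwd : ∀ s, HasDerivAt w (-κ * (1 - w s)) s := fun s => by
    have h1 : HasDerivAt (fun s => -κ * (τ - s)) κ s := by
      simpa using ((hasDerivAt_id s).const_sub τ).const_mul (-κ)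
    have h2 := (h1.exp.const_mul (1 - z)).const_sub 1
    refine h2.congr_deriv ?_
    simp only [hw]; ring
  -- Along the characteristic the derivative of the partial sum telescopes, leaving only the flux
  -- from level `N`. It tends to zero because `w ≤ w 0 < 1` and `p ≤ 1`, so no moment of the initial
  -- state is required.
  have hsum : ∀ N : ℕ, ∀ s ∈ Set.Icc 0 τ, HasDerivWithinAt
      (fun s => ∑ n ∈ Finset.range N, p s n * w s ^ n) (κ * (N * p s N * w s ^ (N - 1)))
      (Set.Icc 0 τ) s := by
    intro N s hs
    induction N with
    | zero => simpa using hasDerivWithinAt_const s (Set.Icc 0 τ) (0 : ℝ)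
    | succ N ih =>
      simp only [Finset.sum_range_succ]
      have h1 := ((h.hasDerivWithinAt s hs.1 N).mono
        (Set.Icc_subset_Ici_self : Set.Icc 0 τ ⊆ _)).mul
        ((hwd s).pow N).hasDerivWithinAt
      refine (ih.add h1).congr_deriv ?_
      rcases N with _ | N
      · simp
      · simp only [Pi.pow_apply, Nat.add_sub_cancel, Nat.cast_add, Nat.cast_one, pow_succ]
        ring
  have hbound : ∀ N : ℕ, ‖(∑ n ∈ Finset.range N, p τ n * z ^ n) -
      ∑ n ∈ Finset.range N, p 0 n * w 0 ^ n‖ ≤ κ * (N * w 0 ^ (N - 1)) * τ := fun N => by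
    have h1 := (convex_Icc 0 τ).norm_image_sub_le_of_norm_hasDerivWithin_le (hsum N)
      (C := κ * (N * w 0 ^ (N - 1))) (fun s hs => ?_) h0mem ⟨hτ, le_rfl⟩
    · have hwτ : w τ = z := by simp [hw]
      simpa [hwτ, abs_of_nonneg hτ] using h1
    · have hp := h.nonneg s hs.1 N
      have hw' := hw0 s hs
      rw [Real.norm_eq_abs, abs_of_nonneg (by positivity)]
      have h2 : p s N * w s ^ (N - 1) ≤ 1 * w 0 ^ (N - 1) := by
        gcongr
        · exact h.le_one hs.1 N
        · exact hwR s hs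
      rw [one_mul] at h2
      rw [mul_assoc (N : ℝ)]
      gcongr
  have hlim : Tendsto (fun N : ℕ => κ * (N * w 0 ^ (N - 1)) * τ) atTop (𝓝 0) := by
    rw [← tendsto_add_atTop_iff_nat 1]
    have h1 := tendsto_self_mul_const_pow_of_lt_one hR0 hR1
    have h2 := tendsto_pow_atTop_nhds_zero_of_lt_one hR0 hR1
    have h3 := ((h1.add h2).const_mul κ).mul_const τ
    rw [add_zero, mul_zero, zero_mul] at h3
    refine h3.congr fun N => ?_
    simp only [Nat.add_sub_cancel]
    push_cast; ring
  have h1 := (summable_genFun (h.nonneg τ hτ) (h.hasSum τ hτ) hz0 hz1.le).hasSum.tendsto_sum_nat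
  have h2 := (summable_genFun (h.nonneg 0 le_rfl) (h.hasSum 0 le_rfl) hR0
    hR1.le).hasSum.tendsto_sum_nat
  have h3 := tendsto_nhds_unique (h1.sub h2) (squeeze_zero_norm hbound hlim)
  rw [sub_eq_zero] at h3
  rw [genFun, h3]
  simp only [hw, sub_zero]
  rfl

theorem ofReal_one_sub_genFun_eq (h : IsPureDeath κ p) (hτ : 0 ≤ τ) {z : ℝ} (hz0 : 0 ≤ z)
    (hz1 : z < 1) : ENNReal.ofReal ((1 - genFun (p τ) z) / (1 - z)) =
      ENNReal.ofReal (Real.exp (-κ * τ)) *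
        ENNReal.ofReal ((1 - genFun (p 0) (1 - (1 - z) * Real.exp (-κ * τ))) /
          (1 - (1 - (1 - z) * Real.exp (-κ * τ)))) := by
  rw [h.genFun_eq hτ hz0 hz1, ← ENNReal.ofReal_mul (Real.exp_pos _).le]
  congr 1
  have h1 : 1 - z ≠ 0 := by linarith
  have h2 := (Real.exp_pos (-κ * τ)).ne'
  rw [sub_sub_cancel]
  field_simp

theorem mem_Ico (h : IsPureDeath κ p) (hτ : 0 ≤ τ) {z : ℝ} (hz : z ∈ Set.Ico (0 : ℝ) 1) :
    1 - (1 - z) * Real.exp (-κ * τ) ∈ Set.Ico (0 : ℝ) 1 := by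
  have hκ := h.rate_pos
  have h1 : Real.exp (-κ * τ) ≤ 1 := by rw [Real.exp_le_one_iff]; nlinarith
  have h2 := Real.exp_pos (-κ * τ)
  constructor
  · have := mul_le_of_le_one_right (a := 1 - z) (by linarith [hz.2]) h1
    linarith [hz.1]
  · have : 0 < (1 - z) * Real.exp (-κ * τ) := mul_pos (by linarith [hz.2]) h2
    linarith

/-- The map `z ↦ 1 - (1 - z) e^{-κτ}` tends to `1` within `[0, 1)` and multiplies the distance to
`1` by `e^{-κτ}`; that factor comes out of the difference quotient in the limit. -/
theorem meanValue_eq (h : IsPureDeath κ p) (hτ : 0 ≤ τ) :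
    meanValue (p τ) = ENNReal.ofReal (Real.exp (-κ * τ)) * meanValue (p 0) := by
  have h1 := tendsto_one_sub_genFun (h.nonneg τ hτ) (h.hasSum τ hτ)
  have h2 := tendsto_one_sub_genFun (h.nonneg 0 le_rfl) (h.hasSum 0 le_rfl)
  have hcont : Continuous fun z : ℝ => 1 - (1 - z) * Real.exp (-κ * τ) := by fun_prop
  have h3 : Tendsto (fun z : ℝ => 1 - (1 - z) * Real.exp (-κ * τ)) (𝓝[Set.Ico 0 1] 1)
      (𝓝[Set.Ico 0 1] 1) := by
    refine tendsto_nhdsWithin_iff.2 ⟨?_, ?_⟩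
    · simpa using (hcont.tendsto 1).mono_left (nhdsWithin_le_nhds (s := Set.Ico 0 1))
    · filter_upwards [self_mem_nhdsWithin] with z hz using h.mem_Ico hτ hz
  have h4 := ENNReal.Tendsto.const_mul (a := ENNReal.ofReal (Real.exp (-κ * τ))) (h2.comp h3)
    (Or.inr ENNReal.ofReal_ne_top)
  have : (𝓝[Set.Ico (0 : ℝ) 1] 1).NeBot := by
    rw [nhdsWithin_Ico_eq_nhdsLT zero_lt_one]; infer_instance
  refine tendsto_nhds_unique h1 (h4.congr' ?_)
  filter_upwards [self_mem_nhdsWithin] with z hz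
  exact (h.ofReal_one_sub_genFun_eq hτ hz.1 hz.2).symm

theorem vacuum_eq (h : IsPureDeath κ p) (hτ : 0 ≤ τ) :
    p τ 0 = genFun (p 0) (1 - Real.exp (-κ * τ)) := by
  rw [← genFun_zero (p τ), h.genFun_eq hτ le_rfl zero_lt_one, sub_zero, one_mul]

theorem ofReal_exp_mul_one_sub_vacuum (h : IsPureDeath κ p) (hτ : 0 ≤ τ) :
    Real.exp (κ * τ) * (1 - p τ 0) = (1 - genFun (p 0) (1 - Real.exp (-κ * τ))) /
      (1 - (1 - Real.exp (-κ * τ))) := by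
  rw [h.vacuum_eq hτ, sub_sub_cancel, div_eq_inv_mul, ← Real.exp_neg, neg_mul, neg_neg]

theorem tendsto_nhdsWithin (h : IsPureDeath κ p) :
    Tendsto (fun τ => 1 - Real.exp (-κ * τ)) atTop (𝓝[Set.Ico 0 1] 1) := by
  refine tendsto_nhdsWithin_iff.2 ⟨?_, ?_⟩
  · have h1 : Tendsto (fun τ => -κ * τ) atTop atBot :=
      tendsto_id.const_mul_atTop_of_neg (neg_lt_zero.2 h.rate_pos)
    simpa using (Real.tendsto_exp_atBot.comp h1).const_sub 1
  · filter_upwards [eventually_ge_atTop 0] with τ hτ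
    simpa using h.mem_Ico hτ (z := 0) ⟨le_rfl, zero_lt_one⟩

theorem ofReal_one_sub_vacuum_le (h : IsPureDeath κ p) (hτ : 0 ≤ τ) :
    ENNReal.ofReal (1 - p τ 0) ≤ ENNReal.ofReal (Real.exp (-κ * τ)) * meanValue (p 0) := by
  have hmem : 1 - Real.exp (-κ * τ) ∈ Set.Ico (0 : ℝ) 1 := by
    simpa using h.mem_Ico hτ (z := 0) ⟨le_rfl, zero_lt_one⟩
  have h1 : 1 - p τ 0 = Real.exp (-κ * τ) * (Real.exp (κ * τ) * (1 - p τ 0)) := by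
    rw [← mul_assoc, ← Real.exp_add]; simp
  rw [h1, h.ofReal_exp_mul_one_sub_vacuum hτ, ENNReal.ofReal_mul (Real.exp_pos _).le]
  gcongr
  exact ofReal_one_sub_genFun_le (h.nonneg 0 le_rfl) (h.hasSum 0 le_rfl) hmem.1 hmem.2

theorem tendsto_exp_mul_one_sub_vacuum (h : IsPureDeath κ p) :
    Tendsto (fun τ => ENNReal.ofReal (Real.exp (κ * τ) * (1 - p τ 0))) atTop
      (𝓝 (meanValue (p 0))) := by
  refine ((tendsto_one_sub_genFun (h.nonneg 0 le_rfl) (h.hasSum 0 le_rfl)).comp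
    h.tendsto_nhdsWithin).congr' ?_
  filter_upwards [eventually_ge_atTop 0] with τ hτ
  rw [h.ofReal_exp_mul_one_sub_vacuum hτ, Function.comp_apply]

theorem tendsto_vacuum (h : IsPureDeath κ p) : Tendsto (fun τ => p τ 0) atTop (𝓝 1) := by
  refine ((tendsto_genFun (h.nonneg 0 le_rfl) (h.hasSum 0 le_rfl)).comp
    h.tendsto_nhdsWithin).congr' ?_
  filter_upwards [eventually_ge_atTop 0] with τ hτ
  rw [h.vacuum_eq hτ, Function.comp_apply]

end IsPureDeath

/-! ### Amplitude damping in the Fock basis -/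

theorem cre_single (n : ℕ) : cre (Finsupp.single n 1) =
    ((√((n : ℝ) + 1) : ℝ) : ℂ) • Finsupp.single (n + 1) 1 := by
  simp [cre]

theorem cre_ann_single (n : ℕ) : cre (ann (Finsupp.single n 1)) =
    (n : ℂ) • Finsupp.single n (1 : ℂ) := by
  ext m
  rw [cre_ann_apply]
  simp only [Finsupp.smul_apply, Finsupp.single_apply, smul_eq_mul]
  split_ifs with h
  · rw [h]
  · simp

/-- The matrix elements of the amplitude damping generator. -/
theorem lindbladForm_damping (σ : ℂ) (ρ : FockSpace →L[ℂ] FockSpace) (m n : ℕ) :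
    lindbladForm 0 (linOp σ 0 0) ρ (Finsupp.single m 1) (Finsupp.single n 1) = σ * conj σ *
      ((√((m : ℝ) + 1) : ℝ) * (√((n : ℝ) + 1) : ℝ) * ⟪fock (m + 1), ρ (fock (n + 1))⟫_ℂ -
        (m + n) / 2 * ⟪fock m, ρ (fock n)⟫_ℂ) := by
  have h0 : dag 0 = 0 := dag_eq (fun f g => by simp)
  simp only [lindbladForm, dag_linOp, h0]
  simp only [linOp, LinearMap.smul_apply,
    Module.End.mul_apply, map_zero, zero_smul, add_zero, zero_add, LinearMap.zero_apply,
    map_smul, cre_single, cre_ann_single, toFock_single, one_smul, inner_smul_left,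
    inner_smul_right, inner_zero_left, inner_zero_right, Complex.conj_conj, Complex.conj_ofReal,
    Complex.conj_natCast]
  ring

/-- The damping generator couples the entry `(m, n)` only to itself and to `(m+1, n+1)`, so the
diagonal evolves on its own. -/
theorem IsLindbladSolution.isPureDeath {κ : ℝ} (hκ : 0 < κ) {σ : ℂ} (hσ : σ * conj σ = κ)
    {ρ : ℝ → FockSpace →L[ℂ] FockSpace} (h : IsLindbladSolution 0 (linOp σ 0 0) ρ) :
    IsPureDeath κ fun τ n => (⟪fock n, ρ τ (fock n)⟫_ℂ).re where
  rate_pos := hκ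
  nonneg τ hτ n := (h.1 τ hτ).1.re_inner_nonneg_right _
  hasSum τ hτ := by simpa using Complex.hasSum_re (h.1 τ hτ).2
  hasDerivWithinAt τ hτ n := by
    have h1 := h.2 (Finsupp.single n 1) (Finsupp.single n 1) τ hτ
    rw [lindbladForm_damping, hσ] at h1
    have h2 := Complex.reCLM.hasFDerivAt.comp_hasDerivWithinAt τ h1
    simp only [toFock_single, one_smul] at h2
    refine h2.congr_deriv ?_
    rw [← Complex.ofReal_mul, Real.mul_self_sqrt (by positivity), Complex.reCLM_apply,
      Complex.re_ofReal_mul, Complex.sub_re, Complex.re_ofReal_mul]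
    congr 2
    rw [show ((n : ℂ) + n) / 2 = ((n : ℝ) : ℂ) by push_cast; ring, Complex.re_ofReal_mul]

/-! ### The amplitude damping channel in Kraus form -/

theorem isPositive_of_hasSum {T : ℕ → FockSpace →L[ℂ] FockSpace} {S : FockSpace →L[ℂ] FockSpace}
    (hT : ∀ k, (T k).IsPositive) (h : HasSum T S) : S.IsPositive := by
  refine (ContinuousLinearMap.isPositive_iff_complex S).2 fun x => ?_
  have h1 : HasSum (fun k => ⟪T k x, x⟫_ℂ) ⟪S x, x⟫_ℂ := by
    have := (h.mapL (ContinuousLinearMap.apply ℂ FockSpace x)).map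
      (g := (⟨⟨fun y => ⟪y, x⟫_ℂ, inner_zero_left x⟩, fun y z => inner_add_left y z x⟩ :
        FockSpace →+ ℂ)) (by change Continuous fun y => ⟪y, x⟫_ℂ; fun_prop)
    exact this
  have h2 := fun k => (ContinuousLinearMap.isPositive_iff_complex (T k)).1 (hT k) x
  have him : ∀ k, (⟪T k x, x⟫_ℂ).im = 0 := fun k => by rw [← (h2 k).1]; simp
  have h3 := Complex.hasSum_im h1
  simp only [him] at h3
  refine ⟨Complex.ext rfl ?_, (Complex.hasSum_re h1).nonneg fun k => (h2 k).2⟩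
  rw [← hasSum_zero.unique h3]
  simp

theorem hasSum_inner_of_hasSum {T : ℕ → FockSpace →L[ℂ] FockSpace}
    {S : FockSpace →L[ℂ] FockSpace} (h : HasSum T S) (x y : FockSpace) :
    HasSum (fun k => ⟪x, T k y⟫_ℂ) ⟪x, S y⟫_ℂ :=
  (h.mapL (ContinuousLinearMap.apply ℂ FockSpace y)).mapL (innerSL ℂ x)

/-- The trace of a positive operator dominates its norm, so the series converges absolutely in
operator norm. -/
theorem summable_of_diagSum {T : ℕ → FockSpace →L[ℂ] FockSpace} (hT : ∀ k, (T k).IsPositive)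
    (h : ∑' k, diagSum (T k) = 1) : Summable T := by
  have htop : ∑' k, diagSum (T k) ≠ ⊤ := by rw [h]; exact ENNReal.one_ne_top
  refine Summable.of_norm_bounded (ENNReal.summable_toReal htop) fun k => ?_
  refine norm_le_of_diagSum_le (hT k) ENNReal.toReal_nonneg ?_
  rw [ENNReal.ofReal_toReal (ENNReal.ne_top_of_tsum_ne_top htop k)]

theorem isDensity_tsum {T : ℕ → FockSpace →L[ℂ] FockSpace} (hT : ∀ k, (T k).IsPositive)
    (h : ∑' k, diagSum (T k) = 1) : IsDensity (∑' k, T k) := by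
  have hs := (summable_of_diagSum hT h).hasSum
  refine isDensity_iff.2 ⟨isPositive_of_hasSum hT hs, ?_⟩
  rw [← h]
  simp only [diagSum]
  rw [ENNReal.tsum_comm]
  refine tsum_congr fun n => ?_
  have h1 := Complex.hasSum_re (hasSum_inner_of_hasSum hs (fock n) (fock n))
  have h0 : ∀ k, 0 ≤ (⟪fock n, T k (fock n)⟫_ℂ).re := fun k => (hT k).re_inner_nonneg_right _
  rw [← h1.tsum_eq, ENNReal.ofReal_tsum_of_nonneg h0 h1.summable]

theorem memℓp_weightedShift {c : ℕ → ℝ} (hc : ∀ n, |c n| ≤ 1) (k : ℕ) (x : FockSpace) :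
    Memℓp (fun n => (c n : ℂ) * x (n + k)) 2 := by
  refine memℓp_gen ?_
  have h1 := (summable_nat_add_iff k).2 (hasSum_norm_sq x).summable
  simp only [ENNReal.toReal_ofNat, Real.rpow_ofNat]
  refine h1.of_nonneg_of_le (fun n => by positivity) fun n => ?_
  rw [norm_mul, Complex.norm_real]
  exact pow_le_pow_left₀ (by positivity) (mul_le_of_le_one_left (norm_nonneg _) (hc n)) 2

/-- The contraction `|n + k⟩ ↦ c n |n⟩`, `|j⟩ ↦ 0` for `j < k`. -/
def weightedShift (c : ℕ → ℝ) (hc : ∀ n, |c n| ≤ 1) (k : ℕ) : FockSpace →L[ℂ] FockSpace :=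
  LinearMap.mkContinuous
    { toFun := fun x => ⟨fun n => (c n : ℂ) * x (n + k), memℓp_weightedShift hc k x⟩
      map_add' := fun x y => lp.ext (funext fun n => mul_add _ _ _)
      map_smul' := fun a x => lp.ext (funext fun n => mul_left_comm _ _ _) } 1 fun x => by
    refine abs_le_of_sq_le_sq' ?_ (by positivity) |>.2
    rw [one_mul]
    have h1 := (summable_nat_add_iff k).2 (hasSum_norm_sq x).summable
    have h2 : ∑' n, ‖x (n + k)‖ ^ 2 ≤ ‖x‖ ^ 2 := by
      rw [← (hasSum_norm_sq x).tsum_eq]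
      exact tsum_comp_le_tsum_of_inj (hasSum_norm_sq x).summable (fun n => by positivity)
        (add_left_injective k)
    refine le_trans (hasSum_le (fun n => ?_) (hasSum_norm_sq _) h1.hasSum) h2
    change ‖(c n : ℂ) * x (n + k)‖ ^ 2 ≤ _
    rw [norm_mul, Complex.norm_real]
    exact pow_le_pow_left₀ (by positivity) (mul_le_of_le_one_left (norm_nonneg _) (hc n)) 2

theorem weightedShift_apply (c : ℕ → ℝ) (hc : ∀ n, |c n| ≤ 1) (k : ℕ) (x : FockSpace) (n : ℕ) :
    weightedShift c hc k x n = c n * x (n + k) := rfl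

theorem star_weightedShift_fock (c : ℕ → ℝ) (hc : ∀ n, |c n| ≤ 1) (k n : ℕ) :
    star (weightedShift c hc k) (fock n) = (c n : ℂ) • fock (n + k) := by
  refine ext_inner_right ℂ fun x => ?_
  rw [inner_star_left, inner_fock_left, weightedShift_apply, inner_smul_left, inner_fock_left,
    Complex.conj_ofReal]

theorem choose_mul_pow_le_one {x : ℝ} (h0 : 0 ≤ x) (h1 : x ≤ 1) (n k : ℕ) :
    ((n + k).choose k : ℝ) * x ^ k * (1 - x) ^ n ≤ 1 := by
  have h := add_pow x (1 - x) (n + k)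
  rw [add_sub_cancel, one_pow] at h
  have h2 : 0 ≤ 1 - x := by linarith
  refine le_of_le_of_eq ?_ h.symm
  refine le_trans (le_of_eq ?_) (Finset.single_le_sum (a := k) (fun i _ => by positivity)
    (Finset.mem_range.2 (by omega)))
  rw [Nat.add_sub_cancel]
  ring

/-- The Kraus weights of the amplitude damping channel with loss probability `x`. -/
def krausWeight (x : ℝ) (k n : ℕ) : ℝ := √(((n + k).choose k : ℝ) * x ^ k * (1 - x) ^ n)

theorem abs_krausWeight_le {x : ℝ} (h0 : 0 ≤ x) (h1 : x ≤ 1) (k n : ℕ) :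
    |krausWeight x k n| ≤ 1 := by
  rw [krausWeight, abs_of_nonneg (Real.sqrt_nonneg _)]
  exact Real.sqrt_le_one.2 (choose_mul_pow_le_one h0 h1 n k)

/-- The summand of the amplitude damping channel in which `k` excitations are lost. -/
def krausTerm (x : ℝ) (hx : x ∈ Set.Icc (0 : ℝ) 1) (ρ : FockSpace →L[ℂ] FockSpace) (k : ℕ) :
    FockSpace →L[ℂ] FockSpace :=
  star (star (weightedShift (krausWeight x k) (abs_krausWeight_le hx.1 hx.2 k) k)) * ρ *
    star (weightedShift (krausWeight x k) (abs_krausWeight_le hx.1 hx.2 k) k)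

section Kraus

variable {x : ℝ} (hx : x ∈ Set.Icc (0 : ℝ) 1) {ρ : FockSpace →L[ℂ] FockSpace}

theorem inner_krausTerm (k m n : ℕ) : ⟪fock m, krausTerm x hx ρ k (fock n)⟫_ℂ =
    krausWeight x k m * krausWeight x k n * ⟪fock (m + k), ρ (fock (n + k))⟫_ℂ := by
  rw [krausTerm, inner_star_mul_mul, star_weightedShift_fock, star_weightedShift_fock, map_smul,
    inner_smul_left, inner_smul_right, Complex.conj_ofReal, mul_assoc]

theorem isPositive_krausTerm (hρ : ρ.IsPositive) (k : ℕ) : (krausTerm x hx ρ k).IsPositive :=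
  isPositive_star_conj hρ _

theorem tsum_diagSum_krausTerm (hρ : IsDensity ρ) : ∑' k, diagSum (krausTerm x hx ρ k) = 1 := by
  have hx' : 0 ≤ 1 - x := by linarith [hx.2]
  have hx0 := hx.1
  rw [← (isDensity_iff.1 hρ).2]
  simp only [diagSum]
  -- Pairs of `k` lost and `n` remaining excitations are grouped by `N = n + k`. For each `N` the
  -- weights add up to `(x + (1 - x))^N = 1`.
  rw [← ENNReal.tsum_prod (f := fun k n => ENNReal.ofReal
      (⟪fock n, krausTerm x hx ρ k (fock n)⟫_ℂ).re),
    ← Finset.HasAntidiagonal.sigmaAntidiagonalEquivProd.tsum_eq, ENNReal.tsum_sigma']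
  refine tsum_congr fun N => ?_
  rw [tsum_fintype]
  have hp : 0 ≤ (⟪fock N, ρ (fock N)⟫_ℂ).re := hρ.1.re_inner_nonneg_right _
  have h1 : ∀ b : Finset.HasAntidiagonal.antidiagonal N, ENNReal.ofReal
      (⟪fock b.1.2, krausTerm x hx ρ b.1.1 (fock b.1.2)⟫_ℂ).re = ENNReal.ofReal
        ((N.choose b.1.1 • (x ^ b.1.1 * (1 - x) ^ b.1.2)) * (⟪fock N, ρ (fock N)⟫_ℂ).re) :=
    fun b => by
      have hb : b.1.2 + b.1.1 = N := by
        rw [add_comm]; exact Finset.HasAntidiagonal.mem_antidiagonal.1 b.2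
      rw [inner_krausTerm, ← Complex.ofReal_mul, Complex.re_ofReal_mul, hb, krausWeight,
        Real.mul_self_sqrt (by positivity), hb, nsmul_eq_mul, mul_assoc (N.choose b.1.1 : ℝ)]
  change ∑ b : Finset.HasAntidiagonal.antidiagonal N, ENNReal.ofReal
      (⟪fock b.1.2, krausTerm x hx ρ b.1.1 (fock b.1.2)⟫_ℂ).re = _
  simp only [h1]
  rw [← ENNReal.ofReal_sum_of_nonneg fun b _ => by positivity, ← Finset.sum_mul]
  congr 1
  rw [Finset.sum_coe_sort (Finset.HasAntidiagonal.antidiagonal N)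
      fun b => N.choose b.1 • (x ^ b.1 * (1 - x) ^ b.2),
    ← (Commute.all x (1 - x)).add_pow', add_sub_cancel, one_pow, one_mul]

/-- The amplitude damping channel with loss probability `x`. -/
def dampingChannel (ρ : FockSpace →L[ℂ] FockSpace) : FockSpace →L[ℂ] FockSpace :=
  ∑' k, krausTerm x hx ρ k

theorem isDensity_dampingChannel (hρ : IsDensity ρ) : IsDensity (dampingChannel hx ρ) :=
  isDensity_tsum (isPositive_krausTerm hx hρ.1) (tsum_diagSum_krausTerm hx hρ)

theorem hasSum_dampingChannel (hρ : IsDensity ρ) (m n : ℕ) :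
    HasSum (fun k => (krausWeight x k m * krausWeight x k n : ℂ) *
      ⟪fock (m + k), ρ (fock (n + k))⟫_ℂ) ⟪fock m, dampingChannel hx ρ (fock n)⟫_ℂ := by
  have h := hasSum_inner_of_hasSum (summable_of_diagSum (isPositive_krausTerm hx hρ.1)
    (tsum_diagSum_krausTerm hx hρ)).hasSum (fock m) (fock n)
  simp only [inner_krausTerm] at h
  exact h

end Kraus

/-! ### Matrix elements of the channel as power series -/

/-- The coefficients of the matrix elements of the amplitude damping channel as power series in
the loss probability. -/
def dampingCoeff (ρ : FockSpace →L[ℂ] FockSpace) (m n k : ℕ) : ℂ :=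
  ((√((k + m).choose m) * √((k + n).choose n) : ℝ) : ℂ) * ⟪fock (m + k), ρ (fock (n + k))⟫_ℂ

/-- The power series with coefficients `dampingCoeff`. -/
def dampingSeries (ρ : FockSpace →L[ℂ] FockSpace) (m n : ℕ) (x : ℝ) : ℂ :=
  ∑' k : ℕ, (x ^ k) • dampingCoeff ρ m n k

section Series

variable {ρ : FockSpace →L[ℂ] FockSpace}

/-- The bound grows polynomially in `k`, so the power series converges for `|x| < 1`. -/
theorem norm_dampingCoeff_le (hρ : IsDensity ρ) (m n k : ℕ) :
    ‖dampingCoeff ρ m n k‖ ≤ (k + m).choose m + (k + n).choose n := by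
  have h1 : ‖⟪fock (m + k), ρ (fock (n + k))⟫_ℂ‖ ≤ 1 := by
    have h2 : ‖ρ (fock (n + k))‖ ≤ 1 := by
      simpa [norm_fock] using ρ.le_of_opNorm_le hρ.norm_le (fock (n + k))
    simpa [norm_fock] using (norm_inner_le_norm (𝕜 := ℂ) (fock (m + k)) (ρ (fock (n + k)))).trans
      (mul_le_mul_of_nonneg_left h2 (norm_nonneg _))
  have h3 := Real.sq_sqrt (Nat.cast_nonneg (α := ℝ) ((k + m).choose m))
  have h4 := Real.sq_sqrt (Nat.cast_nonneg (α := ℝ) ((k + n).choose n))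
  rw [dampingCoeff, norm_mul, Complex.norm_real, Real.norm_eq_abs, abs_of_nonneg (by positivity)]
  refine (mul_le_of_le_one_right (by positivity) h1).trans ?_
  nlinarith [sq_nonneg (√((k + m).choose m : ℝ) - √((k + n).choose n)),
    sq_nonneg (√((k + m).choose m : ℝ) + √((k + n).choose n))]

/-- The combinatorial core of the existence proof: differentiating the series for `(m, n)` yields
the one for `(m+1, n+1)` with the factor `√(m+1) √(n+1)` of the jump term. -/
theorem succ_mul_sqrt_choose (m n k : ℕ) :
    ((k : ℝ) + 1) * (√((k + 1 + m).choose m) * √((k + 1 + n).choose n)) =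
      √((m : ℝ) + 1) * √((n : ℝ) + 1) *
        (√((k + (m + 1)).choose (m + 1)) * √((k + (n + 1)).choose (n + 1))) := by
  have key : ∀ m : ℕ, √((k : ℝ) + 1) * √((k + 1 + m).choose m) =
      √((m : ℝ) + 1) * √((k + (m + 1)).choose (m + 1)) := fun m => by
    rw [← Real.sqrt_mul (by positivity), ← Real.sqrt_mul (by positivity)]
    congr 1
    have h := Nat.choose_succ_right_eq (k + 1 + m) m
    rw [show k + 1 + m - m = k + 1 by omega] at h
    rw [show k + (m + 1) = k + 1 + m by omega]
    have h' : (((k + 1 + m).choose (m + 1) : ℝ)) * (m + 1) = (k + 1 + m).choose m * (k + 1) := by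
      exact_mod_cast h
    linarith
  calc _ = (√((k : ℝ) + 1) * √((k + 1 + m).choose m)) *
        (√((k : ℝ) + 1) * √((k + 1 + n).choose n)) := by
        nth_rw 1 [← Real.mul_self_sqrt (show (0 : ℝ) ≤ (k : ℝ) + 1 by positivity)]; ring
    _ = _ := by rw [key, key]; ring

theorem succ_mul_dampingCoeff (m n k : ℕ) : ((k : ℝ) + 1) • dampingCoeff ρ m n (k + 1) =
    (√((m : ℝ) + 1) * √((n : ℝ) + 1)) • dampingCoeff ρ (m + 1) (n + 1) k := by
  rw [dampingCoeff, dampingCoeff, Complex.real_smul, Complex.real_smul, ← mul_assoc, ← mul_assoc,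
    ← Complex.ofReal_mul, ← Complex.ofReal_mul, succ_mul_sqrt_choose,
    show m + (k + 1) = m + 1 + k by omega, show n + (k + 1) = n + 1 + k by omega]

theorem summable_dampingBound (m n : ℕ) {R : ℝ} (hR0 : 0 ≤ R) (hR : R < 1) :
    Summable fun k : ℕ => R ^ k * (((k + m).choose m : ℝ) + (k + n).choose n) := by
  have hR' : ‖R‖ < 1 := by rwa [Real.norm_eq_abs, abs_of_nonneg hR0]
  have h := (summable_choose_mul_geometric_of_norm_lt_one m hR').add
    (summable_choose_mul_geometric_of_norm_lt_one n hR')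
  refine h.congr fun k => ?_
  ring

theorem hasDerivAt_dampingSeries (hρ : IsDensity ρ) (m n : ℕ) {x : ℝ} (hx : |x| < 1) :
    HasDerivAt (dampingSeries ρ m n)
      ((√((m : ℝ) + 1) * √((n : ℝ) + 1)) • dampingSeries ρ (m + 1) (n + 1) x) x := by
  obtain ⟨R, hxR, hR⟩ := exists_between hx
  have hR0 : 0 ≤ R := (abs_nonneg x).trans hxR.le
  set g' : ℕ → ℝ → ℂ := fun k y => (k * y ^ (k - 1)) • dampingCoeff ρ m n k with hg'
  have hg'_succ : ∀ k y, g' (k + 1) y =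
      (√((m : ℝ) + 1) * √((n : ℝ) + 1)) • (y ^ k) • dampingCoeff ρ (m + 1) (n + 1) k :=
    fun k y => by
      simp only [hg', Nat.add_sub_cancel, Nat.cast_add, Nat.cast_one]
      rw [mul_comm, mul_smul, succ_mul_dampingCoeff, smul_comm]
  -- The derivative of the constant term is zero; the others are bounded on the ball of radius `R <
  -- 1` by the shifted series.
  set u : ℕ → ℝ := fun k => Nat.casesOn k 0 fun k => (√((m : ℝ) + 1) * √((n : ℝ) + 1)) *
    (R ^ k * (((k + (m + 1)).choose (m + 1) : ℝ) + (k + (n + 1)).choose (n + 1))) with hu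
  have hsum : Summable u := by
    rw [← summable_nat_add_iff 1]
    exact (summable_dampingBound (m + 1) (n + 1) hR0 hR).mul_left _
  have hbound : ∀ k, ∀ y ∈ Metric.ball (0 : ℝ) R, ‖g' k y‖ ≤ u k := fun k y hy => by
    rcases k with _ | k
    · simp [hg', hu]
    · rw [hg'_succ, norm_smul, norm_smul, norm_pow, Real.norm_eq_abs, abs_of_nonneg (by positivity)]
      have hy' : ‖y‖ ≤ R := by simpa using (Metric.mem_ball.1 hy).le
      have := norm_dampingCoeff_le hρ (m + 1) (n + 1) k
      simp only [hu]
      gcongr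
  have h := hasDerivAt_tsum_of_isPreconnected (g := fun k y => (y ^ k) • dampingCoeff ρ m n k)
    (g' := g') hsum Metric.isOpen_ball (convex_ball (0 : ℝ) R).isPreconnected
    (fun k y _ => (hasDerivAt_pow k y).smul_const _) hbound
    (Metric.mem_ball_self ((abs_nonneg x).trans_lt hxR))
    (summable_of_ne_finset_zero (s := {0}) fun k hk => by
      rw [zero_pow (by simpa using hk), zero_smul])
    (y := x) (by simpa using hxR)
  refine h.congr_deriv ?_
  have hs : Summable fun k => g' k x :=
    Summable.of_norm_bounded hsum fun k => hbound k x (by simpa using hxR)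
  rw [hs.tsum_eq_zero_add]
  simp only [hg'_succ]
  rw [dampingSeries, ← tsum_const_smul'']
  simp [hg']

theorem dampingSeries_zero (m n : ℕ) : dampingSeries ρ m n 0 = ⟪fock m, ρ (fock n)⟫_ℂ := by
  rw [dampingSeries, tsum_eq_single 0 fun k hk => by rw [zero_pow hk, zero_smul]]
  simp [dampingCoeff]

end Series

theorem clm_ext_of_inner_fock {A B : FockSpace →L[ℂ] FockSpace}
    (h : ∀ m n, ⟪fock m, A (fock n)⟫_ℂ = ⟪fock m, B (fock n)⟫_ℂ) : A = B := by
  refine clm_ext_of_toFock fun f => ?_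
  induction f using Finsupp.induction_linear with
  | zero => simp
  | add f g hf hg => rw [map_add, map_add, map_add, hf, hg]
  | single n c =>
    rw [toFock_single, map_smul, map_smul]
    congr 1
    ext m
    rw [← inner_fock_left, ← inner_fock_left, h]

/-! ### Existence for the damped oscillator -/

theorem lindbladForm_add_left (H L : Op) (ρ : FockSpace →L[ℂ] FockSpace) (f f' g : FiniteFock) :
    lindbladForm H L ρ (f + f') g = lindbladForm H L ρ f g + lindbladForm H L ρ f' g := by
  simp only [lindbladForm, map_add, inner_add_left]
  ring

theorem lindbladForm_add_right (H L : Op) (ρ : FockSpace →L[ℂ] FockSpace) (f g g' : FiniteFock) :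
    lindbladForm H L ρ f (g + g') = lindbladForm H L ρ f g + lindbladForm H L ρ f g' := by
  simp only [lindbladForm, map_add, inner_add_right]
  ring

theorem lindbladForm_smul (H L : Op) (ρ : FockSpace →L[ℂ] FockSpace) (c d : ℂ)
    (f g : FiniteFock) :
    lindbladForm H L ρ (c • f) (d • g) = conj c * d * lindbladForm H L ρ f g := by
  simp only [lindbladForm, map_smul, inner_smul_left, inner_smul_right]
  ring

theorem isLindbladSolution_of_fock {H L : Op} {ρ : ℝ → FockSpace →L[ℂ] FockSpace}
    (hρ : ∀ τ, 0 ≤ τ → IsDensity (ρ τ))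
    (h : ∀ m n τ, 0 ≤ τ → HasDerivWithinAt (fun s => ⟪fock m, ρ s (fock n)⟫_ℂ)
      (lindbladForm H L (ρ τ) (Finsupp.single m 1) (Finsupp.single n 1)) (Set.Ici 0) τ) :
    IsLindbladSolution H L ρ := by
  refine ⟨hρ, fun f g τ hτ => ?_⟩
  induction f using Finsupp.induction_linear with
  | zero =>
    have := lindbladForm_smul H L (ρ τ) 0 1 0 g
    simp only [zero_smul, one_smul, map_zero, zero_mul] at this
    simpa [this] using hasDerivWithinAt_const τ (Set.Ici 0) (0 : ℂ)
  | add f f' hf hf' =>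
    rw [lindbladForm_add_left]
    simp only [map_add, inner_add_left]
    exact hf.add hf'
  | single m c =>
    induction g using Finsupp.induction_linear with
    | zero =>
      have := lindbladForm_smul H L (ρ τ) 1 0 (Finsupp.single m c) 0
      simp only [zero_smul, one_smul, mul_zero, zero_mul] at this
      simpa [this] using hasDerivWithinAt_const τ (Set.Ici 0) (0 : ℂ)
    | add g g' hg hg' =>
      rw [lindbladForm_add_right]
      simp only [map_add, inner_add_right]
      exact hg.add hg'
    | single n d =>
      have h1 := (h m n τ hτ).const_mul (conj c * d)
      rw [← lindbladForm_smul] at h1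
      simp only [Finsupp.smul_single, smul_eq_mul, mul_one] at h1
      refine h1.congr_of_eventuallyEq (Eventually.of_forall fun s => ?_) ?_ <;>
      · simp only [toFock_single, map_smul, inner_smul_left, inner_smul_right]
        ring

/-- The cut-off `max τ 0` makes the channel meaningful for every real `τ`; only `τ ≥ 0` matters for
a solution. -/
theorem loss_mem_Icc {κ : ℝ} (hκ : 0 < κ) (τ : ℝ) :
    1 - Real.exp (-κ * max τ 0) ∈ Set.Icc (0 : ℝ) 1 := by
  have h1 : Real.exp (-κ * max τ 0) ≤ 1 := by
    rw [Real.exp_le_one_iff]; nlinarith [le_max_right τ 0]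
  have h2 := Real.exp_pos (-κ * max τ 0)
  constructor <;> linarith

/-- The exponential accounts for the loss term of the generator, and the remaining power series in
the loss probability for the jump term. -/
theorem krausWeight_mul (κ τ : ℝ) (hx : 0 ≤ 1 - Real.exp (-κ * τ)) (k m n : ℕ) :
    krausWeight (1 - Real.exp (-κ * τ)) k m * krausWeight (1 - Real.exp (-κ * τ)) k n =
      Real.exp (-(κ * ((m + n) / 2)) * τ) * (1 - Real.exp (-κ * τ)) ^ k *
        (√((k + m).choose m) * √((k + n).choose n)) := by
  have key : ∀ m : ℕ, krausWeight (1 - Real.exp (-κ * τ)) k m =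
      √((k + m).choose m) * √((1 - Real.exp (-κ * τ)) ^ k) * Real.exp (m * (-κ * τ) / 2) :=
    fun m => by
      rw [krausWeight, sub_sub_cancel, ← Real.exp_nat_mul, Real.exp_half,
        Real.sqrt_mul (by positivity), Real.sqrt_mul (by positivity), add_comm m k,
        Nat.choose_symm_add]
  rw [key, key]
  have h1 := Real.mul_self_sqrt (pow_nonneg hx k)
  have h2 : Real.exp (-(κ * (((m : ℝ) + n) / 2)) * τ) =
      Real.exp (m * (-κ * τ) / 2) * Real.exp (n * (-κ * τ) / 2) := by
    rw [← Real.exp_add]; congr 1; ring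
  rw [h2]
  calc _ = (√((1 - Real.exp (-κ * τ)) ^ k) * √((1 - Real.exp (-κ * τ)) ^ k)) *
        (√((k + m).choose m) * √((k + n).choose n)) *
        (Real.exp (m * (-κ * τ) / 2) * Real.exp (n * (-κ * τ) / 2)) := by ring
    _ = _ := by rw [h1]; ring

theorem exists_damping_solution {κ : ℝ} (hκ : 0 < κ) {σ : ℂ} (hσ : σ * conj σ = κ)
    {ρ₀ : FockSpace →L[ℂ] FockSpace} (hρ₀ : IsDensity ρ₀) :
    ∃ ρ, IsLindbladSolution 0 (linOp σ 0 0) ρ ∧ ρ 0 = ρ₀ := by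
  set ρ : ℝ → FockSpace →L[ℂ] FockSpace := fun τ => dampingChannel (loss_mem_Icc hκ τ) ρ₀ with hρ
  have hentry : ∀ m n τ, 0 ≤ τ → ⟪fock m, ρ τ (fock n)⟫_ℂ =
      Real.exp (-(κ * ((m + n) / 2)) * τ) • dampingSeries ρ₀ m n (1 - Real.exp (-κ * τ)) :=
    fun m n τ hτ => by
      have h1 := hasSum_dampingChannel (loss_mem_Icc hκ τ) hρ₀ m n
      have h2 := (loss_mem_Icc hκ τ).1
      rw [← h1.tsum_eq, dampingSeries, ← tsum_const_smul'']
      refine tsum_congr fun k => ?_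
      rw [max_eq_left hτ] at h2 ⊢
      rw [← Complex.ofReal_mul, krausWeight_mul κ τ h2, dampingCoeff]
      simp only [Complex.real_smul]
      push_cast
      ring
  refine ⟨ρ, isLindbladSolution_of_fock (fun τ _ => isDensity_dampingChannel _ hρ₀)
    fun m n τ hτ => ?_, clm_ext_of_inner_fock fun m n => ?_⟩
  · have hx : |1 - Real.exp (-κ * τ)| < 1 := by
      have h2 := (loss_mem_Icc hκ τ).1
      rw [max_eq_left hτ] at h2
      rw [abs_of_nonneg h2]
      linarith [Real.exp_pos (-κ * τ)]
    have h1 : HasDerivAt (fun τ => 1 - Real.exp (-κ * τ)) (κ * Real.exp (-κ * τ)) τ := by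
      refine ((((hasDerivAt_id τ).const_mul (-κ)).exp).const_sub 1).congr_deriv ?_
      simp only [id]; ring
    have h2 := (hasDerivAt_dampingSeries hρ₀ m n hx).scomp τ h1
    have h3 : HasDerivAt (fun τ => Real.exp (-(κ * (((m : ℝ) + n) / 2)) * τ))
        (-(κ * ((m + n) / 2)) * Real.exp (-(κ * ((m + n) / 2)) * τ)) τ := by
      refine (((hasDerivAt_id τ).const_mul _).exp).congr_deriv ?_
      simp only [id]; ring
    have h4 := (h3.smul h2).hasDerivWithinAt (s := Set.Ici 0)
    rw [lindbladForm_damping, hσ, hentry _ _ τ hτ, hentry _ _ τ hτ]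
    refine (h4.congr (fun s hs => hentry m n s hs) (hentry m n τ hτ)).congr_deriv ?_
    -- The factor `e^{-κτ}` from differentiating the loss probability is the ratio of the
    -- exponentials belonging to `(m+1, n+1)` and `(m, n)`.
    have h5 : Real.exp (-(κ * ((((m + 1 : ℕ) : ℝ) + (n + 1 : ℕ)) / 2)) * τ) =
        Real.exp (-(κ * ((m + n) / 2)) * τ) * Real.exp (-κ * τ) := by
      rw [← Real.exp_add]; congr 1; push_cast; ring
    rw [h5]
    simp only [Complex.real_smul, Function.comp_apply]
    push_cast
    ring
  · rw [hentry m n 0 le_rfl]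
    simp [dampingSeries_zero]

/-! ### Reduction to the damped oscillator -/

theorem isLindbladSolution_gauge_iff {h l μ c : ℂ} (hl : conj l = l)
    (hc : Complex.I * h = 1 / 2 * (μ * conj c)) (ρ : ℝ → FockSpace →L[ℂ] FockSpace) :
    IsLindbladSolution (linOp h (conj h) l) (linOp μ 0 c) ρ ↔
      IsLindbladSolution 0 (linOp μ 0 0) ρ := by
  simp only [IsLindbladSolution, lindbladForm_gauge hl rfl hc]

/-- A canonical transformation that diagonalises the coupling operator, with a compatible
displacement, turns the equation into that of a damped oscillator. -/
theorem isLindbladSolution_iff_damping {U : FockSpace →L[ℂ] FockSpace}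
    (hU : U ∈ unitary (FockSpace →L[ℂ] FockSpace)) {C : ℝ} {s α h μ : ℂ}
    (hC : (C : ℂ) ^ 2 - s * conj s = 1) (hB : IsBogoliubov U C (-s) α)
    (hB' : IsBogoliubov (star U) C s (-(C * α + s * conj α)))
    (hh : Complex.I * h = 1 / 2 * (μ * conj μ) * conj α) (ρ : ℝ → FockSpace →L[ℂ] FockSpace) :
    IsLindbladSolution (linOp h (conj h) 0) (linOp (μ * C) (μ * s) 0) ρ ↔
      IsLindbladSolution 0 (linOp μ 0 0) fun τ => star U * ρ τ * U := by
  have hh' := congrArg conj hh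
  simp only [map_mul, Complex.conj_I, map_div₀, map_one, map_ofNat, Complex.conj_conj] at hh'
  have hl : conj (h * α + conj h * conj α) = h * α + conj h * conj α := by
    simp only [map_add, map_mul, Complex.conj_conj]; ring
  -- The gauge condition in the new frame: the transformed coupling is `μ a + μ (C α + s α*)`, and
  -- the condition combines `hh` with its conjugate.
  have hc : Complex.I * (h * C - conj h * conj s) =
      1 / 2 * (μ * conj (μ * (C * α + s * conj α))) := by
    simp only [map_add, map_mul, Complex.conj_conj, Complex.conj_ofReal]
    linear_combination (C : ℂ) * hh + conj s * hh'
  rw [← isLindbladSolution_gauge_iff hl hc]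
  constructor
  · intro hρ
    convert! hρ.bogoliubov hU hB using 2 <;>
      try simp only [map_neg, map_sub, map_mul, Complex.conj_ofReal, Complex.conj_conj]
    · ring
    · ring
    · ring
    · linear_combination (-μ) * hC
    · ring
    · ring
  · intro hρ
    have h1 : ∀ τ, star (star U) * (star U * ρ τ * U) * star U = ρ τ := fun τ => by
      have h2 : U * star U = 1 := Unitary.mul_star_self_of_mem hU
      rw [star_star, show U * (star U * ρ τ * U) * star U = (U * star U) * ρ τ * (U * star U) by
        simp only [mul_assoc], h2, one_mul, mul_one]
    have h3 := hρ.bogoliubov (Unitary.star_mem hU) hB'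
    simp only [h1] at h3
    convert! h3 using 2 <;>
      try simp only [map_neg, map_sub, map_add, map_mul, Complex.conj_ofReal, Complex.conj_conj]
    · linear_combination (-h) * hC
    · linear_combination (-conj h) * hC
    · linear_combination (h * α + conj h * conj α) * hC
    · ring
    · ring
    · ring

theorem isLindbladSolution_damping_vacuum (σ : ℂ) :
    IsLindbladSolution 0 (linOp σ 0 0) fun _ => proj (fock 0) := by
  refine isLindbladSolution_of_fock (fun τ _ => isDensity_proj (norm_fock 0)) fun m n τ _ => ?_
  refine (hasDerivWithinAt_const τ _ _).congr_deriv ?_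
  rw [lindbladForm_damping]
  simp only [proj_apply, inner_smul_right, inner_fock_left, fock_apply]
  rcases m with _ | m <;> rcases n with _ | n <;> simp

theorem unitary_conj_proj (U : FockSpace →L[ℂ] FockSpace) (ψ : FockSpace) :
    star U * proj (U ψ) * U = proj (star U (U ψ)) := by
  ext1 x
  rw [mul_assoc, mul_apply_eq_comp, mul_apply_eq_comp, proj_apply, proj_apply, map_smul,
    ContinuousLinearMap.star_eq_adjoint, ContinuousLinearMap.adjoint_inner_left]

/-- Trace norm convergence to a pure state follows from convergence of its population. -/
theorem tendsto_traceNorm_sub_proj {ρ : ℝ → FockSpace →L[ℂ] FockSpace} {ψ : FockSpace}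
    (hρ : ∀ τ, 0 ≤ τ → IsDensity (ρ τ)) (hψ : ‖ψ‖ = 1)
    (h : Tendsto (fun τ => population ψ (ρ τ)) atTop (𝓝 1)) :
    Tendsto (fun τ => traceNorm (ρ τ - proj ψ)) atTop (𝓝 0) := by
  have h1 : Tendsto (fun τ => ENNReal.ofReal (2 * (1 - population ψ (ρ τ)) ^ (1 / 3 : ℝ))) atTop
      (𝓝 0) := by
    have h2 : Tendsto (fun τ => 2 * (1 - population ψ (ρ τ)) ^ (1 / 3 : ℝ)) atTop (𝓝 0) := by
      simpa using ((h.const_sub 1).rpow_const (p := 1 / 3) (Or.inr (by norm_num))).const_mul 2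
    simpa using ENNReal.tendsto_ofReal h2
  refine tendsto_of_tendsto_of_tendsto_of_le_of_le' tendsto_const_nhds h1
    (Eventually.of_forall fun _ => zero_le) ?_
  filter_upwards [eventually_ge_atTop 0] with τ hτ
  obtain ⟨l, hl0, hl, heq⟩ := traceNorm_sub_proj (hρ τ hτ) hψ
  rw [heq]
  refine ENNReal.ofReal_le_ofReal (mul_le_mul_of_nonneg_left ?_ zero_le_two)
  calc l = (l ^ 3) ^ (1 / 3 : ℝ) := by
        rw [← Real.rpow_natCast, ← Real.rpow_mul hl0]; norm_num
    _ ≤ _ := Real.rpow_le_rpow (by positivity) hl (by norm_num)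

theorem opH_eq (θ : ℝ) (βgg βge βeg βee : ℂ) : opH θ βgg βge βeg βee =
    linOp (-Complex.I * θ * (βgg * (conj βge + conj βeg) + conj βee * (βge + βeg)))
      (conj (-Complex.I * θ * (βgg * (conj βge + conj βeg) + conj βee * (βge + βeg)))) 0 := by
  have h1 : opQ βgg βge βeg βee =
      linOp (βgg * (conj βge + conj βeg) + conj βee * (βge + βeg)) 0 0 := by
    simp [opQ, linOp]
  rw [opH, h1, dag_linOp, op_sub_eq]
  simp only [linOp, map_zero, zero_smul, add_zero, zero_add, smul_add, smul_smul, map_mul, map_neg,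
    Complex.conj_I, Complex.conj_ofReal]
  congr 2
  ring

theorem opL_eq (θ : ℝ) (βgg βee : ℂ) : opL θ βgg βee =
    linOp (((√2 * θ : ℝ) : ℂ) * βgg) (-(((√2 * θ : ℝ) : ℂ) * βee)) 0 := by
  rw [opL, op_sub_eq]
  simp only [linOp, zero_smul, add_zero, smul_add, smul_smul]
  congr 2
  ring

/-- The steady state and the convergence of all solutions of an equation that a displaced
squeezing transformation takes to a damped oscillator. -/
theorem stabilises_squeezedState {H L : Op} {α ζ μ : ℂ} {κ : ℝ} (hκ : 0 < κ)
    (hμ : μ * conj μ = κ) (hU : squeezeDisplace α ζ ∈ unitary (FockSpace →L[ℂ] FockSpace))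
    (hiff : ∀ ρ, IsLindbladSolution H L ρ ↔ IsLindbladSolution 0 (linOp μ 0 0)
      fun τ => star (squeezeDisplace α ζ) * ρ τ * squeezeDisplace α ζ) :
    IsLindbladSolution H L (fun _ => proj (squeezedState α ζ)) ∧
    (∀ ρ₀, IsDensity ρ₀ → ∃ ρ, IsLindbladSolution H L ρ ∧ ρ 0 = ρ₀) ∧
    ∀ ρ, IsLindbladSolution H L ρ →
      Tendsto (fun τ => traceNorm (ρ τ - proj (squeezedState α ζ))) atTop (𝓝 0) ∧
      (∀ τ, 0 ≤ τ → meanExcitation α ζ (ρ τ) =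
        ENNReal.ofReal (Real.exp (-κ * τ)) * meanExcitation α ζ (ρ 0)) ∧
      (∀ τ, 0 ≤ τ → ENNReal.ofReal (1 - population (squeezedState α ζ) (ρ τ)) ≤
        ENNReal.ofReal (Real.exp (-κ * τ)) * meanExcitation α ζ (ρ 0)) ∧
      Tendsto (fun τ => ENNReal.ofReal
        (Real.exp (κ * τ) * (1 - population (squeezedState α ζ) (ρ τ))))
        atTop (𝓝 (meanExcitation α ζ (ρ 0))) := by
  set U := squeezeDisplace α ζ with hUdef
  have hψ : squeezedState α ζ = U (fock 0) := rfl
  have hUU : star U * U = 1 := Unitary.star_mul_self_of_mem hU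
  have hUU' : U * star U = 1 := Unitary.mul_star_self_of_mem hU
  have hsU : ∀ x, star U (U x) = x := fun x => by
    rw [← mul_apply_eq_comp, hUU, one_apply_eq_self]
  refine ⟨?_, fun ρ₀ hρ₀ => ?_, fun ρ hρ => ?_⟩
  · rw [hiff]
    simp only [hψ, unitary_conj_proj, hsU]
    exact isLindbladSolution_damping_vacuum μ
  · obtain ⟨ρ, hρ, h0⟩ := exists_damping_solution hκ hμ (hρ₀.unitary_conj hU)
    refine ⟨fun τ => U * ρ τ * star U, ?_, ?_⟩
    · rw [hiff]
      convert! hρ using 2 with τ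
      rw [show star U * (U * ρ τ * star U) * U = (star U * U) * ρ τ * (star U * U) by
        simp only [mul_assoc], hUU, one_mul, mul_one]
    · change U * ρ 0 * star U = ρ₀
      rw [h0, show U * (star U * ρ₀ * U) * star U = (U * star U) * ρ₀ * (U * star U) by
        simp only [mul_assoc], hUU', one_mul, mul_one]
  · have hdeath := ((hiff ρ).1 hρ).isPureDeath hκ hμ
    -- Fock populations in the transformed frame are the populations of the displaced squeezed Fock
    -- states, so `p τ 0` is the population of `|ψ⟩` and the mean of `p τ` is `meanExcitation`.
    simp only [inner_star_mul_mul] at hdeath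
    refine ⟨tendsto_traceNorm_sub_proj hρ.1 ?_ hdeath.tendsto_vacuum,
      fun τ hτ => hdeath.meanValue_eq hτ, fun τ hτ => hdeath.ofReal_one_sub_vacuum_le hτ,
      hdeath.tendsto_exp_mul_one_sub_vacuum⟩
    rw [hψ, norm_unitary_apply hU, norm_fock]

end Oscillator

end

open Oscillator

/-! ### Matching the physical parameters -/

theorem theorem1 (θ : ℝ) (hθ : 0 < θ)
    (βgg βge βeg βee : ℂ)
    (hnorm : ‖βgg‖ ^ 2 + ‖βge‖ ^ 2 + ‖βeg‖ ^ 2 + ‖βee‖ ^ 2 = 1)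
    (hlt : ‖βee‖ < ‖βgg‖)
    (φgg φee : ℝ)
    (hgg : βgg = ‖βgg‖ * Complex.exp (φgg * Complex.I))
    (hee : βee = ‖βee‖ * Complex.exp (φee * Complex.I))
    (ε : ℂ) (hε : βge + βeg = ε)
    (r φr : ℝ) (ζ α : ℂ) (κ : ℝ)
    (hr : Real.tanh (-r) = ‖βee‖ / ‖βgg‖)
    (hφ : ∃ k : ℤ, φr = φee - φgg + 2 * Real.pi * k)
    (hζ : ζ = r * Complex.exp (φr * Complex.I))
    (hα : α = (ε * conj βgg + conj ε * βee) / (θ * (‖βgg‖ ^ 2 - ‖βee‖ ^ 2)))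
    (hκ : κ = 2 * θ ^ 2 * (‖βgg‖ ^ 2 - ‖βee‖ ^ 2)) :
    -- the displaced squeezed state is a steady state
    IsLindbladSolution (opH θ βgg βge βeg βee) (opL θ βgg βee)
      (fun _ => proj (squeezedState α ζ)) ∧
    -- the equation can be solved from every initial state
    (∀ ρ₀, IsDensity ρ₀ → ∃ ρ,
      IsLindbladSolution (opH θ βgg βge βeg βee) (opL θ βgg βee) ρ ∧ ρ 0 = ρ₀) ∧
    -- every solution converges to it, at rate `κ`
    ∀ ρ, IsLindbladSolution (opH θ βgg βge βeg βee) (opL θ βgg βee) ρ →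
      Filter.Tendsto (fun τ => traceNorm (ρ τ - proj (squeezedState α ζ))) Filter.atTop (𝓝 0) ∧
      (∀ τ, 0 ≤ τ → meanExcitation α ζ (ρ τ) =
        ENNReal.ofReal (Real.exp (-κ * τ)) * meanExcitation α ζ (ρ 0)) ∧
      (∀ τ, 0 ≤ τ → ENNReal.ofReal (1 - population (squeezedState α ζ) (ρ τ)) ≤
        ENNReal.ofReal (Real.exp (-κ * τ)) * meanExcitation α ζ (ρ 0)) ∧
      Filter.Tendsto (fun τ => ENNReal.ofReal
        (Real.exp (κ * τ) * (1 - population (squeezedState α ζ) (ρ τ))))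
        Filter.atTop (𝓝 (meanExcitation α ζ (ρ 0))) := by
  have hgg0 : 0 < ‖βgg‖ := (norm_nonneg _).trans_lt hlt
  have hΔ : 0 < ‖βgg‖ ^ 2 - ‖βee‖ ^ 2 := by nlinarith [norm_nonneg βee]
  have hκ0 : 0 < κ := by rw [hκ]; positivity
  set e : ℂ := Complex.exp (φr * Complex.I) with he_def
  have he : e * conj e = 1 := by
    rw [Complex.mul_conj, Complex.normSq_eq_norm_sq, he_def, Complex.norm_exp_ofReal_mul_I]
    simp
  have hcosh := Real.cosh_pos r
  have hcs := Real.cosh_sq_sub_sinh_sq r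
  have hcosh0 : (Real.cosh r : ℂ) ≠ 0 := Complex.ofReal_ne_zero.2 hcosh.ne'
  have hsinh : ‖βgg‖ * Real.sinh r = -(‖βee‖ * Real.cosh r) := by
    rw [Real.tanh_neg, Real.tanh_eq_sinh_div_cosh] at hr
    field_simp at hr
    linarith
  have hphase : βgg * e = ‖βgg‖ * Complex.exp (φee * Complex.I) := by
    obtain ⟨k, hk⟩ := hφ
    rw [he_def, hk]
    nth_rewrite 1 [hgg]
    rw [mul_assoc, ← Complex.exp_add, show (φgg : ℂ) * Complex.I +
      ((φee - φgg + 2 * Real.pi * k : ℝ) : ℂ) * Complex.I =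
        φee * Complex.I + k * (2 * Real.pi * Complex.I) by push_cast; ring, Complex.exp_add,
      Complex.exp_int_mul_two_pi_mul_I, mul_one]
  have hsqueeze : βgg * (e * Real.sinh r) = -(βee * Real.cosh r) := by
    rw [← mul_assoc, hphase]
    have := congrArg (fun x : ℝ => (x : ℂ)) hsinh
    simp only [Complex.ofReal_mul, Complex.ofReal_neg] at this
    linear_combination Complex.exp (φee * Complex.I) * this + (Real.cosh r : ℂ) * hee
  -- Chosen so that `L₁ = μ (cosh r a + e sinh r a†)`; then `|μ|² = 2θ² |β_gg|² (1 - tanh² r) = κ`.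
  set μ : ℂ := ((√2 * θ : ℝ) : ℂ) * βgg / (Real.cosh r : ℂ) with hμ_def
  have hμC : μ * (Real.cosh r : ℂ) = ((√2 * θ : ℝ) : ℂ) * βgg := div_mul_cancel₀ _ hcosh0
  have hμs : μ * (e * Real.sinh r) = -(((√2 * θ : ℝ) : ℂ) * βee) := by
    rw [hμ_def, div_mul_eq_mul_div, div_eq_iff hcosh0]
    linear_combination ((√2 * θ : ℝ) : ℂ) * hsqueeze
  have hμ : μ * conj μ = κ := by
    rw [Complex.mul_conj, Complex.normSq_eq_norm_sq, Complex.ofReal_inj, hμ_def, norm_div,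
      norm_mul, Complex.norm_real, Complex.norm_real, div_pow, mul_pow, Real.norm_eq_abs,
      Real.norm_eq_abs, sq_abs, sq_abs, mul_pow, Real.sq_sqrt zero_le_two, hκ,
      div_eq_iff (by positivity)]
    linear_combination (-2 * θ ^ 2 * (‖βgg‖ * Real.sinh r - ‖βee‖ * Real.cosh r)) * hsinh -
      2 * θ ^ 2 * ‖βgg‖ ^ 2 * hcs
  have hΔ' : (θ : ℂ) * ((‖βgg‖ : ℂ) ^ 2 - (‖βee‖ : ℂ) ^ 2) ≠ 0 := by
    exact_mod_cast (mul_pos hθ hΔ).ne'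
  -- This cancellation condition fixes `α`: it reads `θ (β_gg ε* + β_ee* ε) = κ α* / 2`.
  have hh : Complex.I * (-Complex.I * θ * (βgg * (conj βge + conj βeg) +
      conj βee * (βge + βeg))) = 1 / 2 * (μ * conj μ) * conj α := by
    have h1 := (eq_div_iff hΔ').1 hα
    have h2 := congrArg conj h1
    simp only [map_mul, map_sub, map_pow, map_add, Complex.conj_ofReal, Complex.conj_conj, ← hε]
      at h2
    rw [hμ, hκ]
    push_cast
    linear_combination (-θ : ℂ) * h2 - (θ * (βgg * (conj βge + conj βeg) +
      conj βee * (βge + βeg))) * Complex.I_sq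
  obtain ⟨hU, hB, hB'⟩ := squeezeDisplace_spec α he (r := r)
  rw [opH_eq, opL_eq, ← hμC, ← hμs, hζ]
  refine stabilises_squeezedState hκ0 hμ hU
    (isLindbladSolution_iff_damping hU ?_ hB hB' hh)
  have hcs' := congrArg (fun x : ℝ => (x : ℂ)) hcs
  simp only [Complex.ofReal_sub, Complex.ofReal_pow, Complex.ofReal_one] at hcs'
  rw [map_mul, Complex.conj_ofReal]
  linear_combination hcs' - (Real.sinh r : ℂ) ^ 2 * he
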